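/- Let $\Lambda>0$, $\tau_0<0$, and work on $\{\tau_0<\tau<0\}\times\mathbb R^3$ in units $8\pi G=c=1$; a prime denotes $\partial_\tau$. Let $(a,\rho_B)$ be a background spatially flat FLRW dust solution of the Einstein equations with cosmological constant $\Lambda$, i.e. the metric $a(\tau)^2(-d\tau^2+\delta_{ij}dx^idx^j)$ with dust of density $\rho_B(\tau)>0$ and velocity $a^{-1}\partial_\tau$, where $a>0$ is smooth and conformal time is normalized so that $a\to\infty$ as $\tau\to0^-$. Let $a_{dS}(\tau)=-\sqrt{3/\Lambda}\,\tau^{-1}$. (0) $\rho_B=\rho_0a^{-3}$ for a constant $\rho_0>0$, and $a/a_{dS}\to1$ as $\tau\to0^-$. (1) Let $\gamma_{ij}(\tau,x)$ be a smooth symmetric perturbation and $\rho_1(\tau,x)$ a density perturbation such that the synchronous metrics $g_\varepsilon=a^2(-d\tau^2+(\delta_{ij}+\varepsilon\gamma_{ij})dx^idx^j)$ with comoving dust of density $\rho_B+\varepsilon\rho_1$ satisfy the Einstein equations to first order in $\varepsilon$. Then $\gamma_{ij}$ converges as $\tau\to0^-$, locally uniformly in $x$, to a continuous time-independent $\gamma^\infty_{ij}(x)$,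 and $g_\varepsilon$ approaches de Sitter locally: whenever $\delta+\varepsilon\gamma^\infty(x_0)$ is positive definite (which for $x_0$ in a given compact set holds for all small $\varepsilon$), there is an invertible matrix $M$ such that the pullbacks of $g_\varepsilon$ by $(\eta,y)\mapsto(s\eta,\,x_0+sMy)$ converge as $s\to0^+$, uniformly on compact subsets of $\{\eta<0\}\times\mathbb R^3$, to the de Sitter metric $\frac{3}{\Lambda\eta^2}(-d\eta^2+\delta_{ij}dy^idy^j)$. (2) Suppose in addition that $\gamma_{ij}=-2\phi\,\delta_{ij}+(\partial_i\partial_j-\frac13\delta_{ij}\Delta)\chi+\partial_iZ_j+\partial_jZ_i+\pi_{ij}$, with $\phi,\chi,Z,\pi$ smooth and vanishing with all their derivatives at spatial infinity at each time, $Z$ divergence-free, $\pi$ symmetric, transverse and trace-free. Then $\rho_1=3\rho_B(\phi+D)$ for some $D(x)$, $\phi+D$ satisfies the scalar equation $f''+\frac{a'}af'-\frac12a^2\rho_Bf=0$, $Z'=0$, $\pi_{ij}$ satisfies the tensor equation $f''+2\frac{a'}af'-\Delta f=0$, and $\phi$, $Z_i$, $\pi_{ij}$ all tend, locally uniformly in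 $x$, to functions constant in time as $\tau\to0^-$. (3) Every smooth solution of the scalar equation, and every smooth solution of the tensor equation, tends, locally uniformly in $x$, to a function constant in time as $\tau\to0^-$. Every smooth solution of the vector equation $Z'+\frac{a'}aZ=0$ has the form $Z=C(x)/a$ with $C$ smooth, and tends to $0$ locally uniformly. (4) Let the scale factor be replaced by its asymptotic form $a_{dS}$ in the mode equations, with $\rho_B=\rho_0a_{dS}^{-3}$, $\rho_0>0$, and let $A=\big(\frac12\rho_0\sqrt{\Lambda/3}\big)^{1/2}$. Every smooth solution of the scalar equation is $\phi=C_1(x)\,\tau\,Y_{2/3}(\frac23A\tau^{3/2})+C_2(x)\,\tau\,J_{2/3}(\frac23A\tau^{3/2})$ with complex-valued $C_1,C_2\in C^2$ (principal branches); conversely, for constants $C_1,C_2$ this function solves the equation and has a limit as $\tau\to0^-$. For $q>0$, the solutions of $f''+2\frac{a_{dS}'}{a_{dS}}f'+q^2f=0$ are exactly $K(\sin q\tau-q\tau\cos q\tau)+F(\cos q\tau+q\tau\sin q\tau)$, with constants $K,F$. For functions $K,F$ of the wave vector $\mathbf q\in\mathbb R^3$, put $$\pi(\tau,x)=\int_{\mathbb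 R^3}\big[K(\mathbf q)(\sin q\tau-q\tau\cos q\tau)+F(\mathbf q)(\cos q\tau+q\tau\sin q\tau)\big]e^{-i\mathbf q\cdot x}\,d\mathbf q,\qquad q=|\mathbf q|.$$ If $(1+q)^3K$ and $(1+q)^3F$ are integrable, $\pi$ solves the tensor equation; if $(1+q)K$ and $(1+q)F$ are integrable, $\pi\to\int_{\mathbb R^3}F(\mathbf q)e^{-i\mathbf q\cdot x}\,d\mathbf q$ locally uniformly in $x$ as $\tau\to0^-$. -/

import Mathlib

open Set Filter Topology MeasureTheory
open scoped ContDiff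

namespace DustPert

noncomputable section

/-! ### Coordinates, partial derivatives, curvature -/

/-- Flat space `ℝ³`. -/
abbrev Space : Type := EuclideanSpace ℝ (Fin 3)

/-- Coordinates `(τ, x¹, x², x³)` on spacetime; the index `0` is the time direction. -/
abbrev Spacetime : Type := ℝ × Space

/-- The coordinate vector field `∂_μ`. -/
def basisVec (μ : Fin 4) : Spacetime :=
  Fin.cases ((1 : ℝ), (0 : Space)) (fun i => ((0 : ℝ), EuclideanSpace.single i (1 : ℝ))) μ

/-- The `μ`-th coordinate of a point or a tangent vector. -/
def coord (μ : Fin 4) (v : Spacetime) : ℝ :=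
  Fin.cases v.1 (fun i => v.2 i) μ

/-- The partial derivative `∂_μ f`. -/
def pd {E : Type*} [NormedAddCommGroup E] [NormedSpace ℝ E]
    (μ : Fin 4) (f : Spacetime → E) (p : Spacetime) : E :=
  fderiv ℝ f p (basisVec μ)

/-- The spatial partial derivative `∂_i f`. -/
def sd {E : Type*} [NormedAddCommGroup E] [NormedSpace ℝ E]
    (i : Fin 3) (f : Spacetime → E) (p : Spacetime) : E :=
  pd i.succ f p

/-- The spatial Laplacian. -/
def lap {E : Type*} [NormedAddCommGroup E] [NormedSpace ℝ E]
    (f : Spacetime → E) (p : Spacetime) : E :=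
  ∑ i : Fin 3, sd i (sd i f) p

/-- Components of a covariant 2-tensor field on spacetime. -/
abbrev Tensor2 : Type := Spacetime → Matrix (Fin 4) (Fin 4) ℝ

/-- Christoffel symbols `Γ^σ_{μν}` of the metric `g`. -/
def christoffel (g : Tensor2) (σ μ ν : Fin 4) (p : Spacetime) : ℝ :=
  (1 / 2) * ∑ κ : Fin 4, (g p)⁻¹ σ κ *
    (pd μ (fun q => g q κ ν) p + pd ν (fun q => g q κ μ) p - pd κ (fun q => g q μ ν) p)

/-- The Ricci tensor `R_{μν}`. -/
def ricci (g : Tensor2) (μ ν : Fin 4) (p : Spacetime) : ℝ :=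
  (∑ σ : Fin 4, (pd σ (christoffel g σ μ ν) p - pd ν (christoffel g σ μ σ) p)) +
  ∑ σ : Fin 4, ∑ κ : Fin 4,
    (christoffel g σ σ κ p * christoffel g κ μ ν p -
      christoffel g σ ν κ p * christoffel g κ μ σ p)

/-- The scalar curvature. -/
def scalarCurvature (g : Tensor2) (p : Spacetime) : ℝ :=
  ∑ μ : Fin 4, ∑ ν : Fin 4, (g p)⁻¹ μ ν * ricci g μ ν p

/-- The difference of the two sides of the Einstein equations with cosmological constant `Λ`
for dust of density `ρ` and covariant four-velocity `u`, in units with `8πG = c = 1`: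
`R_{μν} - ½ R g_{μν} + Λ g_{μν} - ρ u_μ u_ν`. -/
def einsteinResidual (Λ : ℝ) (g : Tensor2) (ρ : Spacetime → ℝ) (u : Spacetime → Fin 4 → ℝ)
    (μ ν : Fin 4) (p : Spacetime) : ℝ :=
  ricci g μ ν p - (1 / 2) * scalarCurvature g p * g p μ ν + Λ * g p μ ν
    - ρ p * u p μ * u p ν

/-! ### Metrics in synchronous comoving gauge -/

/-- The metric `a(τ)² (-dτ² + h_{ij} dxⁱ dxʲ)`. -/
def synchronousMetric (a : ℝ → ℝ) (h : Spacetime → Matrix (Fin 3) (Fin 3) ℝ) : Tensor2 :=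
  fun p => Matrix.of fun μ ν : Fin 4 =>
    a p.1 ^ 2 *
      (Fin.cases (Fin.cases (-1 : ℝ) (fun _ => (0 : ℝ)) ν)
        (fun i : Fin 3 => Fin.cases (0 : ℝ) (fun j : Fin 3 => h p i j) ν) μ : ℝ)

/-- The covariant components of the comoving four-velocity `u = a⁻¹ ∂_τ`. -/
def comovingVelocity (a : ℝ → ℝ) : Spacetime → Fin 4 → ℝ :=
  fun p μ => Fin.cases (-(a p.1)) (fun _ : Fin 3 => (0 : ℝ)) μ

/-- The spatially flat FLRW metric `a(τ)² (-dτ² + δ_{ij} dxⁱ dxʲ)`. -/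
def flrwMetric (a : ℝ → ℝ) : Tensor2 :=
  synchronousMetric a (fun _ => 1)

/-- The linearly perturbed metric `a(τ)² (-dτ² + (δ_{ij} + ε γ_{ij}) dxⁱ dxʲ)`. -/
def perturbedMetric (a : ℝ → ℝ) (γ : Spacetime → Matrix (Fin 3) (Fin 3) ℝ) (ε : ℝ) : Tensor2 :=
  synchronousMetric a (fun p => 1 + ε • γ p)

/-- The spacetime region `τ₀ < τ < 0`. -/
def slab (τ₀ : ℝ) : Set Spacetime := Ioo τ₀ 0 ×ˢ univ

/-- `(a, ρ)` is an expanding spatially flat FLRW dust solution with cosmological constant `Λ` on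
`τ₀ < τ < 0`, conformal time being normalized so that `a → ∞` as `τ → 0⁻`. -/
structure IsDustBackground (Λ τ₀ : ℝ) (a ρ : ℝ → ℝ) : Prop where
  smooth : ContDiffOn ℝ ∞ a (Ioo τ₀ 0)
  a_pos : ∀ τ ∈ Ioo τ₀ 0, 0 < a τ
  rho_pos : ∀ τ ∈ Ioo τ₀ 0, 0 < ρ τ
  einstein : ∀ p ∈ slab τ₀, ∀ μ ν : Fin 4,
    einsteinResidual Λ (flrwMetric a) (fun q => ρ q.1) (comovingVelocity a) μ ν p = 0
  tendsto_atTop : Tendsto a (𝓝[<] 0) atTop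

/-- The perturbation `(ε γ, ε ρ₁)` of the metric and of the density satisfies the Einstein
equations to first order in `ε`. -/
def SolvesLinearizedEinstein (Λ τ₀ : ℝ) (a ρ : ℝ → ℝ)
    (γ : Spacetime → Matrix (Fin 3) (Fin 3) ℝ) (ρ₁ : Spacetime → ℝ) : Prop :=
  ∀ p ∈ slab τ₀, ∀ μ ν : Fin 4,
    HasDerivAt (fun ε : ℝ => einsteinResidual Λ (perturbedMetric a γ ε)
      (fun q => ρ q.1 + ε * ρ₁ q) (comovingVelocity a) μ ν p) 0 0

/-! ### De Sitter spacetime and the local asymptotic approach to it -/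

/-- The scale factor `-√(3/Λ) / τ` of de Sitter spacetime in flat slicing. -/
def deSitterScale (Λ : ℝ) : ℝ → ℝ := fun τ => -Real.sqrt (3 / Λ) / τ

/-- The de Sitter metric `3 / (Λ τ²) (-dτ² + δ_{ij} dxⁱ dxʲ)` on `τ < 0`. -/
def deSitterMetric (Λ : ℝ) : Tensor2 := flrwMetric (deSitterScale Λ)

/-- The pullback of `g` under the map `ψ`. -/
def pullback (ψ : Spacetime → Spacetime) (g : Tensor2) : Tensor2 :=
  fun p => Matrix.of fun μ ν : Fin 4 => ∑ α : Fin 4, ∑ β : Fin 4,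
    g (ψ p) α β * coord α (fderiv ℝ ψ p (basisVec μ)) * coord β (fderiv ℝ ψ p (basisVec ν))

/-- The local coordinate change `τ = s η`, `x = x₀ + s M y` about the comoving world line of `x₀`.
The map `(η, y) ↦ (s η, s y)` is an isometry of de Sitter spacetime (a translation in proper time
along that world line) that moves every compact set to late times as `s → 0⁺`. -/
def observerChart (M : Matrix (Fin 3) (Fin 3) ℝ) (x₀ : Space) (s : ℝ) :
    Spacetime → Spacetime :=
  fun p => (s * p.1, x₀ + s • Matrix.toEuclideanLin M p.2)

/-- Near the comoving observer `x₀`, the metric `g` approaches the de Sitter metric at late times: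
after a fixed linear change of the spatial coordinates, the late-time translates of `g` converge to
the de Sitter metric, uniformly on compact sets of the chart `η < 0`. -/
def ApproachesDeSitterAt (Λ : ℝ) (g : Tensor2) (x₀ : Space) : Prop :=
  ∃ M : Matrix (Fin 3) (Fin 3) ℝ, IsUnit M.det ∧ ∀ μ ν : Fin 4,
    TendstoLocallyUniformlyOn
      (fun (s : ℝ) (p : Spacetime) => pullback (observerChart M x₀ s) g p μ ν)
      (fun p => deSitterMetric Λ p μ ν) (𝓝[>] 0) {p : Spacetime | p.1 < 0}

/-- `f(τ, x)` tends, locally uniformly in `x`, to a function constant in time as `τ → 0⁻`. -/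
def TendsToConstantInTime (f : Spacetime → ℝ) : Prop :=
  ∃ c : Space → ℝ, Continuous c ∧
    TendstoLocallyUniformly (fun (τ : ℝ) (x : Space) => f (τ, x)) c (𝓝[<] 0)

/-! ### Scalar, vector and tensor modes -/

/-- `γ_{ij} = -2 φ δ_{ij} + (∂_i ∂_j - ⅓ δ_{ij} Δ) χ + ∂_i Z_j + ∂_j Z_i + π_{ij}`. -/
def modeSum (φ χ : Spacetime → ℝ) (Z : Spacetime → Fin 3 → ℝ)
    (π : Spacetime → Matrix (Fin 3) (Fin 3) ℝ) : Spacetime → Matrix (Fin 3) (Fin 3) ℝ :=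
  fun p => Matrix.of fun i j : Fin 3 =>
    -2 * φ p * (1 : Matrix (Fin 3) (Fin 3) ℝ) i j
      + (sd i (sd j χ) p - (1 / 3) * (1 : Matrix (Fin 3) (Fin 3) ℝ) i j * lap χ p)
      + (sd i (fun q => Z q j) p + sd j (fun q => Z q i) p)
      + π p i j

/-- `f` and all its partial derivatives tend to `0` at spatial infinity, at each time. -/
def VanishesAtInfinity (τ₀ : ℝ) (f : Spacetime → ℝ) : Prop :=
  ∀ τ ∈ Ioo τ₀ 0, ∀ k : ℕ,
    Tendsto (fun x : Space => iteratedFDeriv ℝ k f (τ, x)) (cocompact Space) (𝓝 0)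

/-- Smooth scalar-vector-tensor data on `τ₀ < τ < 0`, vanishing at spatial infinity, with `Z`
divergence-free and `π` symmetric, transverse and trace-free. -/
structure IsModeDecomposition (τ₀ : ℝ) (φ χ : Spacetime → ℝ) (Z : Spacetime → Fin 3 → ℝ)
    (π : Spacetime → Matrix (Fin 3) (Fin 3) ℝ) : Prop where
  smooth_phi : ContDiffOn ℝ ∞ φ (slab τ₀)
  smooth_chi : ContDiffOn ℝ ∞ χ (slab τ₀)
  smooth_Z : ∀ i, ContDiffOn ℝ ∞ (fun p => Z p i) (slab τ₀)
  smooth_pi : ∀ i j, ContDiffOn ℝ ∞ (fun p => π p i j) (slab τ₀)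
  decay_phi : VanishesAtInfinity τ₀ φ
  decay_chi : VanishesAtInfinity τ₀ χ
  decay_Z : ∀ i, VanishesAtInfinity τ₀ (fun p => Z p i)
  decay_pi : ∀ i j, VanishesAtInfinity τ₀ (fun p => π p i j)
  div_Z : ∀ p ∈ slab τ₀, ∑ i : Fin 3, sd i (fun q => Z q i) p = 0
  symm_pi : ∀ p ∈ slab τ₀, (π p).IsSymm
  trace_pi : ∀ p ∈ slab τ₀, (π p).trace = 0
  div_pi : ∀ p ∈ slab τ₀, ∀ j, ∑ i : Fin 3, sd i (fun q => π q i j) p = 0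

/-- The scalar equation `f'' + (a'/a) f' - ½ a² ρ f = 0` on `τ₀ < τ < 0`. -/
def ScalarModeEq {E : Type*} [NormedAddCommGroup E] [NormedSpace ℝ E]
    (τ₀ : ℝ) (a ρ : ℝ → ℝ) (f : ℝ → E) : Prop :=
  ContDiffOn ℝ 2 f (Ioo τ₀ 0) ∧ ∀ τ ∈ Ioo τ₀ 0,
    deriv (deriv f) τ + (deriv a τ / a τ) • deriv f τ - ((1 / 2) * a τ ^ 2 * ρ τ) • f τ = 0

/-- The vector equation `f' + (a'/a) f = 0` on `τ₀ < τ < 0`. -/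
def VectorModeEq {E : Type*} [NormedAddCommGroup E] [NormedSpace ℝ E]
    (τ₀ : ℝ) (a : ℝ → ℝ) (f : ℝ → E) : Prop :=
  ContDiffOn ℝ 1 f (Ioo τ₀ 0) ∧ ∀ τ ∈ Ioo τ₀ 0, deriv f τ + (deriv a τ / a τ) • f τ = 0

/-- The tensor equation `f'' + 2 (a'/a) f' - Δ f = 0` on `τ₀ < τ < 0`. -/
def TensorModeEq {E : Type*} [NormedAddCommGroup E] [NormedSpace ℝ E]
    (τ₀ : ℝ) (a : ℝ → ℝ) (f : Spacetime → E) : Prop :=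
  ContDiffOn ℝ 2 f (slab τ₀) ∧ ∀ p ∈ slab τ₀,
    pd 0 (pd 0 f) p + (2 * (deriv a p.1 / a p.1)) • pd 0 f p - lap f p = 0

/-- The tensor equation for one Fourier mode of wave number `q`:
`f'' + 2 (a'/a) f' + q² f = 0` on `τ₀ < τ < 0`. -/
def FourierModeEq (τ₀ : ℝ) (a : ℝ → ℝ) (q : ℝ) (f : ℝ → ℂ) : Prop :=
  ContDiffOn ℝ 2 f (Ioo τ₀ 0) ∧ ∀ τ ∈ Ioo τ₀ 0,
    deriv (deriv f) τ + (2 * (deriv a τ / a τ)) • deriv f τ + (q ^ 2) • f τ = 0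

/-! ### Bessel functions and Fourier integrals -/

/-- The Bessel function of the first kind `J_ν(z)` (principal branch, `z ≠ 0`). -/
def besselJ (ν z : ℂ) : ℂ :=
  ∑' k : ℕ, (-1 : ℂ) ^ k / ((k.factorial : ℂ) * Complex.Gamma (k + ν + 1))
    * (z / 2) ^ (2 * (k : ℂ) + ν)

/-- The Bessel function of the second kind `Y_ν(z)` of non-integer order. -/
def besselY (ν z : ℂ) : ℂ :=
  (besselJ ν z * Complex.cos (ν * Real.pi) - besselJ (-ν) z) / Complex.sin (ν * Real.pi)

/-- The argument `⅔ A τ^{3/2}`, where `A² = ½ ρ₀ √(Λ/3)`. -/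
def besselArg (Λ ρ₀ τ : ℝ) : ℂ :=
  (2 / 3 : ℂ) * (Real.sqrt ((1 / 2) * ρ₀ * Real.sqrt (Λ / 3)) : ℂ) * (τ : ℂ) ^ (3 / 2 : ℂ)

/-- `C₁ τ Y_{2/3}(⅔ A τ^{3/2}) + C₂ τ J_{2/3}(⅔ A τ^{3/2})`. -/
def besselSolution (Λ ρ₀ : ℝ) (C₁ C₂ : ℂ) (τ : ℝ) : ℂ :=
  C₁ * τ * besselY (2 / 3) (besselArg Λ ρ₀ τ) + C₂ * τ * besselJ (2 / 3) (besselArg Λ ρ₀ τ)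

/-- `K (sin qτ - qτ cos qτ) + F (cos qτ + qτ sin qτ)`. -/
def tensorFourierMode (K F : ℂ) (q τ : ℝ) : ℂ :=
  K * (Real.sin (q * τ) - q * τ * Real.cos (q * τ) : ℝ)
    + F * (Real.cos (q * τ) + q * τ * Real.sin (q * τ) : ℝ)

/-- The superposition of plane waves with the amplitudes `tensorFourierMode`, over all wave vectors
`q ∈ ℝ³`, for one component of the tensor mode. -/
def tensorFourierIntegral (K F : Space → ℂ) (p : Spacetime) : ℂ :=
  ∫ q : Space, tensorFourierMode (K q) (F q) ‖q‖ p.1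
    * Complex.exp (-Complex.I * (inner ℝ q p.2 : ℝ))

end

end DustPert

/-! Write `H = a'/a`, `T = γ_kk`, `V_j = ∂_k γ_kj - ∂_j T` and `W = ∂_j V_j`. The linearized
Einstein equations amount to `V' = 0` (`pd_zero_momentum`) together with `linearized_system`: the
constraint `a² ρ₁ = H T' + W/2`, the equation `T'' + 2 H T' = -W/2`, which contains no spatial
derivative of `T`, and the wave equation `γ_ij'' + 2 H γ_ij' - Δγ_ij = S_ij`, whose source is built
from `W`, `∂_i V_j` and `∂_i ∂_j T`. The Friedmann equations force `H > 0` (`hubble_pos`). Although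
`H` blows up at `τ = 0`, it enters only as friction and has the favourable sign in every energy
estimate.

Hence `T` and all its spatial derivatives stay bounded up to `τ = 0`, and so does the source. A
local energy estimate with a cutoff in a shrinking cone (`exists_energy_bound`), applied to every
spatial derivative, and a Sobolev inequality (`sq_le_sum_integral`) bound `γ_ij'` locally uniformly.
Only a finite conformal time remains, so a bounded time derivative forces convergence
(`tendsToConstantInTime_of_bddNear`). The scalar and tensor equations on the exact background are
handled by the same estimates.

Mass conservation `ρ = ρ₀ a⁻³` and the Friedmann equation give `(1/a)' → -√(Λ/3)`, whence `a / a_dS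
→ 1`. Dilations `(η, y) ↦ (s η, s y)` preserve de Sitter space, so the limit of the pullbacks sees
only `δ + ε γ^∞(x₀) = BᵀB`, and `M = B⁻¹` normalizes it (`approachesDeSitterAt_of_tendsto`).

For decaying modes, `T = -6 φ` and `V_j = ∂_j S + ΔZ_j` with `S = 4 φ + (2/3) Δχ`. Liouville's
theorem (`eq_zero_of_harmonic`) upgrades the time independence of `V` and `W` to `S' = 0` and `Z' =
0`. The wave operator then sends `π_ij` to `∂_i ∂_j A + δ_ij B`; the trace and divergence conditions
and Liouville again give `A = B = 0` (`box_pi`). The function `D` comes from the conserved quantity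
`ρ₁/ρ + T/2` (`exists_time_indep_density`).

For the pure de Sitter scale factor, `τ J_{±2/3}` are constant multiples of two power series in `τ`,
and every solution is recovered from Wronskians with these (`wronskian_div_pow_const`). For tensor
modes, `G - τ G'` solves the equation whenever `G` solves the flat wave equation
(`tensorModeEq_pairWave`). -/

namespace DustPert

/-! ### Calculus on the slab -/

/-- `f` is smooth on `τ₀ < τ < 0`. -/
abbrev SlabSmooth (τ₀ : ℝ) (f : Spacetime → ℝ) : Prop := ContDiffOn ℝ ∞ f (slab τ₀)

lemma isOpen_slab (τ₀ : ℝ) : IsOpen (slab τ₀) := isOpen_Ioo.prod isOpen_univ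

lemma mk_mem_slab {τ₀ τ : ℝ} (h : τ ∈ Ioo τ₀ 0) (x : Space) : (τ, x) ∈ slab τ₀ := ⟨h, mem_univ _⟩

lemma slab_mem_nhds {τ₀ : ℝ} {p : Spacetime} (hp : p ∈ slab τ₀) : slab τ₀ ∈ 𝓝 p :=
  (isOpen_slab τ₀).mem_nhds hp

lemma SlabSmooth.contDiffAt {τ₀ : ℝ} {f : Spacetime → ℝ} (hf : SlabSmooth τ₀ f) {p : Spacetime}
    (hp : p ∈ slab τ₀) : ContDiffAt ℝ ∞ f p :=
  ContDiffOn.contDiffAt hf (slab_mem_nhds hp)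

lemma SlabSmooth.differentiableAt {τ₀ : ℝ} {f : Spacetime → ℝ} (hf : SlabSmooth τ₀ f)
    {p : Spacetime} (hp : p ∈ slab τ₀) : DifferentiableAt ℝ f p :=
  (hf.contDiffAt hp).differentiableAt (by simp)

lemma SlabSmooth.pd {τ₀ : ℝ} {f : Spacetime → ℝ} (hf : SlabSmooth τ₀ f) (μ : Fin 4) :
    SlabSmooth τ₀ (pd μ f) := by
  have h : ContDiffOn ℝ ∞ (fderiv ℝ f) (slab τ₀) :=
    ContDiffOn.fderiv_of_isOpen hf (isOpen_slab τ₀) (by simp)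
  exact h.clm_apply contDiffOn_const

lemma SlabSmooth.sd {τ₀ : ℝ} {f : Spacetime → ℝ} (hf : SlabSmooth τ₀ f) (i : Fin 3) :
    SlabSmooth τ₀ (sd i f) := SlabSmooth.pd hf i.succ

lemma SlabSmooth.lap {τ₀ : ℝ} {f : Spacetime → ℝ} (hf : SlabSmooth τ₀ f) :
    SlabSmooth τ₀ (lap f) :=
  ContDiffOn.sum fun i _ => SlabSmooth.sd (SlabSmooth.sd hf i) i

lemma slabSmooth_of_time {τ₀ : ℝ} {c : ℝ → ℝ} (hc : ContDiffOn ℝ ∞ c (Ioo τ₀ 0)) :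
    SlabSmooth τ₀ (fun p => c p.1) :=
  hc.comp contDiffOn_fst fun _ hp => hp.1

lemma sd_eq_pd {E : Type*} [NormedAddCommGroup E] [NormedSpace ℝ E] (i : Fin 3)
    (f : Spacetime → E) : sd i f = pd i.succ f := rfl

section congr
variable {E : Type*} [NormedAddCommGroup E] [NormedSpace ℝ E]

lemma pd_congr_on {s : Set Spacetime} (hs : IsOpen s) {f g : Spacetime → E} (h : EqOn f g s)
    (μ : Fin 4) : EqOn (pd μ f) (pd μ g) s := fun p hp => by
  have : f =ᶠ[𝓝 p] g := by
    filter_upwards [hs.mem_nhds hp] with q hq using h hq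
  simp only [pd, this.fderiv_eq]

lemma pd_congr {τ₀ : ℝ} {f g : Spacetime → E} (h : EqOn f g (slab τ₀)) (μ : Fin 4) :
    EqOn (pd μ f) (pd μ g) (slab τ₀) := pd_congr_on (isOpen_slab τ₀) h μ

lemma sd_congr {τ₀ : ℝ} {f g : Spacetime → E} (h : EqOn f g (slab τ₀)) (i : Fin 3) :
    EqOn (sd i f) (sd i g) (slab τ₀) := pd_congr h i.succ

lemma lap_congr {τ₀ : ℝ} {f g : Spacetime → E} (h : EqOn f g (slab τ₀)) :
    EqOn (lap f) (lap g) (slab τ₀) := fun _ hp =>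
  Finset.sum_congr rfl fun i _ => sd_congr (sd_congr h i) i hp

end congr

lemma pd_const (μ : Fin 4) (c : ℝ) (p : Spacetime) : pd μ (fun _ => c) p = 0 := by
  simp [pd]

lemma pd_add {μ : Fin 4} {f g : Spacetime → ℝ} {p : Spacetime} (hf : DifferentiableAt ℝ f p)
    (hg : DifferentiableAt ℝ g p) : pd μ (fun q => f q + g q) p = pd μ f p + pd μ g p := by
  simp [pd, fderiv_fun_add hf hg]

lemma pd_sub {μ : Fin 4} {f g : Spacetime → ℝ} {p : Spacetime} (hf : DifferentiableAt ℝ f p)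
    (hg : DifferentiableAt ℝ g p) : pd μ (fun q => f q - g q) p = pd μ f p - pd μ g p := by
  simp [pd, fderiv_fun_sub hf hg]

lemma pd_neg {μ : Fin 4} {f : Spacetime → ℝ} {p : Spacetime} :
    pd μ (fun q => - f q) p = - pd μ f p := by
  simp [pd, fderiv_fun_neg]

lemma pd_mul {μ : Fin 4} {f g : Spacetime → ℝ} {p : Spacetime} (hf : DifferentiableAt ℝ f p)
    (hg : DifferentiableAt ℝ g p) :
    pd μ (fun q => f q * g q) p = pd μ f p * g p + f p * pd μ g p := by
  simp [pd, fderiv_fun_mul hf hg]; ring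

lemma pd_const_mul {μ : Fin 4} {c : ℝ} {f : Spacetime → ℝ} {p : Spacetime}
    (hf : DifferentiableAt ℝ f p) : pd μ (fun q => c * f q) p = c * pd μ f p := by
  simp [pd, fderiv_const_mul hf]

lemma pd_sum {ι : Type*} {μ : Fin 4} {s : Finset ι} {f : ι → Spacetime → ℝ} {p : Spacetime}
    (hf : ∀ i ∈ s, DifferentiableAt ℝ (f i) p) :
    pd μ (fun q => ∑ i ∈ s, f i q) p = ∑ i ∈ s, pd μ (f i) p := by
  simp [pd, fderiv_fun_sum hf]

lemma basisVec_zero : basisVec 0 = ((1 : ℝ), (0 : Space)) := rfl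

lemma basisVec_succ (i : Fin 3) :
    basisVec i.succ = ((0 : ℝ), EuclideanSpace.single i (1 : ℝ)) := rfl

lemma pd_time_zero {c : ℝ → ℝ} {p : Spacetime} (hc : DifferentiableAt ℝ c p.1) :
    pd 0 (fun q => c q.1) p = deriv c p.1 := by
  have h : HasFDerivAt (fun q : Spacetime => c q.1)
      ((ContinuousLinearMap.toSpanSingleton ℝ (deriv c p.1)).comp
        (ContinuousLinearMap.fst ℝ ℝ Space)) p :=
    (hc.hasDerivAt.hasFDerivAt).comp p hasFDerivAt_fst
  simp [pd, h.fderiv, basisVec_zero]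

lemma pd_time_succ {c : ℝ → ℝ} {p : Spacetime} (hc : DifferentiableAt ℝ c p.1) (i : Fin 3) :
    pd i.succ (fun q => c q.1) p = 0 := by
  have h : HasFDerivAt (fun q : Spacetime => c q.1)
      ((ContinuousLinearMap.toSpanSingleton ℝ (deriv c p.1)).comp
        (ContinuousLinearMap.fst ℝ ℝ Space)) p :=
    (hc.hasDerivAt.hasFDerivAt).comp p hasFDerivAt_fst
  simp [pd, h.fderiv, basisVec_succ]

lemma sd_time_mul {c : ℝ → ℝ} {f : Spacetime → ℝ} {p : Spacetime}
    (hc : DifferentiableAt ℝ c p.1) (hf : DifferentiableAt ℝ f p) (i : Fin 3) :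
    sd i (fun q => c q.1 * f q) p = c p.1 * sd i f p := by
  have hc' : DifferentiableAt ℝ (fun q : Spacetime => c q.1) p :=
    DifferentiableAt.comp p hc differentiableAt_fst
  rw [sd, pd_mul hc' hf, pd_time_succ hc]; simp [sd]

lemma pd_comm {τ₀ : ℝ} {f : Spacetime → ℝ} (hf : SlabSmooth τ₀ f) (μ ν : Fin 4) {p : Spacetime}
    (hp : p ∈ slab τ₀) : pd μ (pd ν f) p = pd ν (pd μ f) p := by
  have hs : IsSymmSndFDerivAt ℝ f p := (hf.contDiffAt hp).isSymmSndFDerivAt (by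
    rw [minSmoothness_of_isRCLikeNormedField]; exact WithTop.coe_le_coe.2 le_top)
  have hd : DifferentiableAt ℝ (fderiv ℝ f) p :=
    ((hf.contDiffAt hp).fderiv_right (m := 1)
      (WithTop.coe_le_coe.2 le_top)).differentiableAt (by simp)
  have key (α β : Fin 4) : pd α (pd β f) p = fderiv ℝ (fderiv ℝ f) p (basisVec α) (basisVec β) := by
    have : fderiv ℝ (fun q => fderiv ℝ f q (basisVec β)) p =
        (fderiv ℝ (fderiv ℝ f) p).flip (basisVec β) := by
      rw [fderiv_clm_apply hd (differentiableAt_const _)]; simp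
    change fderiv ℝ (fun q => fderiv ℝ f q (basisVec β)) p (basisVec α) = _
    rw [this]; rfl
  rw [key, key]; exact hs _ _

lemma hasDerivAt_time {f : Spacetime → ℝ} {τ : ℝ} {x : Space}
    (hf : DifferentiableAt ℝ f (τ, x)) : HasDerivAt (fun t => f (t, x)) (pd 0 f (τ, x)) τ := by
  have h := hf.hasFDerivAt.comp_hasDerivAt τ ((hasDerivAt_id τ).prodMk (hasDerivAt_const τ x))
  exact h

lemma hasDerivAt_line {f : Spacetime → ℝ} {τ s : ℝ} {x : Space} {i : Fin 3}
    (hf : DifferentiableAt ℝ f (τ, x + s • EuclideanSpace.single i (1 : ℝ))) :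
    HasDerivAt (fun t : ℝ => f (τ, x + t • EuclideanSpace.single i (1 : ℝ)))
      (sd i f (τ, x + s • EuclideanSpace.single i (1 : ℝ))) s := by
  have h1 : HasDerivAt (fun t : ℝ => x + t • EuclideanSpace.single i (1 : ℝ))
      (EuclideanSpace.single i (1 : ℝ)) s := by
    simpa using ((hasDerivAt_id s).smul_const (EuclideanSpace.single i (1 : ℝ))).const_add x
  exact hf.hasFDerivAt.comp_hasDerivAt s ((hasDerivAt_const s τ).prodMk h1)

/-- A function on the slab whose time derivative vanishes does not depend on time. -/
lemma time_indep {τ₀ : ℝ} {f : Spacetime → ℝ} (hf : SlabSmooth τ₀ f)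
    (h : ∀ p ∈ slab τ₀, pd 0 f p = 0) {τ σ : ℝ} (hτ : τ ∈ Ioo τ₀ 0) (hσ : σ ∈ Ioo τ₀ 0)
    (x : Space) : f (τ, x) = f (σ, x) := by
  refine IsOpen.is_const_of_deriv_eq_zero isOpen_Ioo isPreconnected_Ioo
    (f := fun t => f (t, x)) (fun t ht => ?_) (fun t ht => ?_) hτ hσ
  · exact (hasDerivAt_time
      (hf.differentiableAt (mk_mem_slab ht x))).differentiableAt.differentiableWithinAt
  · rw [(hasDerivAt_time (hf.differentiableAt (mk_mem_slab ht x))).deriv, h _ (mk_mem_slab ht x)]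
    rfl

/-- The restriction of a smooth function to a time slice. -/
lemma SlabSmooth.slice {τ₀ : ℝ} {f : Spacetime → ℝ} (hf : SlabSmooth τ₀ f) {τ : ℝ}
    (hτ : τ ∈ Ioo τ₀ 0) : ContDiff ℝ ∞ (fun x : Space => f (τ, x)) := by
  rw [← contDiffOn_univ]
  exact ContDiffOn.comp hf (t := slab τ₀) (contDiff_prodMk_right τ).contDiffOn
    fun x _ => mk_mem_slab hτ x

lemma SlabSmooth.timeSlice {τ₀ : ℝ} {f : Spacetime → ℝ} (hf : SlabSmooth τ₀ f) (x : Space) :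
    ContDiffOn ℝ ∞ (fun t => f (t, x)) (Ioo τ₀ 0) :=
  ContDiffOn.comp hf (t := slab τ₀) (contDiff_prodMk_left x).contDiffOn
    fun _ ht => mk_mem_slab ht x

lemma deriv_time {τ₀ : ℝ} {f : Spacetime → ℝ} (hf : SlabSmooth τ₀ f) {τ : ℝ}
    (hτ : τ ∈ Ioo τ₀ 0) (x : Space) : deriv (fun t => f (t, x)) τ = pd 0 f (τ, x) :=
  (hasDerivAt_time (hf.differentiableAt (mk_mem_slab hτ x))).deriv

lemma deriv_deriv_time {τ₀ : ℝ} {f : Spacetime → ℝ} (hf : SlabSmooth τ₀ f) {τ : ℝ}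
    (hτ : τ ∈ Ioo τ₀ 0) (x : Space) :
    deriv (deriv (fun t => f (t, x))) τ = pd 0 (pd 0 f) (τ, x) := by
  have : deriv (fun t => f (t, x)) =ᶠ[𝓝 τ] fun t => pd 0 f (t, x) := by
    filter_upwards [isOpen_Ioo.mem_nhds hτ] with t ht using deriv_time hf ht x
  rw [this.deriv_eq]
  exact deriv_time (hf.pd 0) hτ x

/-! ### Bounds near the future boundary -/

/-- `f` is bounded on `[τ₁, 0) × B` for every `τ₁` in the interval and every ball `B`. -/
def BddNear (τ₀ : ℝ) (f : Spacetime → ℝ) : Prop :=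
  ∀ τ₁ ∈ Ioo τ₀ 0, ∀ r : ℝ, ∃ C : ℝ, ∀ τ ∈ Ico τ₁ 0, ∀ x : Space, ‖x‖ ≤ r → |f (τ, x)| ≤ C

lemma Ico_sub_Ioo {τ₀ τ₁ τ : ℝ} (h₁ : τ₁ ∈ Ioo τ₀ 0) (h : τ ∈ Ico τ₁ 0) : τ ∈ Ioo τ₀ 0 :=
  ⟨h₁.1.trans_le h.1, h.2⟩

lemma BddNear.congr {τ₀ : ℝ} {f g : Spacetime → ℝ} (hf : BddNear τ₀ f)
    (h : EqOn f g (slab τ₀)) : BddNear τ₀ g := fun τ₁ h₁ r => by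
  obtain ⟨C, hC⟩ := hf τ₁ h₁ r
  exact ⟨C, fun τ hτ x hx => by
    rw [← h (mk_mem_slab (Ico_sub_Ioo h₁ hτ) x)]; exact hC τ hτ x hx⟩

lemma BddNear.add {τ₀ : ℝ} {f g : Spacetime → ℝ} (hf : BddNear τ₀ f) (hg : BddNear τ₀ g) :
    BddNear τ₀ (fun p => f p + g p) := fun τ₁ h₁ r => by
  obtain ⟨C, hC⟩ := hf τ₁ h₁ r
  obtain ⟨D, hD⟩ := hg τ₁ h₁ r
  exact ⟨C + D, fun τ hτ x hx => (abs_add_le _ _).trans (add_le_add (hC τ hτ x hx) (hD τ hτ x hx))⟩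

lemma BddNear.const_mul {τ₀ : ℝ} {f : Spacetime → ℝ} (hf : BddNear τ₀ f) (c : ℝ) :
    BddNear τ₀ (fun p => c * f p) := fun τ₁ h₁ r => by
  obtain ⟨C, hC⟩ := hf τ₁ h₁ r
  exact ⟨|c| * C, fun τ hτ x hx => by
    rw [abs_mul]; exact mul_le_mul_of_nonneg_left (hC τ hτ x hx) (abs_nonneg _)⟩

lemma SlabSmooth.exists_bound {τ₀ τ : ℝ} {f : Spacetime → ℝ} (hf : SlabSmooth τ₀ f)
    (hτ : τ ∈ Ioo τ₀ 0) (r : ℝ) : ∃ C : ℝ, 0 ≤ C ∧ ∀ x : Space, ‖x‖ ≤ r → |f (τ, x)| ≤ C := by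
  obtain ⟨C, hC⟩ := (isCompact_closedBall (0 : Space) r).exists_bound_of_continuousOn
    (hf.slice hτ).continuous.continuousOn
  exact ⟨max C 0, le_max_right _ _, fun x hx => (hC x (by simpa using hx)).trans (le_max_left _ _)⟩

lemma bddNear_of_time_indep {τ₀ : ℝ} {f : Spacetime → ℝ} (hf : SlabSmooth τ₀ f)
    (h : ∀ p ∈ slab τ₀, pd 0 f p = 0) : BddNear τ₀ f := fun τ₁ h₁ r => by
  obtain ⟨C, -, hC⟩ := hf.exists_bound h₁ r
  exact ⟨C, fun τ hτ x hx => by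
    rw [time_indep hf h (Ico_sub_Ioo h₁ hτ) h₁ x]; exact hC x hx⟩

lemma abs_sub_le_of_pd_bound {τ₀ τ₁ C : ℝ} {f : Spacetime → ℝ} (hf : SlabSmooth τ₀ f)
    (h₁ : τ₁ ∈ Ioo τ₀ 0) {x : Space} (hC : ∀ τ ∈ Ico τ₁ 0, |pd 0 f (τ, x)| ≤ C)
    {σ τ : ℝ} (hσ : σ ∈ Ico τ₁ 0) (hτ : τ ∈ Ico τ₁ 0) :
    |f (τ, x) - f (σ, x)| ≤ C * |τ - σ| := by
  have := (convex_Ico τ₁ 0).norm_image_sub_le_of_norm_hasDerivWithin_le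
    (f := fun t => f (t, x)) (f' := fun t => pd 0 f (t, x)) (C := C)
    (fun t ht => (hasDerivAt_time
      (hf.differentiableAt (mk_mem_slab (Ico_sub_Ioo h₁ ht) x))).hasDerivWithinAt)
    (fun t ht => hC t ht) hσ hτ
  simpa using this

/-- The time left after `τ₁` is at most `|τ₁|`, so integrating a bounded derivative costs only a
finite amount. -/
lemma BddNear.of_pd {τ₀ : ℝ} {f : Spacetime → ℝ} (hf : SlabSmooth τ₀ f)
    (h : BddNear τ₀ (pd 0 f)) : BddNear τ₀ f := fun τ₁ h₁ r => by
  obtain ⟨C, hC⟩ := h τ₁ h₁ r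
  obtain ⟨D, hD0, hD⟩ := hf.exists_bound h₁ r
  refine ⟨|C| * |τ₁| + D, fun τ hτ x hx => ?_⟩
  have h2 := abs_sub_le_of_pd_bound hf h₁ (C := |C|)
    (fun t ht => (hC t ht x hx).trans (le_abs_self _)) (left_mem_Ico.2 h₁.2) hτ
  have h3 : |τ - τ₁| ≤ |τ₁| := by
    rw [abs_of_nonneg (sub_nonneg.2 hτ.1), abs_of_neg h₁.2]; linarith [hτ.2]
  calc |f (τ, x)| = |(f (τ, x) - f (τ₁, x)) + f (τ₁, x)| := by ring_nf
    _ ≤ |f (τ, x) - f (τ₁, x)| + |f (τ₁, x)| := abs_add_le _ _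
    _ ≤ |C| * |τ₁| + D := add_le_add (h2.trans (by gcongr)) (hD x hx)

/-- A function with locally bounded time derivative tends to a function constant in time. -/
lemma tendsToConstantInTime_of_bddNear {τ₀ : ℝ} (hτ₀ : τ₀ < 0) {f : Spacetime → ℝ}
    (hf : SlabSmooth τ₀ f) (h : BddNear τ₀ (pd 0 f)) : TendsToConstantInTime f := by
  obtain ⟨τ₁, h₁⟩ : (Ioo τ₀ 0).Nonempty := nonempty_Ioo.2 hτ₀
  have hev : ∀ᶠ τ in 𝓝[<] (0 : ℝ), τ ∈ Ico τ₁ 0 := Ico_mem_nhdsLT h₁.2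
  choose C hC using fun r : ℝ => h τ₁ h₁ r
  have hlip (r : ℝ) (x : Space) (hx : ‖x‖ ≤ r) : ∀ σ ∈ Ico τ₁ 0, ∀ τ ∈ Ico τ₁ 0,
      |f (τ, x) - f (σ, x)| ≤ |C r| * |τ - σ| := fun σ hσ τ hτ =>
    abs_sub_le_of_pd_bound hf h₁ (fun t ht => (hC r t ht x hx).trans (le_abs_self _)) hσ hτ
  have hlim (x : Space) : ∃ c : ℝ, Tendsto (fun τ => f (τ, x)) (𝓝[<] 0) (𝓝 c) := by
    apply cauchy_map_iff_exists_tendsto.1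
    rw [Metric.cauchy_iff]
    refine ⟨inferInstance, fun ε hε => ?_⟩
    -- `K` dominates the Lipschitz constant and stays positive when that constant is zero.
    set K := |C ‖x‖| + 1
    have hK : 0 < K := by positivity
    have hev2 : ∀ᶠ τ in 𝓝[<] (0 : ℝ), τ ∈ Ioo (-(ε / K)) 0 :=
      Ioo_mem_nhdsLT (by simp; positivity)
    refine ⟨_, image_mem_map (hev.and hev2), ?_⟩
    rintro _ ⟨σ, hσ, rfl⟩ _ ⟨τ, hτ, rfl⟩
    rw [Real.dist_eq]
    refine (hlip ‖x‖ x le_rfl τ hτ.1 σ hσ.1).trans_lt ?_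
    have h3 : |σ - τ| < ε / K := by
      rw [abs_lt]; constructor <;> linarith [hσ.2.1, hσ.2.2, hτ.2.1, hτ.2.2]
    calc |C ‖x‖| * |σ - τ| ≤ K * |σ - τ| := by gcongr; simp [K]
      _ < K * (ε / K) := by gcongr
      _ = ε := by field_simp
  choose c hc using hlim
  -- Letting `σ → 0` in the Lipschitz bound gives a rate that depends only on the ball. Hence the
  -- convergence is locally uniform and the limit inherits continuity.
  have hrate (r : ℝ) (x : Space) (hx : ‖x‖ ≤ r) (τ : ℝ) (hτ : τ ∈ Ico τ₁ 0) :
      |c x - f (τ, x)| ≤ |C r| * |τ| := by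
    have t1 : Tendsto (fun σ => |f (σ, x) - f (τ, x)|) (𝓝[<] 0) (𝓝 |c x - f (τ, x)|) :=
      ((hc x).sub_const _).abs
    have t2 : Tendsto (fun σ : ℝ => |C r| * |σ - τ|) (𝓝[<] 0) (𝓝 (|C r| * |0 - τ|)) := by
      refine Tendsto.mono_left ?_ nhdsWithin_le_nhds
      exact (Continuous.tendsto (by fun_prop) 0)
    have := le_of_tendsto_of_tendsto t1 t2 (hev.mono fun σ hσ => hlip r x hx τ hτ σ hσ)
    simpa using this
  have hunif : TendstoLocallyUniformly (fun (τ : ℝ) (x : Space) => f (τ, x)) c (𝓝[<] 0) := by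
    rw [Metric.tendstoLocallyUniformly_iff]
    intro ε hε x
    refine ⟨Metric.closedBall 0 (‖x‖ + 1), ?_, ?_⟩
    · refine mem_of_superset (Metric.ball_mem_nhds x one_pos) fun y hy => ?_
      rw [mem_closedBall_zero_iff]
      have := norm_le_norm_add_norm_sub' y x
      rw [Metric.mem_ball, dist_eq_norm] at hy
      linarith
    · set K := |C (‖x‖ + 1)| + 1
      have hK : 0 < K := by positivity
      have hev2 : ∀ᶠ τ in 𝓝[<] (0 : ℝ), τ ∈ Ioo (-(ε / K)) 0 :=
        Ioo_mem_nhdsLT (by simp; positivity)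
      filter_upwards [hev, hev2] with τ hτ hτ2 y hy
      rw [Real.dist_eq]
      refine (hrate _ y (mem_closedBall_zero_iff.1 hy) τ hτ).trans_lt ?_
      have h3 : |τ| < ε / K := by rw [abs_lt]; constructor <;> linarith [hτ2.1, hτ2.2]
      calc |C (‖x‖ + 1)| * |τ| ≤ K * |τ| := by gcongr; simp [K]
        _ < K * (ε / K) := by gcongr
        _ = ε := by field_simp
  refine ⟨c, hunif.continuous (Eventually.frequently ?_), hunif⟩
  filter_upwards [hev] with τ hτ
  exact (hf.slice (Ico_sub_Ioo h₁ hτ)).continuous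

/-- A Gronwall estimate. -/
lemma gronwall_Ico {τ₁ c B : ℝ} {y y' : ℝ → ℝ} (hc : 1 ≤ c) (hB : 0 ≤ B)
    (hy : ∀ t ∈ Ico τ₁ 0, HasDerivAt y (y' t) t) (hle : ∀ t ∈ Ico τ₁ 0, y' t ≤ c * y t + B)
    {t : ℝ} (ht : t ∈ Ico τ₁ 0) : y t ≤ (|y τ₁| + B) * Real.exp (-(c * τ₁)) := by
  have h1 : τ₁ ∈ Ico τ₁ 0 := left_mem_Ico.2 (ht.1.trans_lt ht.2)
  have hd : ∀ s ∈ Ico τ₁ 0, HasDerivAt (fun s => (y s + B) * Real.exp (-(c * s)))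
      (y' s * Real.exp (-(c * s)) + (y s + B) * (Real.exp (-(c * s)) * -c)) s := fun s hs => by
    have he : HasDerivAt (fun s => Real.exp (-(c * s))) (Real.exp (-(c * s)) * -c) s := by
      simpa using ((hasDerivAt_id s).const_mul c).neg.exp
    exact ((hy s hs).add_const B).mul he
  -- Since `c ≥ 1` and `B ≥ 0`, the hypothesis gives `y' ≤ c (y + B)`, which makes the weighted
  -- quantity nonincreasing.
  have hanti : AntitoneOn (fun s => (y s + B) * Real.exp (-(c * s))) (Ico τ₁ 0) := by
    apply antitoneOn_of_deriv_nonpos (convex_Ico τ₁ 0)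
    · exact fun s hs => (hd s hs).continuousAt.continuousWithinAt
    · exact fun s hs => (hd s (interior_subset hs)).differentiableAt.differentiableWithinAt
    · intro s hs
      have hs' := interior_subset hs
      rw [(hd s hs').deriv]
      have : y' s + (y s + B) * -c ≤ 0 := by nlinarith [hle s hs']
      nlinarith [Real.exp_pos (-(c * s))]
  have := hanti h1 ht ht.1
  -- Times are negative, so the weight at `t` is at least one and can be dropped from the left side.
  have hp : 1 ≤ Real.exp (-(c * t)) := Real.one_le_exp (by nlinarith [ht.2])
  have hp1 := Real.exp_pos (-(c * τ₁))
  have h3 : (y τ₁ + B) * Real.exp (-(c * τ₁)) ≤ (|y τ₁| + B) * Real.exp (-(c * τ₁)) := by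
    gcongr; exact le_abs_self _
  have h4 : 0 ≤ (|y τ₁| + B) * Real.exp (-(c * τ₁)) := by positivity
  simp only at this
  by_contra hcon
  push Not at hcon
  nlinarith

/-- Iterated spatial derivatives. -/
noncomputable def sdList (L : List (Fin 3)) (f : Spacetime → ℝ) : Spacetime → ℝ := L.foldr sd f

lemma SlabSmooth.sdList {τ₀ : ℝ} {f : Spacetime → ℝ} (hf : SlabSmooth τ₀ f) (L : List (Fin 3)) :
    SlabSmooth τ₀ (sdList L f) := by
  induction L with
  | nil => exact hf
  | cons i L ih => exact SlabSmooth.sd ih i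

/-- `f` and all its spatial derivatives are bounded near `τ = 0`, locally uniformly in space. -/
def AllBddNear (τ₀ : ℝ) (f : Spacetime → ℝ) : Prop := ∀ L, BddNear τ₀ (sdList L f)

lemma sdList_sd (L : List (Fin 3)) (i : Fin 3) (f : Spacetime → ℝ) :
    sdList L (sd i f) = sdList (L ++ [i]) f := by
  simp [sdList, List.foldr_append]

lemma AllBddNear.sd {τ₀ : ℝ} {f : Spacetime → ℝ} (hf : AllBddNear τ₀ f) (i : Fin 3) :
    AllBddNear τ₀ (sd i f) := fun L => by
  rw [sdList_sd]; exact hf _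

lemma sdList_congr {τ₀ : ℝ} {f g : Spacetime → ℝ} (h : EqOn f g (slab τ₀)) (L : List (Fin 3)) :
    EqOn (sdList L f) (sdList L g) (slab τ₀) := by
  induction L with
  | nil => exact h
  | cons i L ih => exact sd_congr ih i

lemma sdList_add {τ₀ : ℝ} {f g : Spacetime → ℝ} (hf : SlabSmooth τ₀ f) (hg : SlabSmooth τ₀ g)
    (L : List (Fin 3)) :
    EqOn (sdList L fun p => f p + g p) (fun p => sdList L f p + sdList L g p) (slab τ₀) := by
  induction L with
  | nil => exact fun _ _ => rfl
  | cons i L ih =>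
    intro p hp
    exact (sd_congr ih i hp).trans (pd_add ((hf.sdList L).differentiableAt hp)
      ((hg.sdList L).differentiableAt hp))

lemma sdList_const_mul {τ₀ : ℝ} {f : Spacetime → ℝ} (hf : SlabSmooth τ₀ f) (c : ℝ)
    (L : List (Fin 3)) :
    EqOn (sdList L fun p => c * f p) (fun p => c * sdList L f p) (slab τ₀) := by
  induction L with
  | nil => exact fun _ _ => rfl
  | cons i L ih =>
    intro p hp
    exact (sd_congr ih i hp).trans (pd_const_mul ((hf.sdList L).differentiableAt hp))

lemma AllBddNear.add {τ₀ : ℝ} {f g : Spacetime → ℝ} (hf : SlabSmooth τ₀ f)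
    (hg : SlabSmooth τ₀ g) (hf' : AllBddNear τ₀ f) (hg' : AllBddNear τ₀ g) :
    AllBddNear τ₀ (fun p => f p + g p) := fun L =>
  ((hf' L).add (hg' L)).congr (sdList_add hf hg L).symm

lemma AllBddNear.const_mul {τ₀ : ℝ} {f : Spacetime → ℝ} (hf : SlabSmooth τ₀ f)
    (hf' : AllBddNear τ₀ f) (c : ℝ) : AllBddNear τ₀ (fun p => c * f p) := fun L =>
  ((hf' L).const_mul c).congr (sdList_const_mul hf c L).symm

lemma pd_zero_sdList {τ₀ : ℝ} {f : Spacetime → ℝ} (hf : SlabSmooth τ₀ f) (L : List (Fin 3)) :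
    EqOn (pd 0 (sdList L f)) (sdList L (pd 0 f)) (slab τ₀) := by
  induction L with
  | nil => exact fun _ _ => rfl
  | cons i L ih =>
    intro p hp
    exact (pd_comm (hf.sdList L) 0 i.succ hp).trans (sd_congr ih i hp)

lemma sdList_zero (L : List (Fin 3)) : sdList L (fun _ => (0 : ℝ)) = fun _ => 0 := by
  induction L with
  | nil => rfl
  | cons i L ih =>
    funext p
    change sd i (sdList L fun _ => 0) p = 0
    rw [ih]; exact pd_const _ _ _

/-- Spatial derivatives of a time-independent function are time-independent, hence bounded by their
values on one compact slice. -/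
lemma allBddNear_of_time_indep {τ₀ : ℝ} {f : Spacetime → ℝ} (hf : SlabSmooth τ₀ f)
    (h : ∀ p ∈ slab τ₀, pd 0 f p = 0) : AllBddNear τ₀ f := fun L => by
  refine bddNear_of_time_indep (hf.sdList L) fun p hp => ?_
  have h0 : EqOn (pd 0 f) (fun _ => 0) (slab τ₀) := h
  rw [pd_zero_sdList hf L hp, sdList_congr h0 L hp, sdList_zero]

end DustPert

namespace DustPert

noncomputable section

/-! ### Linearization of the Einstein equations in synchronous gauge -/

lemma contDiffAt_det {m : ℕ} {E : Type*} [NormedAddCommGroup E] [NormedSpace ℝ E] {n : ℕ∞ω}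
    {M : E → Matrix (Fin m) (Fin m) ℝ} {z : E}
    (h : ∀ i j, ContDiffAt ℝ n (fun w => M w i j) z) : ContDiffAt ℝ n (fun w => (M w).det) z := by
  simp only [Matrix.det_apply]
  refine ContDiffAt.sum fun σ _ => ?_
  simp only [Units.smul_def, zsmul_eq_mul]
  exact contDiffAt_const.mul (contDiffAt_prod fun i _ => h _ _)

/-- By Cramer's rule each entry is a quotient of determinants. The argument stays with entries, so
no norm on matrices has to be chosen. -/
lemma contDiffAt_inv_entry {m : ℕ} {E : Type*} [NormedAddCommGroup E] [NormedSpace ℝ E] {n : ℕ∞ω}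
    {M : E → Matrix (Fin m) (Fin m) ℝ} {z : E}
    (h : ∀ i j, ContDiffAt ℝ n (fun w => M w i j) z) (hz : (M z).det ≠ 0) (i j : Fin m) :
    ContDiffAt ℝ n (fun w => (M w)⁻¹ i j) z := by
  simp only [Matrix.inv_def, Ring.inverse_eq_inv', Matrix.smul_apply, smul_eq_mul,
    Matrix.adjugate_apply]
  refine ((contDiffAt_det h).inv hz).mul (contDiffAt_det fun k l => ?_)
  by_cases hk : k = j
  · subst hk
    simp only [Matrix.updateRow_self]
    exact contDiffAt_const
  · simp only [Matrix.updateRow_ne hk]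
    exact h k l

/-- The derivative of the inverse of an affine family of matrices. -/
lemma hasDerivAt_inv_entry {m : ℕ} (A B : Matrix (Fin m) (Fin m) ℝ) (hA : A.det ≠ 0)
    (i j : Fin m) :
    HasDerivAt (fun ε : ℝ => (A + ε • B)⁻¹ i j) (-(A⁻¹ * B * A⁻¹) i j) 0 := by
  have hs : ∀ k l, ContDiffAt ℝ 1 (fun ε : ℝ => (A + ε • B) k l) 0 := fun k l => by
    simp only [Matrix.add_apply, Matrix.smul_apply, smul_eq_mul]; fun_prop
  have hA0 : (A + (0 : ℝ) • B) = A := by simp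
  have hd : ∀ k l, DifferentiableAt ℝ (fun ε : ℝ => (A + ε • B)⁻¹ k l) 0 := fun k l =>
    (contDiffAt_inv_entry hs (by rwa [hA0]) k l).differentiableAt (by simp)
  set G' : Matrix (Fin m) (Fin m) ℝ :=
    Matrix.of fun k l => deriv (fun ε : ℝ => (A + ε • B)⁻¹ k l) 0 with hG'
  have hev : ∀ᶠ ε in 𝓝 (0 : ℝ), (A + ε • B).det ≠ 0 := by
    have : ContinuousAt (fun ε : ℝ => (A + ε • B).det) 0 := (contDiffAt_det hs).continuousAt
    exact this.eventually_ne (by simpa using hA)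
  -- This is the derivative at `ε = 0` of `(A + ε B)⁻¹ (A + ε B) = 1`, an identity valid near `0`.
  have hmul : G' * A + A⁻¹ * B = 0 := by
    ext k l
    have h1 : HasDerivAt (fun ε : ℝ => ∑ r, (A + ε • B)⁻¹ k r * (A + ε • B) r l)
        (∑ r, (G' k r * A r l + A⁻¹ k r * B r l)) 0 := by
      refine HasDerivAt.fun_sum fun r _ => ?_
      have h2 : HasDerivAt (fun ε : ℝ => (A + ε • B) r l) (B r l) 0 := by
        simp only [Matrix.add_apply, Matrix.smul_apply, smul_eq_mul]
        simpa using ((hasDerivAt_id (0 : ℝ)).mul_const (B r l)).const_add (A r l)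
      have h6 := (hd k r).hasDerivAt.fun_mul h2
      rw [hA0] at h6
      exact h6.congr_deriv (by simp [hG'])
    have h3 : (fun ε : ℝ => ∑ r, (A + ε • B)⁻¹ k r * (A + ε • B) r l) =ᶠ[𝓝 0]
        fun _ => (1 : Matrix (Fin m) (Fin m) ℝ) k l := by
      filter_upwards [hev] with ε hε
      rw [← Matrix.mul_apply, Matrix.nonsing_inv_mul _ (isUnit_iff_ne_zero.2 hε)]
    have h4 := (h1.congr_of_eventuallyEq h3.symm).unique (hasDerivAt_const _ _)
    simpa [Matrix.mul_apply, Finset.sum_add_distrib] using h4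
  have hG : G' = -(A⁻¹ * B * A⁻¹) := by
    have h5 : (G' * A + A⁻¹ * B) * A⁻¹ = 0 := by rw [hmul, zero_mul]
    rw [add_mul, Matrix.mul_nonsing_inv_cancel_right _ _ (isUnit_iff_ne_zero.2 hA)] at h5
    exact eq_neg_of_add_eq_zero_left h5
  have := (hd i j).hasDerivAt
  rw [← Matrix.neg_apply, ← hG]
  exact this

/-- Derivatives in a parameter and in space commute. -/
lemma hasDerivAt_pd_of_contDiffAt {F : ℝ × Spacetime → ℝ} {dF : Spacetime → ℝ} {p : Spacetime}
    (hF : ContDiffAt ℝ 2 F (0, p))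
    (hdF : ∀ᶠ q in 𝓝 p, HasDerivAt (fun ε => F (ε, q)) (dF q) 0) (κ : Fin 4) :
    HasDerivAt (fun ε => pd κ (fun q => F (ε, q)) p) (pd κ dF p) 0 := by
  have hs : IsSymmSndFDerivAt ℝ F (0, p) := hF.isSymmSndFDerivAt (by
    rw [minSmoothness_of_isRCLikeNormedField])
  have hdiff : ∀ᶠ z in 𝓝 ((0 : ℝ), p), DifferentiableAt ℝ F z :=
    (hF.eventually (by simp)).mono fun z hz => hz.differentiableAt (by simp)
  have hfd : DifferentiableAt ℝ (fderiv ℝ F) (0, p) :=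
    (hF.fderiv_right (m := 1) (by norm_num)).differentiableAt (by simp)
  have happ (v : ℝ × Spacetime) : HasFDerivAt (fun z => fderiv ℝ F z v)
      ((fderiv ℝ (fderiv ℝ F) (0, p)).flip v) (0, p) := by
    have := hfd.hasFDerivAt.clm_apply (hasFDerivAt_const v ((0 : ℝ), p))
    simpa using this
  -- Both mixed derivatives are values of the second derivative of `F` at `(0, p)` on the vectors
  -- `(1, 0)` and `(0, ∂_κ)`; its symmetry identifies them.
  have h1 : (fun ε => pd κ (fun q => F (ε, q)) p) =ᶠ[𝓝 0]
      fun ε => fderiv ℝ F (ε, p) (0, basisVec κ) := by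
    have ht : Tendsto (fun ε : ℝ => (ε, p)) (𝓝 0) (𝓝 (0, p)) :=
      (Continuous.tendsto (by fun_prop) _)
    filter_upwards [ht.eventually hdiff] with ε hε
    have := hε.hasFDerivAt.comp p (hasFDerivAt_prodMk_right ε p)
    simp [pd, show (fun q => F (ε, q)) = F ∘ fun q => (ε, q) from rfl, this.fderiv]
  have h2 : dF =ᶠ[𝓝 p] fun q => fderiv ℝ F (0, q) (1, 0) := by
    have ht : Tendsto (fun q : Spacetime => ((0 : ℝ), q)) (𝓝 p) (𝓝 (0, p)) :=
      (Continuous.tendsto (by fun_prop) _)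
    filter_upwards [ht.eventually hdiff, hdF] with q hq hd
    refine hd.unique ?_
    exact hq.hasFDerivAt.comp_hasDerivAt (0 : ℝ)
      ((hasDerivAt_id (0 : ℝ)).prodMk (hasDerivAt_const (0 : ℝ) q))
  have h3 : HasDerivAt (fun ε => fderiv ℝ F (ε, p) (0, basisVec κ))
      ((fderiv ℝ (fderiv ℝ F) (0, p)).flip (0, basisVec κ) (1, 0)) 0 :=
    HasFDerivAt.comp_hasDerivAt (l := fun z => fderiv ℝ F z (0, basisVec κ))
      (f := fun ε : ℝ => (ε, p)) (0 : ℝ) (happ (0, basisVec κ))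
      ((hasDerivAt_id (0 : ℝ)).prodMk (hasDerivAt_const (0 : ℝ) p))
  have h4 : pd κ dF p = fderiv ℝ (fderiv ℝ F) (0, p) (0, basisVec κ) (1, 0) := by
    have := (happ (1, 0)).comp p (hasFDerivAt_prodMk_right (0 : ℝ) p)
    rw [pd, h2.fderiv_eq]
    change fderiv ℝ ((fun z => fderiv ℝ F z (1, 0)) ∘ fun q => ((0 : ℝ), q)) p (basisVec κ) = _
    rw [this.fderiv]
    simp
  rw [h4, hs.eq]
  exact h3.congr_of_eventuallyEq h1

lemma sum_four (f : Fin 4 → ℝ) : ∑ μ, f μ = f 0 + ∑ i : Fin 3, f i.succ := Fin.sum_univ_succ f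

/-- The conformal Hubble rate `a'/a`. -/
def hubble (a : ℝ → ℝ) (τ : ℝ) : ℝ := deriv a τ / a τ

/-- The component `γ_{ij}` as a function on spacetime. -/
abbrev comp (γ : Spacetime → Matrix (Fin 3) (Fin 3) ℝ) (i j : Fin 3) : Spacetime → ℝ :=
  fun q => γ q i j

/-- The first-order part `a² γ_{ij} dxⁱ dxʲ` of the perturbed metric. -/
def perturbationTensor (a : ℝ → ℝ) (γ : Spacetime → Matrix (Fin 3) (Fin 3) ℝ) : Tensor2 :=
  fun p => Matrix.of fun μ ν : Fin 4 =>
    Fin.cases (0 : ℝ) (fun i : Fin 3 => Fin.cases (0 : ℝ) (fun j => a p.1 ^ 2 * γ p i j) ν) μ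

section entries
variable (a : ℝ → ℝ) (γ : Spacetime → Matrix (Fin 3) (Fin 3) ℝ) (q : Spacetime) (i j : Fin 3)

lemma flrw_zero_zero : flrwMetric a q 0 0 = -(a q.1 ^ 2) := by
  simp [flrwMetric, synchronousMetric]
lemma flrw_zero_succ : flrwMetric a q 0 i.succ = 0 := by
  simp [flrwMetric, synchronousMetric]
lemma flrw_succ_zero : flrwMetric a q i.succ 0 = 0 := by
  simp [flrwMetric, synchronousMetric]
lemma flrw_succ_succ : flrwMetric a q i.succ j.succ = if i = j then a q.1 ^ 2 else 0 := by
  simp [flrwMetric, synchronousMetric, Matrix.one_apply]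
lemma pert_zero (ν : Fin 4) : perturbationTensor a γ q 0 ν = 0 := by
  simp [perturbationTensor]
lemma pert_succ_zero : perturbationTensor a γ q i.succ 0 = 0 := by
  simp [perturbationTensor]
lemma pert_succ_succ : perturbationTensor a γ q i.succ j.succ = a q.1 ^ 2 * γ q i j := by
  simp [perturbationTensor]

lemma perturbedMetric_eq (ε : ℝ) :
    perturbedMetric a γ ε q = flrwMetric a q + ε • perturbationTensor a γ q := by
  ext μ ν
  refine Fin.cases ?_ (fun i => ?_) μ <;> refine Fin.cases ?_ (fun j => ?_) ν <;>
    simp [perturbedMetric, flrwMetric, synchronousMetric, perturbationTensor]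
  ring

/-- The inverse of the background metric. -/
def flrwInv (a : ℝ → ℝ) (q : Spacetime) : Matrix (Fin 4) (Fin 4) ℝ :=
  Matrix.diagonal (Fin.cases (-(a q.1 ^ 2)⁻¹) fun _ => (a q.1 ^ 2)⁻¹)

lemma flrwMetric_eq_diagonal : flrwMetric a q =
    Matrix.diagonal (Fin.cases (-(a q.1 ^ 2)) fun _ => a q.1 ^ 2) := by
  ext μ ν
  refine Fin.cases ?_ (fun i => ?_) μ <;> refine Fin.cases ?_ (fun j => ?_) ν <;>
    simp [flrw_zero_zero, flrw_zero_succ, flrw_succ_zero, flrw_succ_succ, Matrix.diagonal_apply,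
      (Fin.succ_ne_zero _).symm]

lemma flrwMetric_det (h : a q.1 ≠ 0) : (flrwMetric a q).det ≠ 0 := by
  rw [flrwMetric_eq_diagonal, Matrix.det_diagonal, Fin.prod_univ_succ]
  simp [h]

lemma flrwMetric_inv (h : a q.1 ≠ 0) : (flrwMetric a q)⁻¹ = flrwInv a q := by
  refine Matrix.inv_eq_right_inv ?_
  rw [flrwMetric_eq_diagonal, flrwInv, Matrix.diagonal_mul_diagonal, ← Matrix.diagonal_one]
  congr 1; funext μ
  refine Fin.cases ?_ (fun i => ?_) μ <;> simp [h]

lemma flrwInv_zero_zero : flrwInv a q 0 0 = -(a q.1 ^ 2)⁻¹ := by simp [flrwInv]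
lemma flrwInv_zero_succ : flrwInv a q 0 i.succ = 0 := by
  simp [flrwInv, (Fin.succ_ne_zero _).symm]
lemma flrwInv_succ_zero : flrwInv a q i.succ 0 = 0 := by
  simp [flrwInv]
lemma flrwInv_succ_succ : flrwInv a q i.succ j.succ = if i = j then (a q.1 ^ 2)⁻¹ else 0 := by
  simp [flrwInv, Matrix.diagonal_apply]

end entries

/-- The background Christoffel symbols. -/
def christoffel₀ (a : ℝ → ℝ) (σ μ ν : Fin 4) : Spacetime → ℝ := fun q =>
  Fin.cases
    (Fin.cases (Fin.cases (hubble a q.1) (fun _ => 0) ν)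
      (fun i => Fin.cases 0 (fun j => if i = j then hubble a q.1 else 0) ν) μ)
    (fun k => Fin.cases (Fin.cases 0 (fun j => if k = j then hubble a q.1 else 0) ν)
      (fun i => Fin.cases (if k = i then hubble a q.1 else 0) (fun _ => 0) ν) μ) σ

/-- The first-order part of the Christoffel symbols. -/
def christoffel₁ (a : ℝ → ℝ) (γ : Spacetime → Matrix (Fin 3) (Fin 3) ℝ) (σ μ ν : Fin 4) :
    Spacetime → ℝ := fun q =>
  Fin.cases
    (Fin.cases (Fin.cases 0 (fun _ => 0) ν)
      (fun i => Fin.cases 0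
        (fun j => hubble a q.1 * γ q i j + 1 / 2 * pd 0 (comp γ i j) q) ν) μ)
    (fun k => Fin.cases (Fin.cases 0 (fun j => 1 / 2 * pd 0 (comp γ k j) q) ν)
      (fun i => Fin.cases (1 / 2 * pd 0 (comp γ k i) q)
        (fun j => 1 / 2 * (sd i (comp γ k j) q + sd j (comp γ k i) q - sd k (comp γ i j) q)) ν) μ) σ

/-! ### Christoffel symbols to zeroth and first order -/

section linearization
variable {τ₀ : ℝ} {a : ℝ → ℝ} {γ : Spacetime → Matrix (Fin 3) (Fin 3) ℝ}

lemma diffAt_scale (ha : ContDiffOn ℝ ∞ a (Ioo τ₀ 0)) {τ : ℝ} (hτ : τ ∈ Ioo τ₀ 0) :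
    DifferentiableAt ℝ a τ :=
  (ha.contDiffAt (isOpen_Ioo.mem_nhds hτ)).differentiableAt (by simp)

lemma contDiffOn_hubble (ha : ContDiffOn ℝ ∞ a (Ioo τ₀ 0)) (hpos : ∀ τ ∈ Ioo τ₀ 0, 0 < a τ) :
    ContDiffOn ℝ ∞ (hubble a) (Ioo τ₀ 0) :=
  (ha.deriv_of_isOpen isOpen_Ioo (by simp)).div ha fun τ hτ => (hpos τ hτ).ne'

lemma diffAt_hubble (ha : ContDiffOn ℝ ∞ a (Ioo τ₀ 0)) (hpos : ∀ τ ∈ Ioo τ₀ 0, 0 < a τ)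
    {τ : ℝ} (hτ : τ ∈ Ioo τ₀ 0) : DifferentiableAt ℝ (hubble a) τ :=
  ((contDiffOn_hubble ha hpos).contDiffAt (isOpen_Ioo.mem_nhds hτ)).differentiableAt (by simp)

lemma slabSmooth_flrw (ha : ContDiffOn ℝ ∞ a (Ioo τ₀ 0)) (μ ν : Fin 4) :
    SlabSmooth τ₀ (fun q => flrwMetric a q μ ν) := by
  have h : SlabSmooth τ₀ (fun q => a q.1) := slabSmooth_of_time ha
  refine Fin.cases ?_ (fun i => ?_) μ <;> refine Fin.cases ?_ (fun j => ?_) ν <;>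
    simp only [flrw_zero_zero, flrw_zero_succ, flrw_succ_zero, flrw_succ_succ]
  · exact (h.pow 2).neg
  · exact contDiffOn_const
  · exact contDiffOn_const
  · split_ifs
    · exact h.pow 2
    · exact contDiffOn_const

lemma slabSmooth_pert (ha : ContDiffOn ℝ ∞ a (Ioo τ₀ 0))
    (hγ : ∀ i j, SlabSmooth τ₀ (comp γ i j)) (μ ν : Fin 4) :
    SlabSmooth τ₀ (fun q => perturbationTensor a γ q μ ν) := by
  have h : SlabSmooth τ₀ (fun q => a q.1) := slabSmooth_of_time ha
  refine Fin.cases ?_ (fun i => ?_) μ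
  · simp only [pert_zero]; exact contDiffOn_const
  · refine Fin.cases ?_ (fun j => ?_) ν
    · simp only [pert_succ_zero]; exact contDiffOn_const
    · simp only [pert_succ_succ]
      exact (h.pow 2).mul (hγ i j)

lemma deriv_scale_sq (ha : ContDiffOn ℝ ∞ a (Ioo τ₀ 0)) {τ : ℝ} (hτ : τ ∈ Ioo τ₀ 0) :
    deriv (fun t => a t ^ 2) τ = 2 * a τ * deriv a τ := by
  simp [deriv_fun_pow (diffAt_scale ha hτ)]

lemma pd_flrw (ha : ContDiffOn ℝ ∞ a (Ioo τ₀ 0)) {q : Spacetime} (hq : q ∈ slab τ₀)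
    (κ μ ν : Fin 4) : pd κ (fun q => flrwMetric a q μ ν) q =
      Fin.cases (Fin.cases (Fin.cases (-(2 * a q.1 * deriv a q.1)) (fun _ => 0) ν)
        (fun i => Fin.cases 0 (fun j => if i = j then 2 * a q.1 * deriv a q.1 else 0) ν) μ)
        (fun _ => 0) κ := by
  have hd : DifferentiableAt ℝ (fun t => a t ^ 2) q.1 := (diffAt_scale ha hq.1).pow 2
  have h0 := pd_time_zero (c := fun t => a t ^ 2) (p := q) hd
  have hs := pd_time_succ (c := fun t => a t ^ 2) (p := q) hd
  rw [deriv_scale_sq ha hq.1] at h0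
  refine Fin.cases ?_ (fun i => ?_) μ <;> refine Fin.cases ?_ (fun j => ?_) ν <;>
    refine Fin.cases ?_ (fun k => ?_) κ <;>
    simp only [flrw_zero_zero, flrw_zero_succ, flrw_succ_zero, flrw_succ_succ, Fin.cases_zero,
      Fin.cases_succ, pd_const, pd_neg, h0, hs, neg_zero] <;>
    split_ifs <;> simp only [h0, hs, pd_const]

lemma pd_zero_pert (ha : ContDiffOn ℝ ∞ a (Ioo τ₀ 0)) (hγ : ∀ i j, SlabSmooth τ₀ (comp γ i j))
    {q : Spacetime} (hq : q ∈ slab τ₀) (i j : Fin 3) :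
    pd 0 (fun q => a q.1 ^ 2 * γ q i j) q =
      2 * a q.1 * deriv a q.1 * γ q i j + a q.1 ^ 2 * pd 0 (comp γ i j) q := by
  have hd : DifferentiableAt ℝ (fun t => a t ^ 2) q.1 := (diffAt_scale ha hq.1).pow 2
  have hd' : DifferentiableAt ℝ (fun q : Spacetime => a q.1 ^ 2) q :=
    DifferentiableAt.comp q hd differentiableAt_fst
  rw [pd_mul hd' ((hγ i j).differentiableAt hq), pd_time_zero (c := fun t => a t ^ 2) hd,
    deriv_scale_sq ha hq.1]

lemma pd_succ_pert (ha : ContDiffOn ℝ ∞ a (Ioo τ₀ 0)) (hγ : ∀ i j, SlabSmooth τ₀ (comp γ i j))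
    {q : Spacetime} (hq : q ∈ slab τ₀) (k i j : Fin 3) :
    pd k.succ (fun q => a q.1 ^ 2 * γ q i j) q =
      a q.1 ^ 2 * sd k (comp γ i j) q := by
  have hd : DifferentiableAt ℝ (fun t => a t ^ 2) q.1 := (diffAt_scale ha hq.1).pow 2
  exact sd_time_mul hd ((hγ i j).differentiableAt hq) k

lemma pd_perturbedMetric (ha : ContDiffOn ℝ ∞ a (Ioo τ₀ 0))
    (hγ : ∀ i j, SlabSmooth τ₀ (comp γ i j)) (ε : ℝ) {q : Spacetime} (hq : q ∈ slab τ₀)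
    (κ μ ν : Fin 4) : pd κ (fun q => perturbedMetric a γ ε q μ ν) q =
      pd κ (fun q => flrwMetric a q μ ν) q + ε * pd κ (fun q => perturbationTensor a γ q μ ν) q := by
  have h1 := (slabSmooth_flrw ha μ ν).differentiableAt hq
  have h2 := (slabSmooth_pert ha hγ μ ν).differentiableAt hq
  simp only [perturbedMetric_eq, Matrix.add_apply, Matrix.smul_apply, smul_eq_mul]
  rw [pd_add h1 (h2.const_mul ε), pd_const_mul h2]

lemma christoffel_flrw (ha : ContDiffOn ℝ ∞ a (Ioo τ₀ 0)) (hpos : ∀ τ ∈ Ioo τ₀ 0, 0 < a τ)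
    (σ μ ν : Fin 4) {q : Spacetime} (hq : q ∈ slab τ₀) :
    christoffel (flrwMetric a) σ μ ν q = christoffel₀ a σ μ ν q := by
  have h0 := (hpos q.1 hq.1).ne'
  simp only [christoffel, flrwMetric_inv a q h0, pd_flrw ha hq]
  refine Fin.cases ?_ (fun k => ?_) σ <;> refine Fin.cases ?_ (fun i => ?_) μ <;>
    refine Fin.cases ?_ (fun j => ?_) ν <;>
    simp [sum_four, christoffel₀, flrwInv_zero_zero, flrwInv_zero_succ, flrwInv_succ_zero,
      flrwInv_succ_succ, hubble] <;> (try split_ifs) <;> (try field_simp) <;> (try ring)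

/-- The metric is affine in `ε`, so the bracket of first derivatives is affine as well, and the only
nonlinear factor is the inverse metric. The product rule is then evaluated for each time/space
pattern of the indices. -/
lemma hasDerivAt_christoffel (ha : ContDiffOn ℝ ∞ a (Ioo τ₀ 0)) (hpos : ∀ τ ∈ Ioo τ₀ 0, 0 < a τ)
    (hγ : ∀ i j, SlabSmooth τ₀ (comp γ i j)) (σ μ ν : Fin 4) {q : Spacetime} (hq : q ∈ slab τ₀) :
    HasDerivAt (fun ε => christoffel (perturbedMetric a γ ε) σ μ ν q)
      (christoffel₁ a γ σ μ ν q) 0 := by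
  have h0 := (hpos q.1 hq.1).ne'
  have hinv (κ : Fin 4) := hasDerivAt_inv_entry (flrwMetric a q) (perturbationTensor a γ q)
    (flrwMetric_det a q h0) σ κ
  have haff (u v : ℝ) : HasDerivAt (fun ε : ℝ => u + ε * v) v 0 := by
    simpa using ((hasDerivAt_id (0 : ℝ)).mul_const v).const_add u
  have key := (HasDerivAt.fun_sum (u := Finset.univ) fun κ _ =>
    (hinv κ).fun_mul (((haff (pd μ (fun q => flrwMetric a q κ ν) q)
      (pd μ (fun q => perturbationTensor a γ q κ ν) q)).fun_add
      (haff (pd ν (fun q => flrwMetric a q κ μ) q)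
      (pd ν (fun q => perturbationTensor a γ q κ μ) q))).fun_sub
      (haff (pd κ (fun q => flrwMetric a q μ ν) q)
      (pd κ (fun q => perturbationTensor a γ q μ ν) q)))).const_mul (1 / 2 : ℝ)
  simp only [christoffel, pd_perturbedMetric ha hγ _ hq]
  simp only [perturbedMetric_eq]
  refine key.congr_deriv ?_
  simp only [flrwMetric_inv a q h0, pd_flrw ha hq, zero_smul, add_zero, zero_mul]
  refine Fin.cases ?_ (fun k => ?_) σ <;> refine Fin.cases ?_ (fun i => ?_) μ <;>
    refine Fin.cases ?_ (fun j => ?_) ν <;>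
    simp [sum_four, christoffel₁, flrwInv_zero_zero, flrwInv_zero_succ, flrwInv_succ_zero,
      flrwInv_succ_succ, hubble, Matrix.mul_apply, pert_zero, pert_succ_zero, pert_succ_succ,
      pd_zero_pert ha hγ hq, pd_succ_pert ha hγ hq, pd_const,
      Finset.sum_add_distrib, Finset.sum_neg_distrib] <;>
    (try field_simp) <;> (try ring)

end linearization

end

end DustPert

namespace DustPert

noncomputable section

/-! ### Ricci tensor to first order, Friedmann equations, and the field equations in trace-reversed
form -/

section ricci
variable {τ₀ : ℝ} {a : ℝ → ℝ} {γ : Spacetime → Matrix (Fin 3) (Fin 3) ℝ}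

/-- Joint regularity in `(ε, p)` is what permits exchanging `d/dε` with the spacetime derivatives in
the Ricci tensor. -/
lemma contDiffAt_christoffel (ha : ContDiffOn ℝ ∞ a (Ioo τ₀ 0)) (hpos : ∀ τ ∈ Ioo τ₀ 0, 0 < a τ)
    (hγ : ∀ i j, SlabSmooth τ₀ (comp γ i j)) (σ μ ν : Fin 4) {p : Spacetime} (hp : p ∈ slab τ₀) :
    ContDiffAt ℝ 2 (fun z : ℝ × Spacetime => christoffel (perturbedMetric a γ z.1) σ μ ν z.2)
      (0, p) := by
  have hle : (2 : ℕ∞ω) ≤ ∞ := WithTop.coe_le_coe.2 le_top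
  have hlift {f : Spacetime → ℝ} (hf : SlabSmooth τ₀ f) :
      ContDiffAt ℝ 2 (fun z : ℝ × Spacetime => f z.2) (0, p) :=
    ContDiffAt.comp (0, p) ((hf.contDiffAt hp).of_le hle) contDiffAt_snd
  have hinv (κ : Fin 4) : ContDiffAt ℝ 2
      (fun z : ℝ × Spacetime => (perturbedMetric a γ z.1 z.2)⁻¹ σ κ) (0, p) := by
    refine contDiffAt_inv_entry (fun i j => ?_) ?_ σ κ
    · simp only [perturbedMetric_eq, Matrix.add_apply, Matrix.smul_apply, smul_eq_mul]
      exact (hlift (slabSmooth_flrw ha i j)).add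
        (contDiffAt_fst.mul (hlift (slabSmooth_pert ha hγ i j)))
    · simpa [perturbedMetric_eq] using flrwMetric_det a p (hpos p.1 hp.1).ne'
  have hev : ∀ᶠ z in 𝓝 ((0 : ℝ), p), z.2 ∈ slab τ₀ :=
    (continuous_snd.tendsto ((0 : ℝ), p)).eventually (slab_mem_nhds hp)
  have hpd (κ i j : Fin 4) : ContDiffAt ℝ 2
      (fun z : ℝ × Spacetime => pd κ (fun q => perturbedMetric a γ z.1 q i j) z.2) (0, p) := by
    have : ContDiffAt ℝ 2 (fun z : ℝ × Spacetime => pd κ (fun q => flrwMetric a q i j) z.2 +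
        z.1 * pd κ (fun q => perturbationTensor a γ q i j) z.2) (0, p) :=
      (hlift ((slabSmooth_flrw ha i j).pd κ)).add
        (contDiffAt_fst.mul (hlift ((slabSmooth_pert ha hγ i j).pd κ)))
    refine this.congr_of_eventuallyEq ?_
    filter_upwards [hev] with z hz using pd_perturbedMetric ha hγ z.1 hz κ i j
  simp only [christoffel]
  exact contDiffAt_const.mul (ContDiffAt.sum fun κ _ =>
    (hinv κ).mul (((hpd _ _ _).add (hpd _ _ _)).sub (hpd _ _ _)))

lemma hasDerivAt_pd_christoffel (ha : ContDiffOn ℝ ∞ a (Ioo τ₀ 0))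
    (hpos : ∀ τ ∈ Ioo τ₀ 0, 0 < a τ) (hγ : ∀ i j, SlabSmooth τ₀ (comp γ i j)) (κ σ μ ν : Fin 4)
    {p : Spacetime} (hp : p ∈ slab τ₀) :
    HasDerivAt (fun ε => pd κ (christoffel (perturbedMetric a γ ε) σ μ ν) p)
      (pd κ (christoffel₁ a γ σ μ ν) p) 0 :=
  hasDerivAt_pd_of_contDiffAt
    (F := fun z : ℝ × Spacetime => christoffel (perturbedMetric a γ z.1) σ μ ν z.2)
    (contDiffAt_christoffel ha hpos hγ σ μ ν hp)
    (by filter_upwards [slab_mem_nhds hp] with q hq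
        exact hasDerivAt_christoffel ha hpos hγ σ μ ν hq) κ

/-- The first-order part of the Ricci tensor. -/
def ricci₁ (a : ℝ → ℝ) (γ : Spacetime → Matrix (Fin 3) (Fin 3) ℝ) (μ ν : Fin 4)
    (p : Spacetime) : ℝ :=
  (∑ σ : Fin 4, (pd σ (christoffel₁ a γ σ μ ν) p - pd ν (christoffel₁ a γ σ μ σ) p)) +
  ∑ σ : Fin 4, ∑ κ : Fin 4,
    ((christoffel₁ a γ σ σ κ p * christoffel₀ a κ μ ν p +
        christoffel₀ a σ σ κ p * christoffel₁ a γ κ μ ν p) -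
      (christoffel₁ a γ σ ν κ p * christoffel₀ a κ μ σ p +
        christoffel₀ a σ ν κ p * christoffel₁ a γ κ μ σ p))

lemma perturbedMetric_zero : perturbedMetric a γ 0 = flrwMetric a := by
  funext q; rw [perturbedMetric_eq]; simp

lemma hasDerivAt_ricci (ha : ContDiffOn ℝ ∞ a (Ioo τ₀ 0)) (hpos : ∀ τ ∈ Ioo τ₀ 0, 0 < a τ)
    (hγ : ∀ i j, SlabSmooth τ₀ (comp γ i j)) (μ ν : Fin 4) {p : Spacetime} (hp : p ∈ slab τ₀) :
    HasDerivAt (fun ε => ricci (perturbedMetric a γ ε) μ ν p) (ricci₁ a γ μ ν p) 0 := by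
  have h1 := fun σ μ ν => hasDerivAt_christoffel ha hpos hγ σ μ ν hp
  have h2 := fun κ σ μ ν => hasDerivAt_pd_christoffel ha hpos hγ κ σ μ ν hp
  have key := (HasDerivAt.fun_sum (u := Finset.univ) fun σ _ =>
    (h2 σ σ μ ν).fun_sub (h2 ν σ μ σ)).fun_add (HasDerivAt.fun_sum (u := Finset.univ) fun σ _ =>
      HasDerivAt.fun_sum (u := Finset.univ) fun κ _ =>
      ((h1 σ σ κ).fun_mul (h1 κ μ ν)).fun_sub ((h1 σ ν κ).fun_mul (h1 κ μ σ)))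
  simp only [perturbedMetric_zero, christoffel_flrw ha hpos _ _ _ hp] at key
  exact key

/-! #### Evaluation of the Ricci tensor -/

section values
variable (i j k : Fin 3)

/-- The component tables are equalities of functions, not of values, because the symbols occur
inside `pd`. -/
lemma chr0_000 : christoffel₀ a 0 0 0 = fun q => hubble a q.1 := rfl
lemma chr0_00s : christoffel₀ a 0 0 i.succ = fun _ => 0 := rfl
lemma chr0_0s0 : christoffel₀ a 0 i.succ 0 = fun _ => 0 := rfl
lemma chr0_0ss : christoffel₀ a 0 i.succ j.succ = fun q => if i = j then hubble a q.1 else 0 := rfl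
lemma chr0_s00 : christoffel₀ a k.succ 0 0 = fun _ => 0 := rfl
lemma chr0_s0s : christoffel₀ a k.succ 0 j.succ = fun q => if k = j then hubble a q.1 else 0 := rfl
lemma chr0_ss0 : christoffel₀ a k.succ j.succ 0 = fun q => if k = j then hubble a q.1 else 0 := rfl
lemma chr0_sss : christoffel₀ a k.succ i.succ j.succ = fun _ => 0 := rfl

lemma chr1_000 : christoffel₁ a γ 0 0 0 = fun _ => 0 := rfl
lemma chr1_00s : christoffel₁ a γ 0 0 i.succ = fun _ => 0 := rfl
lemma chr1_0s0 : christoffel₁ a γ 0 i.succ 0 = fun _ => 0 := rfl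
lemma chr1_0ss : christoffel₁ a γ 0 i.succ j.succ =
    fun q => hubble a q.1 * γ q i j + 1 / 2 * pd 0 (comp γ i j) q := rfl
lemma chr1_s00 : christoffel₁ a γ k.succ 0 0 = fun _ => 0 := rfl
lemma chr1_s0s : christoffel₁ a γ k.succ 0 j.succ = fun q => 1 / 2 * pd 0 (comp γ k j) q := rfl
lemma chr1_ss0 : christoffel₁ a γ k.succ i.succ 0 = fun q => 1 / 2 * pd 0 (comp γ k i) q := rfl
lemma chr1_sss : christoffel₁ a γ k.succ i.succ j.succ = fun q =>
    1 / 2 * (sd i (comp γ k j) q + sd j (comp γ k i) q - sd k (comp γ i j) q) := rfl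

end values

lemma pd_if_time {c : ℝ → ℝ} {p : Spacetime} (P : Prop) [Decidable P] (κ : Fin 4) :
    pd κ (fun q => if P then c q.1 else 0) p = if P then pd κ (fun q => c q.1) p else 0 := by
  split_ifs
  · rfl
  · exact pd_const _ _ _

lemma ricci_flrw (ha : ContDiffOn ℝ ∞ a (Ioo τ₀ 0)) (hpos : ∀ τ ∈ Ioo τ₀ 0, 0 < a τ)
    {p : Spacetime} (hp : p ∈ slab τ₀) (μ ν : Fin 4) :
    ricci (flrwMetric a) μ ν p = Fin.cases (Fin.cases (-3 * deriv (hubble a) p.1) (fun _ => 0) ν)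
      (fun i => Fin.cases 0
        (fun j => if i = j then deriv (hubble a) p.1 + 2 * hubble a p.1 ^ 2 else 0) ν) μ := by
  have hd := diffAt_hubble ha hpos hp.1
  have hc (κ σ μ ν : Fin 4) : pd κ (christoffel (flrwMetric a) σ μ ν) p =
      pd κ (christoffel₀ a σ μ ν) p :=
    pd_congr (fun q hq => christoffel_flrw ha hpos σ μ ν hq) κ hp
  simp only [ricci, hc, christoffel_flrw ha hpos _ _ _ hp]
  have hb := pd_time_zero hd
  have hbs := pd_time_succ hd
  refine Fin.cases ?_ (fun i => ?_) μ <;> refine Fin.cases ?_ (fun j => ?_) ν <;>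
    simp [sum_four, chr0_000, chr0_00s, chr0_0s0, chr0_0ss, chr0_s00, chr0_s0s, chr0_ss0, chr0_sss,
      pd_const, pd_if_time, hb, hbs, Finset.sum_add_distrib]
  rcases eq_or_ne i j with rfl | h
  · simp; ring
  · simp [h, h.symm]

lemma ricci₁_zero_zero (hγ : ∀ i j, SlabSmooth τ₀ (comp γ i j)) {p : Spacetime} (hp : p ∈ slab τ₀) :
    ricci₁ a γ 0 0 p = -(1 / 2) * ∑ k, (pd 0 (pd 0 (comp γ k k)) p +
      hubble a p.1 * pd 0 (comp γ k k) p) := by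
  have h1 (i j : Fin 3) : DifferentiableAt ℝ (pd 0 (comp γ i j)) p :=
    ((hγ i j).pd 0).differentiableAt hp
  simp only [ricci₁, sum_four, chr0_000, chr0_00s, chr0_s00, chr0_s0s, chr0_ss0,
    chr0_sss, chr1_000, chr1_00s, chr1_s00, chr1_s0s, chr1_ss0, chr1_sss,
    pd_const, pd_const_mul (h1 _ _)]
  simp [Fin.sum_univ_three]
  ring

/-- Symmetry of `γ` is not assumed. The second sum is the contribution of the antisymmetric part;
analogous terms occur in `ricci₁_succ_succ`, and all of them drop out for symmetric `γ`. -/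
lemma ricci₁_zero_succ (hγ : ∀ i j, SlabSmooth τ₀ (comp γ i j)) {p : Spacetime} (hp : p ∈ slab τ₀) (i : Fin 3) :
    ricci₁ a γ 0 i.succ p =
      (1 / 2) * ∑ k, (sd k (pd 0 (comp γ k i)) p - sd i (pd 0 (comp γ k k)) p) +
      hubble a p.1 / 2 * ∑ k, (sd k (comp γ i k) p - sd k (comp γ k i) p) := by
  have h1 (i j : Fin 3) : DifferentiableAt ℝ (pd 0 (comp γ i j)) p :=
    ((hγ i j).pd 0).differentiableAt hp
  simp only [ricci₁, sum_four, chr0_000, chr0_00s, chr0_0s0, chr0_0ss, chr0_s00, chr0_s0s, chr0_ss0,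
    chr0_sss, chr1_000, chr1_00s, chr1_0s0, chr1_0ss, chr1_s00, chr1_s0s, chr1_ss0, chr1_sss,
    pd_const, pd_const_mul (h1 _ _)]
  fin_cases i <;> simp [Fin.sum_univ_three, sd] <;> ring

lemma ricci₁_succ_succ (ha : ContDiffOn ℝ ∞ a (Ioo τ₀ 0)) (hpos : ∀ τ ∈ Ioo τ₀ 0, 0 < a τ)
    (hγ : ∀ i j, SlabSmooth τ₀ (comp γ i j)) {p : Spacetime} (hp : p ∈ slab τ₀)
    (i j : Fin 3) :
    ricci₁ a γ i.succ j.succ p =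
      (1 / 2) * (pd 0 (pd 0 (comp γ i j)) p + 2 * hubble a p.1 * pd 0 (comp γ i j) p +
        (if i = j then hubble a p.1 * ∑ k, pd 0 (comp γ k k) p else 0)) +
      (deriv (hubble a) p.1 + 2 * hubble a p.1 ^ 2) * γ p i j +
      hubble a p.1 * (pd 0 (comp γ i j) p - pd 0 (comp γ j i) p) +
      hubble a p.1 ^ 2 * (γ p i j - γ p j i) +
      (1 / 2) * ∑ k, (sd k (sd i (comp γ k j)) p + sd k (sd j (comp γ k i)) p
        - sd k (sd k (comp γ i j)) p - sd j (sd i (comp γ k k)) p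
        - sd j (sd k (comp γ k i)) p + sd j (sd k (comp γ i k)) p) := by
  have hd := diffAt_hubble ha hpos hp.1
  have hd' : DifferentiableAt ℝ (fun q : Spacetime => hubble a q.1) p :=
    DifferentiableAt.comp p hd differentiableAt_fst
  have h0 (i j : Fin 3) : DifferentiableAt ℝ (fun q => γ q i j) p := (hγ i j).differentiableAt hp
  have h1 (i j : Fin 3) : DifferentiableAt ℝ (pd 0 (comp γ i j)) p :=
    ((hγ i j).pd 0).differentiableAt hp
  have h2 (k i j : Fin 3) : DifferentiableAt ℝ (sd k (comp γ i j)) p :=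
    ((hγ i j).sd k).differentiableAt hp
  have e1 (i j : Fin 3) : pd 0 (fun q => hubble a q.1 * γ q i j + 1 / 2 * pd 0 (comp γ i j) q) p =
      deriv (hubble a) p.1 * γ p i j + hubble a p.1 * pd 0 (comp γ i j) p +
        1 / 2 * pd 0 (pd 0 (comp γ i j)) p := by
    rw [pd_add (hd'.fun_mul (h0 i j)) ((h1 i j).const_mul _), pd_mul hd' (h0 i j),
      pd_const_mul (h1 i j), pd_time_zero hd]
  have e2 (l k i j : Fin 3) : pd l.succ (fun q => 1 / 2 *
      (sd i (comp γ k j) q + sd j (comp γ k i) q - sd k (comp γ i j) q)) p =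
      1 / 2 * (sd l (sd i (comp γ k j)) p + sd l (sd j (comp γ k i)) p
        - sd l (sd k (comp γ i j)) p) := by
    rw [pd_const_mul (((h2 _ _ _).fun_add (h2 _ _ _)).fun_sub (h2 _ _ _)),
      pd_sub ((h2 _ _ _).fun_add (h2 _ _ _)) (h2 _ _ _), pd_add (h2 _ _ _) (h2 _ _ _)]
    rfl
  simp only [ricci₁, sum_four, chr0_000, chr0_00s, chr0_0s0, chr0_0ss, chr0_ss0,
    chr0_sss, chr1_000, chr1_00s, chr1_0s0, chr1_0ss, chr1_ss0, chr1_sss,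
    pd_const, e1, e2]
  simp [Finset.sum_add_distrib, Finset.mul_sum, mul_add, mul_sub]
  split_ifs <;> simp [Fin.sum_univ_three] <;> ring

lemma scalarCurvature_flrw (ha : ContDiffOn ℝ ∞ a (Ioo τ₀ 0)) (hpos : ∀ τ ∈ Ioo τ₀ 0, 0 < a τ)
    {p : Spacetime} (hp : p ∈ slab τ₀) :
    scalarCurvature (flrwMetric a) p =
      6 * (a p.1 ^ 2)⁻¹ * (deriv (hubble a) p.1 + hubble a p.1 ^ 2) := by
  simp only [scalarCurvature, flrwMetric_inv a p (hpos p.1 hp.1).ne', ricci_flrw ha hpos hp]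
  simp [sum_four, flrwInv_zero_zero, flrwInv_zero_succ, flrwInv_succ_zero, flrwInv_succ_succ]
  ring

/-- The variation is `g^{μν} δR_{μν} - h^{μν} R_{μν}`; the second term reduces to the spatial trace
because `h_{0μ} = 0` and the background spatial Ricci tensor is pure trace. -/
lemma hasDerivAt_scalarCurvature (ha : ContDiffOn ℝ ∞ a (Ioo τ₀ 0))
    (hpos : ∀ τ ∈ Ioo τ₀ 0, 0 < a τ) (hγ : ∀ i j, SlabSmooth τ₀ (comp γ i j))
    {p : Spacetime} (hp : p ∈ slab τ₀) :
    HasDerivAt (fun ε => scalarCurvature (perturbedMetric a γ ε) p)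
      ((a p.1 ^ 2)⁻¹ * (-ricci₁ a γ 0 0 p + ∑ k : Fin 3, (ricci₁ a γ k.succ k.succ p -
        (deriv (hubble a) p.1 + 2 * hubble a p.1 ^ 2) * γ p k k))) 0 := by
  have h0 := (hpos p.1 hp.1).ne'
  have hinv (σ κ : Fin 4) := hasDerivAt_inv_entry (flrwMetric a p) (perturbationTensor a γ p)
    (flrwMetric_det a p h0) σ κ
  have key := HasDerivAt.fun_sum (u := Finset.univ) fun μ _ =>
    HasDerivAt.fun_sum (u := Finset.univ) fun ν _ =>
      (hinv μ ν).fun_mul (hasDerivAt_ricci ha hpos hγ μ ν hp)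
  simp only [scalarCurvature]
  simp only [perturbedMetric_eq]
  refine key.congr_deriv ?_
  simp only [perturbedMetric_zero, flrwMetric_inv a p h0, ricci_flrw ha hpos hp, zero_smul,
    add_zero]
  simp [sum_four, flrwInv_zero_zero, flrwInv_zero_succ, flrwInv_succ_zero, flrwInv_succ_succ,
    Matrix.mul_apply, pert_zero, pert_succ_zero, pert_succ_succ, Finset.sum_add_distrib]
  simp [Fin.sum_univ_three]
  field_simp
  ring

/-- The Friedmann equations. -/
lemma IsDustBackground.friedmann {Λ : ℝ} {ρ : ℝ → ℝ} (h : IsDustBackground Λ τ₀ a ρ) {τ : ℝ}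
    (hτ : τ ∈ Ioo τ₀ 0) : 3 * hubble a τ ^ 2 = a τ ^ 2 * (Λ + ρ τ) ∧
      2 * deriv (hubble a) τ + hubble a τ ^ 2 = Λ * a τ ^ 2 := by
  have hp := mk_mem_slab hτ (0 : Space)
  have h0 := (h.a_pos τ hτ).ne'
  -- The `00` component is the first Friedmann equation and one diagonal spatial component is the
  -- second.
  have e0 := h.einstein _ hp 0 0
  have e1 := h.einstein _ hp (Fin.succ 0) (Fin.succ 0)
  simp only [einsteinResidual, ricci_flrw h.smooth h.a_pos hp,
    scalarCurvature_flrw h.smooth h.a_pos hp, flrw_zero_zero, flrw_succ_succ, comovingVelocity,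
    Fin.cases_zero, Fin.cases_succ] at e0 e1
  simp at e0 e1
  field_simp at e0 e1
  constructor <;> linarith

/-- The linearized Einstein equations, in terms of the Ricci tensor. -/
lemma ricci₁_eq {Λ : ℝ} {ρ : ℝ → ℝ} (h : IsDustBackground Λ τ₀ a ρ)
    (hγ : ∀ i j, SlabSmooth τ₀ (comp γ i j)) {ρ₁ : Spacetime → ℝ}
    (hE : SolvesLinearizedEinstein Λ τ₀ a ρ γ ρ₁) {p : Spacetime} (hp : p ∈ slab τ₀) :
    ricci₁ a γ 0 0 p = 1 / 2 * a p.1 ^ 2 * ρ₁ p ∧ (∀ i : Fin 3, ricci₁ a γ 0 i.succ p = 0) ∧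
    ∀ i j : Fin 3, ricci₁ a γ i.succ j.succ p = (if i = j then 1 / 2 * a p.1 ^ 2 * ρ₁ p else 0) +
      (deriv (hubble a) p.1 + 2 * hubble a p.1 ^ 2) * γ p i j := by
  have ha := h.smooth
  have hpos := h.a_pos
  have h0 := (hpos p.1 hp.1).ne'
  obtain ⟨-, f2⟩ := h.friedmann hp.1
  -- `s` is the first-order scalar curvature. It is treated as an unknown until the trace of the
  -- equations determines it.
  set s := (a p.1 ^ 2)⁻¹ * (-ricci₁ a γ 0 0 p + ∑ k : Fin 3, (ricci₁ a γ k.succ k.succ p -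
        (deriv (hubble a) p.1 + 2 * hubble a p.1 ^ 2) * γ p k k)) with hs
  have key (μ ν : Fin 4) : ricci₁ a γ μ ν p - (1 / 2 * s * flrwMetric a p μ ν +
      1 / 2 * (6 * (a p.1 ^ 2)⁻¹ * (deriv (hubble a) p.1 + hubble a p.1 ^ 2)) *
        perturbationTensor a γ p μ ν) + Λ * perturbationTensor a γ p μ ν
      - ρ₁ p * comovingVelocity a p μ * comovingVelocity a p ν = 0 := by
    have haff (u v : ℝ) : HasDerivAt (fun ε : ℝ => u + ε * v) v 0 := by
      simpa using ((hasDerivAt_id (0 : ℝ)).mul_const v).const_add u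
    have hg : HasDerivAt (fun ε => perturbedMetric a γ ε p μ ν) (perturbationTensor a γ p μ ν) 0 := by
      simp only [perturbedMetric_eq, Matrix.add_apply, Matrix.smul_apply, smul_eq_mul]
      exact haff _ _
    have hall := (((hasDerivAt_ricci ha hpos hγ μ ν hp).fun_sub
      (((hasDerivAt_scalarCurvature ha hpos hγ hp).const_mul (1 / 2 : ℝ)).fun_mul hg)).fun_add
      (hg.const_mul Λ)).fun_sub (((haff (ρ p.1) (ρ₁ p)).mul_const
        (comovingVelocity a p μ)).mul_const (comovingVelocity a p ν))
    have := hall.unique (hE p hp μ ν)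
    simpa only [perturbedMetric_zero, scalarCurvature_flrw ha hpos hp, ← hs] using this
  have hs' : s * a p.1 ^ 2 = -ricci₁ a γ 0 0 p + ∑ k : Fin 3, (ricci₁ a γ k.succ k.succ p -
        (deriv (hubble a) p.1 + 2 * hubble a p.1 ^ 2) * γ p k k) := by
    rw [hs]; field_simp
  clear_value s
  have k00 := key 0 0
  simp only [flrw_zero_zero, pert_zero, comovingVelocity, Fin.cases_zero] at k00
  have kij (i j : Fin 3) : ricci₁ a γ i.succ j.succ p =
      (if i = j then 1 / 2 * (s * a p.1 ^ 2) else 0) +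
      (deriv (hubble a) p.1 + 2 * hubble a p.1 ^ 2) * γ p i j := by
    have := key i.succ j.succ
    simp only [flrw_succ_succ, pert_succ_succ, comovingVelocity, Fin.cases_succ] at this
    have h6 : 1 / 2 * (6 * (a p.1 ^ 2)⁻¹ * (deriv (hubble a) p.1 + hubble a p.1 ^ 2)) *
        (a p.1 ^ 2 * γ p i j) = 3 * (deriv (hubble a) p.1 + hubble a p.1 ^ 2) * γ p i j := by
      field_simp; ring
    rw [h6] at this
    -- The second Friedmann equation trades `Λ` for derivatives of the Hubble rate.
    have h7 : Λ * (a p.1 ^ 2 * γ p i j) =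
        (2 * deriv (hubble a) p.1 + hubble a p.1 ^ 2) * γ p i j := by rw [f2]; ring
    rw [h7] at this
    split_ifs at this ⊢ <;> linarith
  -- Inserting the spatial components in the definition of `s` gives `R₀₀ = s a² / 2`. The `00`
  -- equation says `R₀₀ = a² ρ₁ - s a² / 2`, so `s = ρ₁`.
  have hsum : s * a p.1 ^ 2 = -ricci₁ a γ 0 0 p + 3 / 2 * (s * a p.1 ^ 2) := by
    conv_lhs => rw [hs']
    simp only [kij, if_true]
    simp
    ring
  have hsr : s * a p.1 ^ 2 = a p.1 ^ 2 * ρ₁ p := by linarith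
  refine ⟨by linarith, fun i => ?_, fun i j => ?_⟩
  · have := key 0 i.succ
    simp only [flrw_zero_succ, pert_zero, comovingVelocity, Fin.cases_succ] at this
    linarith
  · rw [kij i j, hsr]; ring_nf

end ricci

end

end DustPert

namespace DustPert

noncomputable section

/-! ### The background -/

namespace IsDustBackground
variable {Λ τ₀ : ℝ} {a ρ : ℝ → ℝ}

/-- The first Friedmann equation makes `H² > 0`, so the continuous function `H` has a constant sign.
A negative sign would make `a` nonincreasing, against `a → ∞`. -/
lemma hubble_pos (h : IsDustBackground Λ τ₀ a ρ) (hΛ : 0 < Λ) {τ : ℝ} (hτ : τ ∈ Ioo τ₀ 0) :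
    0 < hubble a τ := by
  have hne : ∀ t ∈ Ioo τ₀ 0, hubble a t ≠ 0 := fun t ht h0 => by
    have h1 := (h.friedmann ht).1
    rw [h0] at h1
    have h2 := mul_pos (pow_pos (h.a_pos t ht) 2) (add_pos hΛ (h.rho_pos t ht))
    linarith
  have hcont : ContinuousOn (hubble a) (Ioo τ₀ 0) := (contDiffOn_hubble h.smooth h.a_pos).continuousOn
  by_contra hcon
  have hlt : hubble a τ < 0 := lt_of_le_of_ne (not_lt.1 hcon) (hne τ hτ)
  have hneg : ∀ t ∈ Ioo τ₀ 0, hubble a t < 0 := fun t ht => by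
    by_contra hc
    obtain ⟨s, hs, hs0⟩ := isPreconnected_Ioo.intermediate_value hτ ht hcont
      ⟨hlt.le, not_lt.1 hc⟩
    exact hne s hs hs0
  have hanti : AntitoneOn a (Ioo τ₀ 0) := by
    apply antitoneOn_of_deriv_nonpos (convex_Ioo τ₀ 0) h.smooth.continuousOn
    · exact fun t ht => (diffAt_scale h.smooth (interior_subset ht)).differentiableWithinAt
    · intro t ht
      have ht' := interior_subset ht
      have h1 := hneg t ht'
      rw [hubble, div_lt_iff₀ (h.a_pos t ht')] at h1
      linarith
  have hev : ∀ᶠ t in 𝓝[<] (0 : ℝ), t ∈ Ioo τ 0 := Ioo_mem_nhdsLT hτ.2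
  obtain ⟨t, ht, ht2⟩ := (hev.and (h.tendsto_atTop.eventually_gt_atTop (a τ))).exists
  exact absurd (hanti hτ ⟨hτ.1.trans ht.1, ht.2⟩ ht.1.le) (not_le.2 ht2)

lemma deriv_scale (h : IsDustBackground Λ τ₀ a ρ) {τ : ℝ} (hτ : τ ∈ Ioo τ₀ 0) :
    deriv a τ = hubble a τ * a τ := by
  rw [hubble, div_mul_cancel₀ _ (h.a_pos τ hτ).ne']

lemma hasDerivAt_scale (h : IsDustBackground Λ τ₀ a ρ) {τ : ℝ} (hτ : τ ∈ Ioo τ₀ 0) :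
    HasDerivAt a (hubble a τ * a τ) τ := by
  rw [← h.deriv_scale hτ]; exact (diffAt_scale h.smooth hτ).hasDerivAt

lemma hasDerivAt_hubble (h : IsDustBackground Λ τ₀ a ρ) {τ : ℝ} (hτ : τ ∈ Ioo τ₀ 0) :
    HasDerivAt (hubble a) ((Λ * a τ ^ 2 - hubble a τ ^ 2) / 2) τ := by
  have h1 := (diffAt_hubble h.smooth h.a_pos hτ).hasDerivAt
  have h2 := (h.friedmann hτ).2
  rwa [show deriv (hubble a) τ = (Λ * a τ ^ 2 - hubble a τ ^ 2) / 2 by linarith] at h1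

lemma monotoneOn_scale (h : IsDustBackground Λ τ₀ a ρ) (hΛ : 0 < Λ) :
    MonotoneOn a (Ioo τ₀ 0) := by
  apply monotoneOn_of_deriv_nonneg (convex_Ioo τ₀ 0) h.smooth.continuousOn
  · exact fun t ht => (diffAt_scale h.smooth (interior_subset ht)).differentiableWithinAt
  · intro t ht
    have ht' := interior_subset ht
    rw [h.deriv_scale ht']
    exact (mul_pos (h.hubble_pos hΛ ht') (h.a_pos t ht')).le

/-- Conservation of mass. -/
lemma exists_density (h : IsDustBackground Λ τ₀ a ρ) (hτ₀ : τ₀ < 0) :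
    ∃ ρ₀ : ℝ, 0 < ρ₀ ∧ ∀ τ ∈ Ioo τ₀ 0, ρ τ = ρ₀ / a τ ^ 3 := by
  obtain ⟨τ₁, h₁⟩ : (Ioo τ₀ 0).Nonempty := nonempty_Ioo.2 hτ₀
  -- The first Friedmann equation expresses `ρ a³` through smooth quantities; no regularity of `ρ`
  -- is given. The derivative of the right side is `3 H a (2 H' + H² - Λ a²)`, which vanishes by the
  -- second equation.
  have hform : ∀ t ∈ Ioo τ₀ 0, ρ t * a t ^ 3 = 3 * hubble a t ^ 2 * a t - Λ * a t ^ 3 :=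
    fun t ht => by linear_combination -a t * (h.friedmann ht).1
  have hd : ∀ t ∈ Ioo τ₀ 0,
      HasDerivAt (fun t => 3 * hubble a t ^ 2 * a t - Λ * a t ^ 3) 0 t := fun t ht => by
    have := ((((h.hasDerivAt_hubble ht).fun_pow 2).const_mul 3).fun_mul
      (h.hasDerivAt_scale ht)).fun_sub (((h.hasDerivAt_scale ht).fun_pow 3).const_mul Λ)
    refine this.congr_deriv ?_
    norm_num; ring
  have hconst : ∀ t ∈ Ioo τ₀ 0, ρ t * a t ^ 3 = ρ τ₁ * a τ₁ ^ 3 := fun t ht => by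
    rw [hform t ht, hform τ₁ h₁]
    exact IsOpen.is_const_of_deriv_eq_zero isOpen_Ioo isPreconnected_Ioo
      (fun s hs => (hd s hs).differentiableAt.differentiableWithinAt)
      (fun s hs => (hd s hs).deriv) ht h₁
  refine ⟨ρ τ₁ * a τ₁ ^ 3, mul_pos (h.rho_pos _ h₁) (pow_pos (h.a_pos _ h₁) 3), fun τ hτ => ?_⟩
  rw [← hconst τ hτ, mul_div_assoc, div_self (pow_pos (h.a_pos _ hτ) 3).ne', mul_one]

/-- The scale factor approaches that of de Sitter spacetime. -/
lemma tendsto_scale_div (h : IsDustBackground Λ τ₀ a ρ) (hΛ : 0 < Λ) (hτ₀ : τ₀ < 0) :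
    Tendsto (fun τ => a τ / deSitterScale Λ τ) (𝓝[<] 0) (𝓝 1) := by
  obtain ⟨ρ₀, -, hρ⟩ := h.exists_density hτ₀
  have hev : ∀ᶠ t in 𝓝[<] (0 : ℝ), t ∈ Ioo τ₀ 0 := Ioo_mem_nhdsLT hτ₀
  have hinv : Tendsto (fun t => (a t)⁻¹) (𝓝[<] 0) (𝓝 0) := tendsto_inv_atTop_zero.comp h.tendsto_atTop
  have hL : 0 < Real.sqrt (Λ / 3) := Real.sqrt_pos.2 (by positivity)
  have hlim : Tendsto (fun t => Real.sqrt ((Λ + ρ₀ * (a t)⁻¹ ^ 3) / 3)) (𝓝[<] 0)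
      (𝓝 (Real.sqrt (Λ / 3))) := by
    have : Tendsto (fun t => (Λ + ρ₀ * (a t)⁻¹ ^ 3) / 3) (𝓝[<] 0) (𝓝 ((Λ + ρ₀ * 0 ^ 3) / 3)) :=
      (((hinv.pow 3).const_mul ρ₀).const_add Λ).div_const 3
    simpa using this.sqrt
  -- The derivative of `1/a` is `-H/a`, and `H²/a² = (Λ + ρ₀ a⁻³)/3`. L'Hôpital's rule for `(1/a)/τ`
  -- then yields the asymptotics; positivity of `H` selects the root.
  have hder : Tendsto (fun t => -hubble a t * (a t)⁻¹ / 1) (𝓝[<] 0) (𝓝 (-Real.sqrt (Λ / 3))) := by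
    refine hlim.neg.congr' ?_
    filter_upwards [hev] with t ht
    have ha := h.a_pos t ht
    have hH := h.hubble_pos hΛ ht
    have : (Λ + ρ₀ * (a t)⁻¹ ^ 3) / 3 = (hubble a t * (a t)⁻¹) ^ 2 := by
      have h1 := (h.friedmann ht).1
      rw [hρ t ht] at h1
      field_simp
      field_simp at h1
      linarith
    rw [this, Real.sqrt_sq (by positivity)]
    ring
  have hd : ∀ t ∈ Ioo τ₀ 0, HasDerivAt (fun t => (a t)⁻¹) (-hubble a t * (a t)⁻¹) t := fun t ht => by
    have ha := (h.a_pos t ht).ne'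
    refine ((h.hasDerivAt_scale ht).fun_inv ha).congr_deriv ?_
    field_simp
  have hq := HasDerivAt.lhopital_zero_left_on_Ioo (f := fun t => (a t)⁻¹) (g := fun t => t)
    hτ₀ hd (fun t _ => hasDerivAt_id t) (fun _ _ => one_ne_zero) hinv
    (tendsto_id.mono_left nhdsWithin_le_nhds) hder
  have hfin := ((hq.inv₀ (neg_ne_zero.2 hL.ne')).const_mul (-(Real.sqrt (3 / Λ))⁻¹))
  have hval : -(Real.sqrt (3 / Λ))⁻¹ * (-Real.sqrt (Λ / 3))⁻¹ = 1 := by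
    have h3 : Real.sqrt (3 / Λ) * Real.sqrt (Λ / 3) = 1 := by
      rw [← Real.sqrt_mul (by positivity)]
      rw [show 3 / Λ * (Λ / 3) = 1 by field_simp, Real.sqrt_one]
    rw [inv_neg, neg_mul_neg, ← mul_inv, h3, inv_one]
  rw [hval] at hfin
  refine hfin.congr' ?_
  filter_upwards [hev] with t ht
  have ha := (h.a_pos t ht).ne'
  have ht0 := ht.2.ne
  have hs : Real.sqrt (3 / Λ) ≠ 0 := (Real.sqrt_pos.2 (by positivity)).ne'
  simp only [deSitterScale]
  field_simp

end IsDustBackground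

/-! ### Ordinary differential equations in time -/

/-- A crude bound is enough, as only finiteness of the constants matters. -/
lemma abs_le_of_sq_le_add {u M : ℝ} (h : u ^ 2 ≤ M) : |u| ≤ M + 1 := by
  rw [abs_le]; constructor <;> nlinarith

/-- Solutions of `u'' + 2 H u' = S` with `H ≥ 0` and bounded `S` have bounded time derivative. -/
lemma bddNear_pd_of_damped {τ₀ : ℝ} {H : ℝ → ℝ} (hH : ∀ τ ∈ Ioo τ₀ 0, 0 ≤ H τ)
    {u S : Spacetime → ℝ} (hu : SlabSmooth τ₀ u) (hS : BddNear τ₀ S)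
    (heq : ∀ p ∈ slab τ₀, pd 0 (pd 0 u) p + 2 * H p.1 * pd 0 u p = S p) :
    BddNear τ₀ (pd 0 u) := fun τ₁ h₁ r => by
  obtain ⟨C, hC⟩ := hS τ₁ h₁ r
  obtain ⟨D, hD0, hD⟩ := (hu.pd 0).exists_bound h₁ r
  refine ⟨(D ^ 2 + C ^ 2) * Real.exp (-(1 * τ₁)) + 1, fun τ hτ x hx => abs_le_of_sq_le_add ?_⟩
  -- With `y = u'²` one has `y' = 2 u' S - 4 H u'² ≤ y + C²`: the friction term, however large, is
  -- discarded by its sign.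
  have hg := gronwall_Ico (τ₁ := τ₁) (c := 1) (B := C ^ 2) (y := fun t => pd 0 u (t, x) ^ 2)
    (y' := fun t => 2 * pd 0 u (t, x) * pd 0 (pd 0 u) (t, x)) le_rfl (sq_nonneg C)
    (fun t ht => by
      have := (hasDerivAt_time
        ((hu.pd 0).differentiableAt (mk_mem_slab (Ico_sub_Ioo h₁ ht) x))).fun_pow 2
      simpa using this)
    (fun t ht => by
      have ht' := Ico_sub_Ioo h₁ ht
      have e := heq _ (mk_mem_slab ht' x)
      have b : S (t, x) ^ 2 ≤ C ^ 2 := sq_le_sq' (abs_le.1 (hC t ht x hx)).1 (abs_le.1 (hC t ht x hx)).2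
      have hHt := hH t ht'
      have e2 : pd 0 (pd 0 u) (t, x) = S (t, x) - 2 * H t * pd 0 u (t, x) := by linarith
      simp only [e2]
      nlinarith [sq_nonneg (pd 0 u (t, x) - S (t, x)), mul_nonneg hHt (sq_nonneg (pd 0 u (t, x)))])
    hτ
  refine hg.trans ?_
  gcongr
  have := hD x hx
  rw [abs_of_nonneg (sq_nonneg _)]
  exact sq_le_sq' (abs_le.1 this).1 (abs_le.1 this).2

/-- Solutions of `u'' + H u' = c u` with `H ≥ 0` and bounded `c` have bounded time derivative. -/
lemma bddNear_pd_of_scalar {τ₀ : ℝ} {H c : ℝ → ℝ} (hH : ∀ τ ∈ Ioo τ₀ 0, 0 ≤ H τ)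
    (hc : ∀ τ₁ ∈ Ioo τ₀ 0, ∃ C, ∀ τ ∈ Ico τ₁ 0, |c τ| ≤ C)
    {u : Spacetime → ℝ} (hu : SlabSmooth τ₀ u)
    (heq : ∀ p ∈ slab τ₀, pd 0 (pd 0 u) p + H p.1 * pd 0 u p = c p.1 * u p) :
    BddNear τ₀ (pd 0 u) := fun τ₁ h₁ r => by
  obtain ⟨C, hC⟩ := hc τ₁ h₁
  have hC0 : 0 ≤ C := (abs_nonneg _).trans (hC τ₁ (left_mem_Ico.2 h₁.2))
  obtain ⟨D, hD0, hD⟩ := (hu.pd 0).exists_bound h₁ r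
  obtain ⟨E, hE0, hE⟩ := hu.exists_bound h₁ r
  refine ⟨(D ^ 2 + E ^ 2) * Real.exp (-((1 + C) * τ₁)) + 1,
    fun τ hτ x hx => abs_le_of_sq_le_add ?_⟩
  -- Here `y = u'² + u²` satisfies `y' = 2 (1 + c) u u' - 2 H u'² ≤ (1 + C) y`.
  have hg := gronwall_Ico (τ₁ := τ₁) (c := 1 + C) (B := 0)
    (y := fun t => pd 0 u (t, x) ^ 2 + u (t, x) ^ 2)
    (y' := fun t => 2 * pd 0 u (t, x) * pd 0 (pd 0 u) (t, x) + 2 * u (t, x) * pd 0 u (t, x))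
    (by linarith) le_rfl
    (fun t ht => by
      have hm := mk_mem_slab (Ico_sub_Ioo h₁ ht) x
      have := ((hasDerivAt_time ((hu.pd 0).differentiableAt hm)).fun_pow 2).fun_add
        ((hasDerivAt_time (hu.differentiableAt hm)).fun_pow 2)
      simpa using this)
    (fun t ht => by
      have ht' := Ico_sub_Ioo h₁ ht
      have e := heq _ (mk_mem_slab ht' x)
      have b := abs_le.1 (hC t ht)
      have hHt := hH t ht'
      have e2 : pd 0 (pd 0 u) (t, x) = c t * u (t, x) - H t * pd 0 u (t, x) := by linarith
      simp only [e2]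
      set v := pd 0 u (t, x)
      set w := u (t, x)
      have h1 : 2 * (1 + c t) * (v * w) ≤ (1 + C) * (v ^ 2 + w ^ 2) := by
        nlinarith [sq_nonneg (v - w), sq_nonneg (v + w),
          mul_nonneg (show 0 ≤ C - c t by linarith) (sq_nonneg (v + w)),
          mul_nonneg (show 0 ≤ C + c t by linarith) (sq_nonneg (v - w))]
      nlinarith [mul_nonneg hHt (sq_nonneg v)])
    hτ
  have h2 : pd 0 u (τ, x) ^ 2 ≤ pd 0 u (τ, x) ^ 2 + u (τ, x) ^ 2 := by
    nlinarith [sq_nonneg (u (τ, x))]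
  refine h2.trans (hg.trans ?_)
  rw [add_zero]
  gcongr
  have b1 := abs_le.1 (hD x hx)
  have b2 := abs_le.1 (hE x hx)
  rw [abs_of_nonneg (by positivity)]
  exact add_le_add (sq_le_sq' b1.1 b1.2) (sq_le_sq' b2.1 b2.2)

/-! ### The linearized system -/

/-- The trace `γ_{kk}`. -/
def trace₁ (γ : Spacetime → Matrix (Fin 3) (Fin 3) ℝ) : Spacetime → ℝ := fun q => ∑ k, γ q k k

/-- The momentum density `∂_k γ_{kj} - ∂_j γ_{kk}`. -/
def momentum (γ : Spacetime → Matrix (Fin 3) (Fin 3) ℝ) (j : Fin 3) : Spacetime → ℝ := fun q =>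
  (∑ k, sd k (comp γ k j) q) - sd j (trace₁ γ) q

/-- The linearized spatial curvature `∂_i ∂_j γ_{ij} - Δ γ_{kk}`. -/
def curvature₁ (γ : Spacetime → Matrix (Fin 3) (Fin 3) ℝ) : Spacetime → ℝ := fun q =>
  ∑ j, sd j (momentum γ j) q

/-- The source of the wave equation for `γ_{ij}`. -/
def waveSource (γ : Spacetime → Matrix (Fin 3) (Fin 3) ℝ) (i j : Fin 3) : Spacetime → ℝ :=
  fun q => ((if i = j then 1 / 2 else 0) * curvature₁ γ q + (-1) * sd i (momentum γ j) q) +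
    ((-1) * sd j (momentum γ i) q + (-1) * sd i (sd j (trace₁ γ)) q)

/-! ### Time-independent momentum density and reduction to a damped trace equation and wave
equations -/

section system
variable {Λ τ₀ : ℝ} {a ρ : ℝ → ℝ} {γ : Spacetime → Matrix (Fin 3) (Fin 3) ℝ} {ρ₁ : Spacetime → ℝ}

lemma slabSmooth_trace (hγ : ∀ i j, SlabSmooth τ₀ (comp γ i j)) : SlabSmooth τ₀ (trace₁ γ) :=
  ContDiffOn.sum fun k _ => hγ k k

lemma slabSmooth_momentum (hγ : ∀ i j, SlabSmooth τ₀ (comp γ i j)) (j : Fin 3) :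
    SlabSmooth τ₀ (momentum γ j) :=
  (ContDiffOn.sum fun k _ => (hγ k j).sd k).sub ((slabSmooth_trace hγ).sd j)

lemma slabSmooth_curvature (hγ : ∀ i j, SlabSmooth τ₀ (comp γ i j)) :
    SlabSmooth τ₀ (curvature₁ γ) :=
  ContDiffOn.sum fun k _ => (slabSmooth_momentum hγ k).sd k

lemma pd_trace (hγ : ∀ i j, SlabSmooth τ₀ (comp γ i j)) (μ : Fin 4) {p : Spacetime}
    (hp : p ∈ slab τ₀) : pd μ (trace₁ γ) p = ∑ k, pd μ (comp γ k k) p :=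
  pd_sum fun k _ => (hγ k k).differentiableAt hp

lemma pd_pd_trace (hγ : ∀ i j, SlabSmooth τ₀ (comp γ i j)) (μ ν : Fin 4) {p : Spacetime}
    (hp : p ∈ slab τ₀) : pd μ (pd ν (trace₁ γ)) p = ∑ k, pd μ (pd ν (comp γ k k)) p := by
  rw [pd_congr (fun q hq => pd_trace hγ ν hq) μ hp]
  exact pd_sum fun k _ => ((hγ k k).pd ν).differentiableAt hp

lemma pd_momentum (hγ : ∀ i j, SlabSmooth τ₀ (comp γ i j)) (μ : Fin 4) (j : Fin 3) {p : Spacetime}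
    (hp : p ∈ slab τ₀) : pd μ (momentum γ j) p =
      (∑ k, pd μ (sd k (comp γ k j)) p) - pd μ (sd j (trace₁ γ)) p := by
  have h1 : DifferentiableAt ℝ (fun q => ∑ k, sd k (comp γ k j) q) p :=
    SlabSmooth.differentiableAt (ContDiffOn.sum fun k _ => (hγ k j).sd k) hp
  unfold momentum
  rw [pd_sub h1 (((slabSmooth_trace hγ).sd j).differentiableAt hp),
    pd_sum fun k _ => ((hγ k j).sd k).differentiableAt hp]

/-- This is the mixed time-space component of the field equations: comoving dust carries no momentum
at first order, and symmetry of `γ` removes the antisymmetric terms. -/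
lemma pd_zero_momentum (h : IsDustBackground Λ τ₀ a ρ) (hγ : ∀ i j, SlabSmooth τ₀ (comp γ i j))
    (hsym : ∀ p ∈ slab τ₀, (γ p).IsSymm) (hE : SolvesLinearizedEinstein Λ τ₀ a ρ γ ρ₁)
    (j : Fin 3) {p : Spacetime} (hp : p ∈ slab τ₀) : pd 0 (momentum γ j) p = 0 := by
  have hs (i j : Fin 3) : EqOn (comp γ i j) (comp γ j i) (slab τ₀) := fun q hq =>
    (hsym q hq).apply j i
  have e := (ricci₁_eq h hγ hE hp).2.1 j
  rw [ricci₁_zero_succ hγ hp j] at e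
  have h1 : ∑ k, (sd k (comp γ j k) p - sd k (comp γ k j) p) = 0 :=
    Finset.sum_eq_zero fun k _ => by rw [sd_congr (hs j k) k hp, sub_self]
  rw [h1, Finset.sum_sub_distrib] at e
  rw [pd_momentum hγ 0 j hp, sd_eq_pd, pd_comm (slabSmooth_trace hγ) 0 j.succ hp,
    pd_pd_trace hγ _ _ hp]
  have h2 : ∑ k, pd 0 (sd k (comp γ k j)) p = ∑ k, sd k (pd 0 (comp γ k j)) p :=
    Finset.sum_congr rfl fun k _ => pd_comm (hγ k j) 0 k.succ hp
  rw [h2]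
  simp only [sd_eq_pd] at e ⊢
  linarith

lemma pd_zero_sd_momentum (h : IsDustBackground Λ τ₀ a ρ)
    (hγ : ∀ i j, SlabSmooth τ₀ (comp γ i j)) (hsym : ∀ p ∈ slab τ₀, (γ p).IsSymm)
    (hE : SolvesLinearizedEinstein Λ τ₀ a ρ γ ρ₁) (i j : Fin 3) {p : Spacetime}
    (hp : p ∈ slab τ₀) : pd 0 (sd i (momentum γ j)) p = 0 := by
  rw [sd_eq_pd, pd_comm (slabSmooth_momentum hγ j) 0 i.succ hp,
    pd_congr (g := fun _ => 0) (fun q hq => pd_zero_momentum h hγ hsym hE j hq) _ hp, pd_const]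

lemma pd_zero_curvature (h : IsDustBackground Λ τ₀ a ρ) (hγ : ∀ i j, SlabSmooth τ₀ (comp γ i j))
    (hsym : ∀ p ∈ slab τ₀, (γ p).IsSymm) (hE : SolvesLinearizedEinstein Λ τ₀ a ρ γ ρ₁)
    {p : Spacetime} (hp : p ∈ slab τ₀) : pd 0 (curvature₁ γ) p = 0 := by
  unfold curvature₁
  rw [pd_sum fun k _ => ((slabSmooth_momentum hγ k).sd k).differentiableAt hp]
  exact Finset.sum_eq_zero fun k _ => pd_zero_sd_momentum h hγ hsym hE k k hp

/-- The linearized Einstein equations as a constraint, an evolution equation for the trace and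
a wave equation. -/
lemma linearized_system (h : IsDustBackground Λ τ₀ a ρ) (hγ : ∀ i j, SlabSmooth τ₀ (comp γ i j))
    (hsym : ∀ p ∈ slab τ₀, (γ p).IsSymm) (hE : SolvesLinearizedEinstein Λ τ₀ a ρ γ ρ₁)
    {p : Spacetime} (hp : p ∈ slab τ₀) :
    a p.1 ^ 2 * ρ₁ p = hubble a p.1 * pd 0 (trace₁ γ) p + 1 / 2 * curvature₁ γ p ∧
    pd 0 (pd 0 (trace₁ γ)) p + 2 * hubble a p.1 * pd 0 (trace₁ γ) p = -(1 / 2) * curvature₁ γ p ∧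
    ∀ i j, pd 0 (pd 0 (comp γ i j)) p + 2 * hubble a p.1 * pd 0 (comp γ i j) p
      - lap (comp γ i j) p = waveSource γ i j p := by
  have hs (i j : Fin 3) : EqOn (comp γ i j) (comp γ j i) (slab τ₀) := fun q hq =>
    (hsym q hq).apply j i
  obtain ⟨e0, -, e2⟩ := ricci₁_eq h hγ hE hp
  rw [ricci₁_zero_zero hγ hp, Finset.sum_add_distrib, ← Finset.mul_sum, ← pd_trace hγ 0 hp,
    ← pd_pd_trace hγ 0 0 hp] at e0
  -- The spatial equations, with second spatial derivatives other than the Laplacian collected into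
  -- derivatives of the momentum density and of the trace.
  have e3 (i j : Fin 3) : pd 0 (pd 0 (comp γ i j)) p + 2 * hubble a p.1 * pd 0 (comp γ i j) p
      - lap (comp γ i j) p = (if i = j then a p.1 ^ 2 * ρ₁ p - hubble a p.1 * pd 0 (trace₁ γ) p
        else 0) - sd i (momentum γ j) p - sd j (momentum γ i) p - sd i (sd j (trace₁ γ)) p := by
    have e := e2 i j
    rw [ricci₁_succ_succ h.smooth h.a_pos hγ hp i j, ← pd_trace hγ 0 hp,
      pd_congr (hs j i) 0 hp, show γ p j i = γ p i j from hs j i hp] at e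
    have t1 : ∑ k, (sd k (sd i (comp γ k j)) p + sd k (sd j (comp γ k i)) p
        - sd k (sd k (comp γ i j)) p - sd j (sd i (comp γ k k)) p
        - sd j (sd k (comp γ k i)) p + sd j (sd k (comp γ i k)) p) =
        (sd i (momentum γ j) p + sd i (sd j (trace₁ γ)) p) +
        (sd j (momentum γ i) p + sd j (sd i (trace₁ γ)) p)
        - lap (comp γ i j) p - sd j (sd i (trace₁ γ)) p := by
      have m1 := pd_momentum hγ i.succ j hp
      have m2 := pd_momentum hγ j.succ i hp
      have m3 := pd_pd_trace hγ j.succ i.succ hp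
      simp only [sd_eq_pd, lap] at m1 m2 m3 ⊢
      rw [m1, m2, m3]
      have c1 : ∑ k : Fin 3, pd i.succ (pd k.succ (comp γ k j)) p =
          ∑ k : Fin 3, pd k.succ (pd i.succ (comp γ k j)) p :=
        Finset.sum_congr rfl fun k _ => pd_comm (hγ k j) _ _ hp
      have c2 : ∑ k : Fin 3, pd j.succ (pd k.succ (comp γ k i)) p =
          ∑ k : Fin 3, pd k.succ (pd j.succ (comp γ k i)) p :=
        Finset.sum_congr rfl fun k _ => pd_comm (hγ k i) _ _ hp
      have c3 : ∑ k : Fin 3, pd j.succ (pd k.succ (comp γ i k)) p =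
          ∑ k : Fin 3, pd j.succ (pd k.succ (comp γ k i)) p :=
        Finset.sum_congr rfl fun k _ => pd_congr (pd_congr (hs i k) _) _ hp
      simp only [Finset.sum_add_distrib, Finset.sum_sub_distrib, c1, c2, c3]
      ring
    rw [t1] at e
    have t2 : sd j (sd i (trace₁ γ)) p = sd i (sd j (trace₁ γ)) p :=
      pd_comm (slabSmooth_trace hγ) _ _ hp
    rw [t2] at e
    split_ifs at e ⊢ <;> linarith
  have hlap : lap (trace₁ γ) p = ∑ k, lap (comp γ k k) p := by
    simp only [lap, sd_eq_pd]
    rw [Finset.sum_comm]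
    exact Finset.sum_congr rfl fun k _ => pd_pd_trace hγ _ _ hp
  -- In the trace of the wave equations the Laplacian of the trace cancels. Combined with the `00`
  -- equation `T'' + H T' = -a² ρ₁`, this gives the constraint.
  have htr : pd 0 (pd 0 (trace₁ γ)) p + 2 * hubble a p.1 * pd 0 (trace₁ γ) p =
      3 * (a p.1 ^ 2 * ρ₁ p - hubble a p.1 * pd 0 (trace₁ γ) p) - 2 * curvature₁ γ p := by
    have : ∑ i, (pd 0 (pd 0 (comp γ i i)) p + 2 * hubble a p.1 * pd 0 (comp γ i i) p
      - lap (comp γ i i) p) = ∑ i, ((if i = i then a p.1 ^ 2 * ρ₁ p -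
        hubble a p.1 * pd 0 (trace₁ γ) p else 0) - sd i (momentum γ i) p - sd i (momentum γ i) p
        - sd i (sd i (trace₁ γ)) p) := Finset.sum_congr rfl fun i _ => e3 i i
    simp only [Finset.sum_sub_distrib, Finset.sum_add_distrib, ← Finset.mul_sum, if_true,
      ← pd_trace hγ 0 hp, ← pd_pd_trace hγ 0 0 hp, ← hlap] at this
    have hl : ∑ i, sd i (sd i (trace₁ γ)) p = lap (trace₁ γ) p := rfl
    have hc : ∑ i, sd i (momentum γ i) p = curvature₁ γ p := rfl
    rw [hl, hc] at this
    simp at this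
    linarith
  have r1 : a p.1 ^ 2 * ρ₁ p = hubble a p.1 * pd 0 (trace₁ γ) p + 1 / 2 * curvature₁ γ p := by
    linarith
  refine ⟨r1, by linarith, fun i j => ?_⟩
  rw [e3 i j, r1, waveSource]
  split_ifs <;> ring

/-- The momentum and curvature terms do not depend on time. The trace solves a damped equation in
time alone, so each of its spatial derivatives solves the same kind of equation and is bounded
without loss of derivatives. -/
lemma allBddNear_waveSource (h : IsDustBackground Λ τ₀ a ρ) (hΛ : 0 < Λ)
    (hγ : ∀ i j, SlabSmooth τ₀ (comp γ i j))
    (hsym : ∀ p ∈ slab τ₀, (γ p).IsSymm) (hE : SolvesLinearizedEinstein Λ τ₀ a ρ γ ρ₁)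
    (i j : Fin 3) : SlabSmooth τ₀ (waveSource γ i j) ∧ AllBddNear τ₀ (waveSource γ i j) := by
  have hW := slabSmooth_curvature hγ
  have hV := fun i j => (slabSmooth_momentum hγ j).sd i
  have hT := slabSmooth_trace hγ
  have bW : AllBddNear τ₀ (curvature₁ γ) :=
    allBddNear_of_time_indep hW fun p hp => pd_zero_curvature h hγ hsym hE hp
  have bV := fun i j => allBddNear_of_time_indep (hV i j)
    fun p hp => pd_zero_sd_momentum h hγ hsym hE i j hp
  have bT : AllBddNear τ₀ (trace₁ γ) := fun L => by
    refine BddNear.of_pd (hT.sdList L) (bddNear_pd_of_damped (H := hubble a)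
      (S := sdList L fun p => -(1 / 2) * curvature₁ γ p)
      (fun τ hτ => (h.hubble_pos hΛ hτ).le) (hT.sdList L)
      (AllBddNear.const_mul hW bW _ L) fun p hp => ?_)
    have hdamp : EqOn (fun p => pd 0 (pd 0 (trace₁ γ)) p + 2 * hubble a p.1 * pd 0 (trace₁ γ) p)
        (fun p => -(1 / 2) * curvature₁ γ p) (slab τ₀) := fun q hq =>
      (linearized_system h hγ hsym hE hq).2.1
    rw [← sdList_congr hdamp L hp]
    -- The coefficient depends only on time, so spatial derivatives pass through it.
    have hmul : EqOn (sdList L fun p => 2 * hubble a p.1 * pd 0 (trace₁ γ) p)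
        (fun p => 2 * hubble a p.1 * sdList L (pd 0 (trace₁ γ)) p) (slab τ₀) := by
      induction L with
      | nil => exact fun _ _ => rfl
      | cons k L ih =>
        intro q hq
        exact (sd_congr ih k hq).trans (sd_time_mul (c := fun t => 2 * hubble a t)
          ((diffAt_hubble h.smooth h.a_pos hq.1).const_mul 2)
          (((hT.pd 0).sdList L).differentiableAt hq) k)
    have hH : SlabSmooth τ₀ (fun p => 2 * hubble a p.1) :=
      contDiffOn_const.mul (slabSmooth_of_time (contDiffOn_hubble h.smooth h.a_pos))
    rw [sdList_add ((hT.pd 0).pd 0) (hH.mul (hT.pd 0)) L hp]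
    beta_reduce
    rw [show sdList L (fun x => 2 * hubble a x.1 * pd 0 (trace₁ γ) x) p = _ from hmul hp]
    rw [pd_zero_sdList hT L hp, pd_congr (pd_zero_sdList hT L) 0 hp, pd_zero_sdList (hT.pd 0) L hp]
  have s1 : SlabSmooth τ₀ fun q => (if i = j then 1 / 2 else 0) * curvature₁ γ q :=
    contDiffOn_const.mul hW
  have s2 (i j) : SlabSmooth τ₀ fun q => (-1) * sd i (momentum γ j) q :=
    contDiffOn_const.mul (hV i j)
  have s3 : SlabSmooth τ₀ fun q => (-1) * sd i (sd j (trace₁ γ)) q :=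
    contDiffOn_const.mul ((hT.sd j).sd i)
  exact ⟨(s1.add (s2 i j)).add ((s2 j i).add s3), AllBddNear.add (s1.add (s2 i j))
    ((s2 j i).add s3) (AllBddNear.add s1 (s2 i j) (bW.const_mul hW _) ((bV i j).const_mul (hV i j) _))
    (AllBddNear.add (s2 j i) s3 ((bV j i).const_mul (hV j i) _)
      (((bT.sd j).sd i).const_mul ((hT.sd j).sd i) _))⟩

end system

end

end DustPert

namespace DustPert

noncomputable section

/-! ### Energy estimate for the wave equation -/

lemma integrable_slice {τ₀ τ R : ℝ} {G : Spacetime → ℝ} (hG : SlabSmooth τ₀ G)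
    (hτ : τ ∈ Ioo τ₀ 0) (hsupp : ∀ x : Space, R < ‖x‖ → G (τ, x) = 0) :
    Integrable (fun x : Space => G (τ, x)) := by
  refine (hG.slice hτ).continuous.integrable_of_hasCompactSupport ?_
  refine HasCompactSupport.intro (isCompact_closedBall (0 : Space) R) fun x hx => hsupp x ?_
  simpa using hx

lemma integral_sd_eq_zero {τ₀ τ R : ℝ} {G : Spacetime → ℝ} (hG : SlabSmooth τ₀ G)
    (hτ : τ ∈ Ioo τ₀ 0) (hsupp : ∀ x : Space, R < ‖x‖ → G (τ, x) = 0) (i : Fin 3) :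
    (∫ x : Space, sd i G (τ, x)) = 0 ∧ Integrable (fun x : Space => sd i G (τ, x)) := by
  have hsl := hG.slice hτ
  have hfd (x : Space) : sd i G (τ, x) =
      fderiv ℝ (fun y : Space => G (τ, y)) x (EuclideanSpace.single i (1 : ℝ)) := by
    have := (hG.differentiableAt (mk_mem_slab hτ x)).hasFDerivAt.comp x
      (hasFDerivAt_prodMk_right τ x)
    rw [show (fun y : Space => G (τ, y)) = G ∘ fun y => (τ, y) from rfl, this.fderiv]
    simp [sd, pd, basisVec_succ]
  have hcs : HasCompactSupport (fun y : Space => G (τ, y)) :=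
    HasCompactSupport.intro (isCompact_closedBall (0 : Space) R) fun x hx => hsupp x (by simpa using hx)
  have hint : Integrable (fun x : Space =>
      fderiv ℝ (fun y : Space => G (τ, y)) x (EuclideanSpace.single i (1 : ℝ))) := by
    refine Continuous.integrable_of_hasCompactSupport ?_ (hcs.fderiv_apply (𝕜 := ℝ) _)
    exact (hsl.continuous_fderiv (by simp)).clm_apply continuous_const
  simp only [hfd]
  refine ⟨?_, hint⟩
  -- Integration by parts against the constant function `1`.
  have := integral_mul_fderiv_eq_neg_fderiv_mul_of_integrable (μ := (volume : Measure Space))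
    (f := fun _ => (1 : ℝ)) (g := fun y : Space => G (τ, y)) (v := EuclideanSpace.single i (1 : ℝ))
    (by simp) (by simpa using hint) (by simpa using integrable_slice hG hτ hsupp)
    (fun _ _ => differentiableAt_const _) (fun x _ => hsl.differentiable (by simp) x)
  simpa using this

lemma hasDerivAt_integral_slice {τ₀ τ₁ τ R : ℝ} {G : Spacetime → ℝ} (hG : SlabSmooth τ₀ G)
    (h₁ : τ₀ ≤ τ₁) (hτ : τ ∈ Ioo τ₁ 0)
    (hsupp : ∀ t ∈ Ioo τ₁ 0, ∀ x : Space, R < ‖x‖ → G (t, x) = 0) :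
    HasDerivAt (fun t => ∫ x : Space, G (t, x)) (∫ x : Space, pd 0 G (τ, x)) τ ∧
      Integrable (fun x : Space => pd 0 G (τ, x)) := by
  obtain ⟨α, hα⟩ := exists_between hτ.1
  obtain ⟨β, hβ⟩ := exists_between hτ.2
  have hsub : Ioo τ₁ 0 ⊆ Ioo τ₀ 0 := Ioo_subset_Ioo_left h₁
  have hI : Icc α β ⊆ Ioo τ₁ 0 := fun t ht => ⟨hα.1.trans_le ht.1, ht.2.trans_lt hβ.2⟩
  obtain ⟨C, hC⟩ := ((isCompact_Icc (a := α) (b := β)).prod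
    (isCompact_closedBall (0 : Space) R)).exists_bound_of_continuousOn
    (f := pd 0 G) (ContinuousOn.mono (hG.pd 0).continuousOn
      fun q hq => ⟨hsub (hI hq.1), mem_univ _⟩)
  -- The support condition holds on an open time interval, hence passes to the time derivative. A
  -- constant on the ball then dominates it.
  have hzero : ∀ t ∈ Ioo τ₁ 0, ∀ x : Space, R < ‖x‖ → pd 0 G (t, x) = 0 := fun t ht x hx => by
    rw [← deriv_time hG (hsub ht) x]
    have : (fun s => G (s, x)) =ᶠ[𝓝 t] fun _ => 0 := by
      filter_upwards [isOpen_Ioo.mem_nhds ht] with s hs using hsupp s hs x hx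
    rw [this.deriv_eq]; simp
  have hs : Icc α β ∈ 𝓝 τ := Icc_mem_nhds hα.2 hβ.1
  have := hasDerivAt_integral_of_dominated_loc_of_deriv_le (𝕜 := ℝ)
    (μ := (volume : Measure Space)) (F := fun t x => G (t, x))
    (F' := fun t x => pd 0 G (t, x)) (bound := (Metric.closedBall (0 : Space) R).indicator fun _ => C)
    hs (by
      filter_upwards [hs] with t ht
      exact (hG.slice (hsub (hI ht))).continuous.aestronglyMeasurable)
    (integrable_slice hG (hsub hτ) (hsupp τ hτ))
    ((hG.pd 0).slice (hsub hτ)).continuous.aestronglyMeasurable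
    (Eventually.of_forall fun x t ht => by
      by_cases hx : x ∈ Metric.closedBall (0 : Space) R
      · rw [indicator_of_mem hx]; exact hC (t, x) ⟨ht, hx⟩
      · rw [indicator_of_notMem hx, hzero t (hI ht) x (by simpa using hx), norm_zero])
    ((integrable_indicator_iff measurableSet_closedBall).2
      (integrableOn_const (measure_closedBall_lt_top).ne))
    (Eventually.of_forall fun x t ht =>
      hasDerivAt_time (hG.differentiableAt (mk_mem_slab (hsub (hI ht)) x)))
  exact ⟨this.2, this.1⟩

/-- `f` is a smooth solution of the wave equation `f'' + 2 H f' - Δ f = F`. -/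
structure IsWaveSolution (τ₀ : ℝ) (H : ℝ → ℝ) (f F : Spacetime → ℝ) : Prop where
  smooth : SlabSmooth τ₀ f
  smooth_source : SlabSmooth τ₀ F
  eq : ∀ p ∈ slab τ₀, pd 0 (pd 0 f) p + 2 * H p.1 * pd 0 f p - lap f p = F p

/-- The coefficients of the operator depend only on time, so it commutes with spatial derivatives.
This feeds all derivatives of a solution into one energy estimate. -/
lemma IsWaveSolution.sd {τ₀ : ℝ} {H : ℝ → ℝ} {f F : Spacetime → ℝ} (h : IsWaveSolution τ₀ H f F)
    (hH : ContDiffOn ℝ ∞ H (Ioo τ₀ 0)) (i : Fin 3) : IsWaveSolution τ₀ H (sd i f) (sd i F) := by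
  refine ⟨h.smooth.sd i, h.smooth_source.sd i, fun p hp => ?_⟩
  have hd : DifferentiableAt ℝ (fun t => 2 * H t) p.1 :=
    ((hH.contDiffAt (isOpen_Ioo.mem_nhds hp.1)).differentiableAt (by simp)).const_mul 2
  have hd' : DifferentiableAt ℝ (fun q : Spacetime => 2 * H q.1) p :=
    DifferentiableAt.comp (g := fun t => 2 * H t) p hd differentiableAt_fst
  have h1 := ((h.smooth.pd 0).pd 0).differentiableAt hp
  have h2 := (h.smooth.pd 0).differentiableAt hp
  have h3 := h.smooth.lap.differentiableAt hp
  rw [← sd_congr (fun q hq => h.eq q hq) i hp,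
    show DustPert.sd i (fun q => pd 0 (pd 0 f) q + 2 * H q.1 * pd 0 f q - DustPert.lap f q) p =
      pd i.succ (fun q => pd 0 (pd 0 f) q + 2 * H q.1 * pd 0 f q - DustPert.lap f q) p from rfl,
    pd_sub (h1.fun_add (hd'.fun_mul h2)) h3, pd_add h1 (hd'.fun_mul h2), ← sd_eq_pd,
    show pd i.succ (fun q => 2 * H q.1 * pd 0 f q) p = _ from sd_time_mul hd h2 i]
  have c1 : pd 0 (DustPert.sd i f) p = DustPert.sd i (pd 0 f) p := pd_comm h.smooth 0 i.succ hp
  have c2 : pd 0 (pd 0 (DustPert.sd i f)) p = DustPert.sd i (pd 0 (pd 0 f)) p := by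
    have : EqOn (pd 0 (DustPert.sd i f)) (DustPert.sd i (pd 0 f)) (slab τ₀) :=
      fun q hq => pd_comm h.smooth 0 i.succ hq
    exact (pd_congr this 0 hp).trans (pd_comm (h.smooth.pd 0) 0 i.succ hp)
  have c3 : DustPert.lap (DustPert.sd i f) p = DustPert.sd i (DustPert.lap f) p := by
    have : DustPert.sd i (DustPert.lap f) p =
        ∑ k, DustPert.sd i (DustPert.sd k (DustPert.sd k f)) p :=
      pd_sum fun k _ => ((h.smooth.sd k).sd k).differentiableAt hp
    rw [this]
    refine Finset.sum_congr rfl fun k _ => ?_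
    have : EqOn (DustPert.sd k (DustPert.sd i f)) (DustPert.sd i (DustPert.sd k f)) (slab τ₀) :=
      fun q hq => pd_comm h.smooth k.succ i.succ hq
    exact (sd_congr this k hp).trans (pd_comm (h.smooth.sd k) k.succ i.succ hp)
  rw [c1, c2, c3]
  rfl

lemma IsWaveSolution.sdList {τ₀ : ℝ} {H : ℝ → ℝ} {f F : Spacetime → ℝ}
    (h : IsWaveSolution τ₀ H f F) (hH : ContDiffOn ℝ ∞ H (Ioo τ₀ 0)) (L : List (Fin 3)) :
    IsWaveSolution τ₀ H (sdList L f) (sdList L F) := by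
  induction L with
  | nil => exact h
  | cons i L ih => exact ih.sd hH i

/-! #### The cutoff -/

lemma deriv_smoothTransition_nonneg (s : ℝ) : 0 ≤ deriv Real.smoothTransition s :=
  Real.smoothTransition.monotone.deriv_nonneg

/-- Where the transition function vanishes it attains its global minimum. -/
lemma deriv_smoothTransition_of_nonpos {s : ℝ} (hs : s ≤ 0) :
    deriv Real.smoothTransition s = 0 := by
  refine IsLocalMin.deriv_eq_zero (Eventually.of_forall fun t => ?_)
  rw [Real.smoothTransition.zero_of_nonpos hs]
  exact Real.smoothTransition.nonneg t

/-- The argument `R² - 2R(τ - τ₁) - |x|²` of the cutoff. -/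
def coneFun (R τ₁ : ℝ) (p : Spacetime) : ℝ := R ^ 2 - 2 * R * (p.1 - τ₁) - ∑ i, p.2 i ^ 2

/-- A cutoff supported in a backward truncated cone. -/
def cutoff (R τ₁ : ℝ) (p : Spacetime) : ℝ := Real.smoothTransition (coneFun R τ₁ p)

lemma coneFun_eq (R τ₁ : ℝ) (p : Spacetime) :
    coneFun R τ₁ p = R ^ 2 - 2 * R * (p.1 - τ₁) - ‖p.2‖ ^ 2 := by
  rw [coneFun, EuclideanSpace.norm_sq_eq]; simp

lemma contDiff_coneFun (R τ₁ : ℝ) : ContDiff ℝ ∞ (coneFun R τ₁) := by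
  unfold coneFun
  fun_prop

lemma contDiff_cutoff (R τ₁ : ℝ) : ContDiff ℝ ∞ (cutoff R τ₁) :=
  (Real.smoothTransition.contDiff (n := ⊤)).comp (contDiff_coneFun R τ₁)

lemma pd_cutoff (R τ₁ : ℝ) (μ : Fin 4) (p : Spacetime) : pd μ (cutoff R τ₁) p =
    deriv Real.smoothTransition (coneFun R τ₁ p) * pd μ (coneFun R τ₁) p := by
  have h1 : DifferentiableAt ℝ Real.smoothTransition (coneFun R τ₁ p) :=
    (Real.smoothTransition.contDiffAt (n := 1)).differentiableAt (by simp)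
  have h2 : DifferentiableAt ℝ (coneFun R τ₁) p :=
    (contDiff_coneFun R τ₁).contDiffAt.differentiableAt (by simp)
  have := h1.hasDerivAt.comp_hasFDerivAt p h2.hasFDerivAt
  change fderiv ℝ (Real.smoothTransition ∘ coneFun R τ₁) p (basisVec μ) = _
  rw [this.fderiv]; rfl

lemma pd_zero_coneFun (R τ₁ : ℝ) (p : Spacetime) : pd 0 (coneFun R τ₁) p = -(2 * R) := by
  have h2 : DifferentiableAt ℝ (coneFun R τ₁) (p.1, p.2) :=
    (contDiff_coneFun R τ₁).contDiffAt.differentiableAt (by simp)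
  refine (hasDerivAt_time h2).unique ?_
  have := (((hasDerivAt_id p.1).sub_const τ₁).const_mul (2 * R)).const_sub (R ^ 2) |>.sub_const
    (∑ i, p.2 i ^ 2)
  simpa [coneFun] using this

lemma sd_coneFun (R τ₁ : ℝ) (k : Fin 3) (p : Spacetime) :
    sd k (coneFun R τ₁) p = -(2 * p.2 k) := by
  have h2 : DifferentiableAt ℝ (coneFun R τ₁)
      (p.1, p.2 + (0 : ℝ) • EuclideanSpace.single k (1 : ℝ)) :=
    (contDiff_coneFun R τ₁).contDiffAt.differentiableAt (by simp)
  have h3 := hasDerivAt_line h2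
  simp only [zero_smul, add_zero] at h3
  refine h3.unique ?_
  have hs (i : Fin 3) : HasDerivAt (fun t : ℝ => (p.2 i + t * if i = k then 1 else 0) ^ 2)
      (2 * p.2 i * if i = k then 1 else 0) 0 := by
    have := (((hasDerivAt_id (0 : ℝ)).mul_const (if i = k then (1 : ℝ) else 0)).const_add
      (p.2 i)).fun_pow 2
    simpa using this
  have := (HasDerivAt.fun_sum (u := Finset.univ) fun i _ => hs i).const_sub
    (R ^ 2 - 2 * R * (p.1 - τ₁))
  simpa [coneFun, Pi.single_apply] using this

lemma sd_cutoff (R τ₁ : ℝ) (k : Fin 3) (p : Spacetime) : sd k (cutoff R τ₁) p =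
    deriv Real.smoothTransition (coneFun R τ₁ p) * -(2 * p.2 k) := by
  rw [← sd_coneFun R τ₁]; exact pd_cutoff R τ₁ k.succ p

lemma cutoff_eq_zero {R τ₁ τ : ℝ} (hR : 0 ≤ R) (hτ : τ₁ ≤ τ) {x : Space} (hx : R < ‖x‖) :
    cutoff R τ₁ (τ, x) = 0 := by
  refine Real.smoothTransition.zero_of_nonpos ?_
  rw [coneFun_eq]
  nlinarith [mul_nonneg hR (sub_nonneg.2 hτ)]

/-- The flux through the boundary of the cone has a sign. -/
lemma cutoff_flux_nonpos {R τ₁ τ : ℝ} (hR : 0 < R) (hτ : τ₁ ≤ τ) (x : Space) (v : ℝ)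
    (s : Fin 3 → ℝ) : 1 / 2 * pd 0 (cutoff R τ₁) (τ, x) * (v ^ 2 + ∑ i, s i ^ 2)
      - ∑ i, sd i (cutoff R τ₁) (τ, x) * (v * s i) ≤ 0 := by
  simp only [pd_cutoff, pd_zero_coneFun, sd_cutoff]
  rcases le_or_gt (coneFun R τ₁ (τ, x)) 0 with h | h
  · simp [deriv_smoothTransition_of_nonpos h]
  · set d := deriv Real.smoothTransition (coneFun R τ₁ (τ, x))
    have hd : 0 ≤ d := deriv_smoothTransition_nonneg _
    have hx : ∑ i, x i ^ 2 ≤ R ^ 2 := by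
      rw [coneFun] at h
      have := mul_nonneg hR.le (sub_nonneg.2 hτ)
      simp only at h
      linarith
    have hq : 0 ≤ ∑ i, (R * s i - x i * v) ^ 2 := Finset.sum_nonneg fun i _ => sq_nonneg _
    simp only [Fin.sum_univ_three] at hx hq ⊢
    -- On the support `|x| ≤ R`, and expanding `∑ (R s_i - x_i v)² ≥ 0` gives this bound after
    -- division by `R`. The time slope `2R` of the cone function thus beats its spatial gradient
    -- `2|x|`.
    have hkey : 0 ≤ R * (v ^ 2 + (s 0 ^ 2 + s 1 ^ 2 + s 2 ^ 2))
        - 2 * v * (x 0 * s 0 + x 1 * s 1 + x 2 * s 2) := by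
      have h5 : 0 ≤ (R ^ 2 - (x 0 ^ 2 + x 1 ^ 2 + x 2 ^ 2)) * v ^ 2 :=
        mul_nonneg (by linarith) (sq_nonneg v)
      by_contra hcon
      push Not at hcon
      nlinarith
    nlinarith [mul_nonneg hd hkey]

/-- The energy density, weighted with the cutoff. -/
def energyDensity (R τ₁ : ℝ) (f : Spacetime → ℝ) (p : Spacetime) : ℝ :=
  cutoff R τ₁ p * (1 / 2 * (pd 0 f p * pd 0 f p + ∑ i, sd i f p * sd i f p))

/-- The weighted energy flux. -/
def energyFlux (R τ₁ : ℝ) (f : Spacetime → ℝ) (i : Fin 3) (p : Spacetime) : ℝ :=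
  cutoff R τ₁ p * (pd 0 f p * sd i f p)

lemma slabSmooth_cutoff (τ₀ R τ₁ : ℝ) : SlabSmooth τ₀ (cutoff R τ₁) :=
  (contDiff_cutoff R τ₁).contDiffOn

lemma slabSmooth_energyDensity {τ₀ R τ₁ : ℝ} {f : Spacetime → ℝ} (hf : SlabSmooth τ₀ f) :
    SlabSmooth τ₀ (energyDensity R τ₁ f) :=
  (slabSmooth_cutoff τ₀ R τ₁).mul (contDiffOn_const.mul (((hf.pd 0).mul (hf.pd 0)).add
    (ContDiffOn.sum fun i _ => (hf.sd i).mul (hf.sd i))))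

lemma slabSmooth_energyFlux {τ₀ R τ₁ : ℝ} {f : Spacetime → ℝ} (hf : SlabSmooth τ₀ f) (i : Fin 3) :
    SlabSmooth τ₀ (energyFlux R τ₁ f i) :=
  (slabSmooth_cutoff τ₀ R τ₁).mul ((hf.pd 0).mul (hf.sd i))

/-- The local energy inequality. -/
lemma energy_inequality {τ₀ τ₁ R : ℝ} {H : ℝ → ℝ} {f F : Spacetime → ℝ}
    (h : IsWaveSolution τ₀ H f F) (hH : ∀ τ ∈ Ioo τ₀ 0, 0 ≤ H τ) (hR : 0 < R)
    {p : Spacetime} (hp : p ∈ slab τ₀) (hp1 : τ₁ ≤ p.1) :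
    pd 0 (energyDensity R τ₁ f) p - ∑ i, sd i (energyFlux R τ₁ f i) p ≤
      energyDensity R τ₁ f p + 1 / 2 * (cutoff R τ₁ p * F p ^ 2) := by
  have hw := (slabSmooth_cutoff τ₀ R τ₁).differentiableAt hp
  have hv := (h.smooth.pd 0).differentiableAt hp
  have hs := fun i => (h.smooth.sd i).differentiableAt hp
  have hsum : DifferentiableAt ℝ (fun q => ∑ i, sd i f q * sd i f q) p :=
    DifferentiableAt.fun_sum fun i _ => (hs i).fun_mul (hs i)
  have hq := (hv.fun_mul hv).fun_add hsum
  have e1 : pd 0 (energyDensity R τ₁ f) p = pd 0 (cutoff R τ₁) p *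
      (1 / 2 * (pd 0 f p * pd 0 f p + ∑ i, sd i f p * sd i f p)) + cutoff R τ₁ p *
      (pd 0 f p * pd 0 (pd 0 f) p + ∑ i, sd i f p * sd i (pd 0 f) p) := by
    have hc : ∀ i, pd 0 (sd i f) p = sd i (pd 0 f) p := fun i => pd_comm h.smooth 0 i.succ hp
    unfold energyDensity
    rw [pd_mul hw (hq.const_mul _), pd_const_mul hq, pd_add (hv.fun_mul hv) hsum, pd_mul hv hv,
      pd_sum fun i _ => (hs i).fun_mul (hs i)]
    simp only [pd_mul (hs _) (hs _), hc, Fin.sum_univ_three]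
    ring
  have e2 (i : Fin 3) : sd i (energyFlux R τ₁ f i) p = sd i (cutoff R τ₁) p *
      (pd 0 f p * sd i f p) + cutoff R τ₁ p *
      (sd i (pd 0 f) p * sd i f p + pd 0 f p * sd i (sd i f) p) := by
    unfold energyFlux
    rw [sd_eq_pd i (fun q => _), pd_mul hw (hv.fun_mul (hs i)), pd_mul hv (hs i)]
    rfl
  have hflux := cutoff_flux_nonpos hR hp1 p.2 (pd 0 f p) (fun i => sd i f p)
  have heq := h.eq p hp
  have hHp := hH p.1 hp.1
  have hw0 : 0 ≤ cutoff R τ₁ p := Real.smoothTransition.nonneg _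
  rw [e1]
  simp only [e2, energyDensity, lap, Fin.sum_univ_three] at hflux heq ⊢
  set v := pd 0 f p
  set w := cutoff R τ₁ p
  -- The mixed derivatives cancel between the density and the flux, leaving `w v (f'' - Δf) = w v (F
  -- - 2 H v) ≤ ½ w (v² + F²)`.
  have e4 : pd 0 (pd 0 f) p = F p - 2 * H p.1 * v +
      (sd 0 (sd 0 f) p + sd 1 (sd 1 f) p + sd 2 (sd 2 f) p) := by linarith
  rw [e4]
  have h1 : 0 ≤ w * (H p.1 * v ^ 2) := by positivity
  have h2 : 0 ≤ w * (v - F p) ^ 2 := by positivity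
  have h3 : 0 ≤ w * (sd 0 f p ^ 2 + sd 1 f p ^ 2 + sd 2 f p ^ 2) := by positivity
  nlinarith

/-- Local energy bound for the wave equation. -/
lemma exists_energy_bound {τ₀ : ℝ} {H : ℝ → ℝ} {f F : Spacetime → ℝ}
    (h : IsWaveSolution τ₀ H f F) (hH : ∀ τ ∈ Ioo τ₀ 0, 0 ≤ H τ) (hF : BddNear τ₀ F)
    {τ₁ : ℝ} (h₁ : τ₁ ∈ Ioo τ₀ 0) {r : ℝ} (hr : 0 ≤ r) :
    ∃ M : ℝ, ∀ τ ∈ Ico τ₁ 0,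
      ∫ x in Metric.closedBall (0 : Space) r, pd 0 f (τ, x) ^ 2 ≤ M := by
  -- Starting the cone slightly before `τ₁` places `τ₁` inside the open interval on which the energy
  -- may be differentiated.
  obtain ⟨τ₂, h₂⟩ := exists_between h₁.1
  have hτ₂ : τ₂ ∈ Ioo τ₀ 0 := ⟨h₂.1, h₂.2.trans h₁.2⟩
  -- With this radius `R² - 2 R |τ₂| - r² ≥ 1`, so the cutoff equals one on the ball of radius `r`
  -- all the way to `τ = 0`.
  set R : ℝ := r + 2 * |τ₂| + 1 with hR
  have hR0 : 0 < R := by positivity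
  obtain ⟨C, hC⟩ := hF τ₁ h₁ R
  set B : ℝ := 1 / 2 * (C ^ 2 * (volume (Metric.closedBall (0 : Space) R)).toReal) with hB
  have hB0 : 0 ≤ B := by positivity
  have hsm := slabSmooth_energyDensity (R := R) (τ₁ := τ₂) h.smooth
  have hsf := fun i => slabSmooth_energyFlux (R := R) (τ₁ := τ₂) h.smooth i
  have hsupp : ∀ t ∈ Ioo τ₂ 0, ∀ x : Space, R < ‖x‖ → energyDensity R τ₂ f (t, x) = 0 :=
    fun t ht x hx => by rw [energyDensity, cutoff_eq_zero hR0.le ht.1.le hx, zero_mul]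
  have hsuppf : ∀ i, ∀ t ∈ Ioo τ₂ 0, ∀ x : Space, R < ‖x‖ → energyFlux R τ₂ f i (t, x) = 0 :=
    fun i t ht x hx => by rw [energyFlux, cutoff_eq_zero hR0.le ht.1.le hx, zero_mul]
  have hsub : ∀ t ∈ Ico τ₁ 0, t ∈ Ioo τ₂ 0 := fun t ht => ⟨h₂.2.trans_le ht.1, ht.2⟩
  have hder := fun t (ht : t ∈ Ico τ₁ 0) =>
    hasDerivAt_integral_slice hsm hτ₂.1.le (hsub t ht) hsupp
  have hgr (t : ℝ) (ht : t ∈ Ico τ₁ 0) := gronwall_Ico (c := 1) (B := B)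
    (y := fun t => ∫ x : Space, energyDensity R τ₂ f (t, x))
    (y' := fun t => ∫ x : Space, pd 0 (energyDensity R τ₂ f) (t, x)) le_rfl hB0
    (fun t ht => (hder t ht).1) (fun t ht => by
      have htI := Ico_sub_Ioo h₁ ht
      have hdiv := fun i => integral_sd_eq_zero (hsf i) htI (hsuppf i t (hsub t ht)) i
      have hsq : SlabSmooth τ₀ (fun p => cutoff R τ₂ p * F p ^ 2) :=
        (slabSmooth_cutoff τ₀ R τ₂).mul (h.smooth_source.pow 2)
      have hiF : Integrable (fun x : Space => cutoff R τ₂ (t, x) * F (t, x) ^ 2) :=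
        integrable_slice hsq htI fun x hx => by
          rw [cutoff_eq_zero hR0.le (hsub t ht).1.le hx, zero_mul]
      have hiE := integrable_slice hsm htI (hsupp t (hsub t ht))
      have hFint : ∫ x : Space, cutoff R τ₂ (t, x) * F (t, x) ^ 2 ≤
          C ^ 2 * (volume (Metric.closedBall (0 : Space) R)).toReal := by
        have hle : ∀ x : Space, cutoff R τ₂ (t, x) * F (t, x) ^ 2 ≤
            (Metric.closedBall (0 : Space) R).indicator (fun _ => C ^ 2) x := fun x => by
          by_cases hx : x ∈ Metric.closedBall (0 : Space) R
          · rw [indicator_of_mem hx]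
            have b := abs_le.1 (hC t ht x (by simpa using hx))
            have b2 : F (t, x) ^ 2 ≤ C ^ 2 := sq_le_sq' b.1 b.2
            have b3 : cutoff R τ₂ (t, x) ≤ 1 := Real.smoothTransition.le_one _
            have b4 : 0 ≤ cutoff R τ₂ (t, x) := Real.smoothTransition.nonneg _
            nlinarith [sq_nonneg (F (t, x))]
          · rw [indicator_of_notMem hx,
              cutoff_eq_zero hR0.le (hsub t ht).1.le (by simpa using hx), zero_mul]
        refine (integral_mono hiF ((integrable_indicator_iff measurableSet_closedBall).2
          (integrableOn_const measure_closedBall_lt_top.ne)) hle).trans_eq ?_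
        rw [integral_indicator measurableSet_closedBall, setIntegral_const]
        simp [Measure.real, mul_comm]
      -- The flux has compact support, so its divergence may be subtracted from the time derivative
      -- of the energy density.
      have hzero : ∫ x : Space, ∑ i, sd i (energyFlux R τ₂ f i) (t, x) = 0 := by
        rw [integral_finsetSum _ fun i _ => (hdiv i).2]
        exact Finset.sum_eq_zero fun i _ => (hdiv i).1
      have hiS : Integrable (fun x : Space => ∑ i, sd i (energyFlux R τ₂ f i) (t, x)) :=
        integrable_finsetSum _ fun i _ => (hdiv i).2
      calc ∫ x : Space, pd 0 (energyDensity R τ₂ f) (t, x)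
          = ∫ x : Space, (pd 0 (energyDensity R τ₂ f) (t, x) -
              ∑ i, sd i (energyFlux R τ₂ f i) (t, x)) := by
            rw [integral_sub (hder t ht).2 hiS, hzero, sub_zero]
        _ ≤ ∫ x : Space, (energyDensity R τ₂ f (t, x) +
              1 / 2 * (cutoff R τ₂ (t, x) * F (t, x) ^ 2)) :=
            integral_mono ((hder t ht).2.sub hiS) (hiE.add (hiF.const_mul _)) fun x =>
              energy_inequality h hH hR0 (mk_mem_slab htI x) (hsub t ht).1.le
        _ = (∫ x : Space, energyDensity R τ₂ f (t, x)) +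
              1 / 2 * ∫ x : Space, cutoff R τ₂ (t, x) * F (t, x) ^ 2 := by
            rw [integral_add hiE (hiF.const_mul _), integral_const_mul]
        _ ≤ 1 * (∫ x : Space, energyDensity R τ₂ f (t, x)) + B := by
            rw [one_mul, hB]; gcongr) ht
  refine ⟨2 * ((|∫ x : Space, energyDensity R τ₂ f (τ₁, x)| + B) * Real.exp (-(1 * τ₁))),
    fun τ hτ => ?_⟩
  have hτI := Ico_sub_Ioo h₁ hτ
  have hiE := integrable_slice hsm hτI (hsupp τ (hsub τ hτ))
  have hnn : ∀ x, 0 ≤ energyDensity R τ₂ f (τ, x) := fun x =>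
    mul_nonneg (Real.smoothTransition.nonneg _) (mul_nonneg (by norm_num)
      (add_nonneg (mul_self_nonneg _) (Finset.sum_nonneg fun i _ => mul_self_nonneg _)))
  have h3 : ∫ x in Metric.closedBall (0 : Space) r, pd 0 f (τ, x) ^ 2 ≤
      ∫ x in Metric.closedBall (0 : Space) r, 2 * energyDensity R τ₂ f (τ, x) := by
    refine setIntegral_mono_on ?_ (hiE.const_mul 2).integrableOn measurableSet_closedBall
      fun x hx => ?_
    · exact (((h.smooth.pd 0).slice hτI).continuous.pow 2).continuousOn.integrableOn_compact
        (isCompact_closedBall _ _)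
    · have hx' : ‖x‖ ≤ r := by simpa using hx
      have hone : cutoff R τ₂ (τ, x) = 1 := by
        refine Real.smoothTransition.one_of_one_le ?_
        rw [coneFun_eq]
        have ht : τ - τ₂ ≤ |τ₂| := by
          rw [abs_of_neg hτ₂.2]; linarith [hτ.2]
        have hx2 : ‖x‖ ^ 2 ≤ r ^ 2 := by gcongr
        have : R * (τ - τ₂) ≤ R * |τ₂| := by gcongr
        simp only
        nlinarith [abs_nonneg τ₂]
      have hs : 0 ≤ ∑ i, sd i f (τ, x) * sd i f (τ, x) :=
        Finset.sum_nonneg fun i _ => mul_self_nonneg _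
      rw [energyDensity, hone]
      nlinarith
  refine h3.trans ?_
  rw [integral_const_mul]
  gcongr
  exact (setIntegral_le_integral hiE (Eventually.of_forall hnn)).trans (hgr τ hτ)

end

end DustPert

namespace DustPert

noncomputable section

/-! ### A pointwise bound by local square integrals -/

/-- The linear parametrization `(a, b, c) ↦ a e₀ + b e₁ + c e₂` of space. -/
def cubeMap (s : ℝ × ℝ × ℝ) : Space :=
  s.1 • EuclideanSpace.single 0 (1 : ℝ) + (s.2.1 • EuclideanSpace.single 1 (1 : ℝ) +
    s.2.2 • EuclideanSpace.single 2 (1 : ℝ))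

/-- Used to read iterated integrals along the three axes as a volume integral over a unit cube. -/
lemma measurePreserving_cubeMap : MeasurePreserving cubeMap := by
  have h1 := (volume_preserving_finTwoArrow ℝ).symm
  have h2 := (volume_preserving_piFinSuccAbove (fun _ : Fin 3 => ℝ) 0).symm
  have h3 := (EuclideanSpace.volume_preserving_symm_measurableEquiv_toLp (Fin 3)).symm
  have := h3.comp (h2.comp ((MeasurePreserving.id (volume : Measure ℝ)).prod h1))
  convert this using 1
  · funext s
    ext i
    fin_cases i <;> simp [cubeMap, MeasurableEquiv.piFinSuccAbove, MeasurableEquiv.finTwoArrow]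
  · exact Measure.volume_eq_prod _ _

/-- The mean of `k` over the segment from `x` to `x + e_i`. -/
def segmentMean (i : Fin 3) (k : Space → ℝ) (x : Space) : ℝ :=
  ∫ s in (0 : ℝ)..1, k (x + s • EuclideanSpace.single i (1 : ℝ))

lemma continuous_segment (i : Fin 3) {k : Space → ℝ} (hk : Continuous k) (x : Space) :
    Continuous fun s : ℝ => k (x + s • EuclideanSpace.single i (1 : ℝ)) := by fun_prop

lemma segmentMean_mono (i : Fin 3) {k l : Space → ℝ} (hk : Continuous k) (hl : Continuous l)
    (h : ∀ x, k x ≤ l x) (x : Space) : segmentMean i k x ≤ segmentMean i l x :=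
  intervalIntegral.integral_mono_on zero_le_one
    ((continuous_segment i hk x).intervalIntegrable _ _)
    ((continuous_segment i hl x).intervalIntegrable _ _) fun _ _ => h _

lemma continuous_segmentMean (i : Fin 3) {k : Space → ℝ} (hk : Continuous k) :
    Continuous (segmentMean i k) := by
  unfold segmentMean
  apply intervalIntegral.continuous_parametric_intervalIntegral_of_continuous'
  fun_prop

/-- The fundamental theorem of calculus is applied to `(1 - s) u(s)²`, whose weight removes the far
endpoint. The integrand `u² - 2 (1 - s) u u'` is at most `2 u² + u'²`. -/
lemma sq_le_segmentMean {τ₀ τ : ℝ} {g : Spacetime → ℝ} (hg : SlabSmooth τ₀ g)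
    (hτ : τ ∈ Ioo τ₀ 0) (i : Fin 3) (x : Space) : g (τ, x) ^ 2 ≤
      segmentMean i (fun y => 2 * g (τ, y) ^ 2 + sd i g (τ, y) ^ 2) x := by
  have hc := (hg.slice hτ).continuous
  have hc' := ((hg.sd i).slice hτ).continuous
  have c1 := continuous_segment i hc x
  have c2 := continuous_segment i hc' x
  have hk : Continuous fun y : Space => 2 * g (τ, y) ^ 2 + sd i g (τ, y) ^ 2 :=
    (continuous_const.mul (hc.pow 2)).add (hc'.pow 2)
  set u : ℝ → ℝ := fun s => g (τ, x + s • EuclideanSpace.single i (1 : ℝ)) with hu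
  set u' : ℝ → ℝ := fun s => sd i g (τ, x + s • EuclideanSpace.single i (1 : ℝ)) with hu'
  have hd (s : ℝ) : HasDerivAt (fun s => (1 - s) * u s ^ 2)
      (-u s ^ 2 + (1 - s) * (2 * u s * u' s)) s := by
    have h1 : HasDerivAt u (u' s) s := hasDerivAt_line (hg.differentiableAt (mk_mem_slab hτ _))
    have := ((hasDerivAt_id s).const_sub 1).fun_mul (h1.fun_pow 2)
    refine this.congr_deriv ?_
    simp
  have hftc := intervalIntegral.integral_eq_sub_of_hasDerivAt (a := 0) (b := 1)
    (fun s _ => hd s) (Continuous.intervalIntegrable (by fun_prop) _ _)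
  have hval : g (τ, x) ^ 2 = ∫ s in (0 : ℝ)..1, -(-u s ^ 2 + (1 - s) * (2 * u s * u' s)) := by
    rw [intervalIntegral.integral_neg, hftc]; simp [hu]
  rw [hval]
  refine intervalIntegral.integral_mono_on zero_le_one
    (Continuous.intervalIntegrable (by fun_prop) _ _)
    (Continuous.intervalIntegrable (continuous_segment i hk x) _ _) fun s hs => ?_
  change _ ≤ 2 * u s ^ 2 + u' s ^ 2
  have h1 : 0 ≤ 1 - s := by linarith [hs.2]
  have h2 : 0 ≤ (1 - s) * (u s + u' s) ^ 2 := mul_nonneg h1 (sq_nonneg _)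
  have h3 : 0 ≤ s * (u s ^ 2 + u' s ^ 2) := mul_nonneg hs.1 (by positivity)
  nlinarith

/-- By Fubini the iterated mean is the integral over a unit cube with corner `x`. Three unit edges
enlarge the radius by at most `3`, and `k ≥ 0` allows extending the domain. -/
lemma segmentMean_iterate_le {k : Space → ℝ} (hk : Continuous k) (h0 : ∀ x, 0 ≤ k x) {r : ℝ}
    {x : Space} (hx : ‖x‖ ≤ r) :
    segmentMean 0 (segmentMean 1 (segmentMean 2 k)) x ≤
      ∫ y in Metric.closedBall (0 : Space) (r + 3), k y := by
  have hcm : Continuous cubeMap := by unfold cubeMap; fun_prop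
  have hK : Continuous fun s : ℝ × ℝ × ℝ => k (x + cubeMap s) := by fun_prop
  set Q : Set (ℝ × ℝ × ℝ) := Ioc 0 1 ×ˢ Ioc 0 1 ×ˢ Ioc 0 1 with hQ
  have hQm : MeasurableSet Q := measurableSet_Ioc.prod (measurableSet_Ioc.prod measurableSet_Ioc)
  have hQsub : Q ⊆ Icc 0 1 ×ˢ Icc 0 1 ×ˢ Icc 0 1 :=
    prod_mono Ioc_subset_Icc_self (prod_mono Ioc_subset_Icc_self Ioc_subset_Icc_self)
  have hQc : IsCompact (Icc (0 : ℝ) 1 ×ˢ Icc (0 : ℝ) 1 ×ˢ Icc (0 : ℝ) 1) :=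
    isCompact_Icc.prod (isCompact_Icc.prod isCompact_Icc)
  have hKi : IntegrableOn (fun s => k (x + cubeMap s)) Q :=
    (hK.continuousOn.integrableOn_compact hQc).mono_set hQsub
  have e1 : segmentMean 0 (segmentMean 1 (segmentMean 2 k)) x =
      ∫ s in Q, k (x + cubeMap s) := by
    rw [hQ, Measure.volume_eq_prod, setIntegral_prod _ (by rwa [← Measure.volume_eq_prod])]
    simp only [segmentMean, intervalIntegral.integral_of_le zero_le_one]
    refine setIntegral_congr_fun measurableSet_Ioc fun a _ => ?_
    have hKa : Continuous fun s : ℝ × ℝ => k (x + cubeMap (a, s)) := by fun_prop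
    beta_reduce
    rw [Measure.volume_eq_prod, setIntegral_prod _ (by
      rw [← Measure.volume_eq_prod]
      exact (hKa.continuousOn.integrableOn_compact (isCompact_Icc.prod isCompact_Icc)).mono_set
        (prod_mono Ioc_subset_Icc_self Ioc_subset_Icc_self))]
    refine setIntegral_congr_fun measurableSet_Ioc fun b _ => ?_
    refine setIntegral_congr_fun measurableSet_Ioc fun c _ => ?_
    simp only [cubeMap, add_assoc]
  rw [e1, ← integral_indicator hQm, ← integral_indicator measurableSet_closedBall]
  have hpre : ∫ y : Space, (Metric.closedBall (0 : Space) (r + 3)).indicator k y =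
      ∫ s : ℝ × ℝ × ℝ, (Metric.closedBall (0 : Space) (r + 3)).indicator k (x + cubeMap s) := by
    have hm : AEStronglyMeasurable
        (fun y : Space => (Metric.closedBall (0 : Space) (r + 3)).indicator k (x + y))
        (Measure.map cubeMap volume) :=
      ((hk.stronglyMeasurable.indicator measurableSet_closedBall).comp_measurable
        (measurable_const_add x)).aestronglyMeasurable
    rw [← integral_add_left_eq_self _ x, ← measurePreserving_cubeMap.map_eq,
      integral_map measurePreserving_cubeMap.measurable.aemeasurable hm]
  have hinj : Integrable
      (fun s : ℝ × ℝ × ℝ => (Metric.closedBall (0 : Space) (r + 3)).indicator k (x + cubeMap s)) := by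
    have h1 : Integrable ((Metric.closedBall (0 : Space) (r + 3)).indicator k) :=
      (integrable_indicator_iff measurableSet_closedBall).2
        (hk.continuousOn.integrableOn_compact (isCompact_closedBall _ _))
    have h2 := h1.comp_add_left x
    exact measurePreserving_cubeMap.integrable_comp_of_integrable h2
  rw [hpre]
  refine integral_mono ((integrable_indicator_iff hQm).2 hKi) hinj fun s => ?_
  by_cases hs : s ∈ Q
  · have hs' := hQsub hs
    have hmem : x + cubeMap s ∈ Metric.closedBall (0 : Space) (r + 3) := by
      rw [mem_closedBall_zero_iff]
      refine (norm_add_le _ _).trans (add_le_add hx ?_)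
      have hb : ∀ t ∈ Icc (0 : ℝ) 1, ∀ i : Fin 3,
          ‖t • EuclideanSpace.single i (1 : ℝ)‖ ≤ 1 := fun t ht i => by
        rw [norm_smul]; simpa [abs_of_nonneg ht.1] using ht.2
      refine (norm_add_le _ _).trans ?_
      have h2 := norm_add_le (s.2.1 • EuclideanSpace.single (1 : Fin 3) (1 : ℝ))
        (s.2.2 • EuclideanSpace.single (2 : Fin 3) (1 : ℝ))
      linarith [hb _ hs'.1 0, hb _ hs'.2.1 1, hb _ hs'.2.2 2]
    rw [indicator_of_mem hs, indicator_of_mem hmem]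
  · rw [indicator_of_notMem hs]
    exact indicator_nonneg (fun y _ => h0 y) _

/-- The multi-indices of order at most one in each direction. -/
def multiIndices : Finset (List (Fin 3)) :=
  {[], [0], [1], [2], [1, 0], [2, 0], [2, 1], [2, 1, 0]}

/-- A Sobolev inequality. -/
lemma sq_le_sum_integral {τ₀ τ : ℝ} {g : Spacetime → ℝ} (hg : SlabSmooth τ₀ g)
    (hτ : τ ∈ Ioo τ₀ 0) {r : ℝ} {x : Space} (hx : ‖x‖ ≤ r) :
    g (τ, x) ^ 2 ≤ 8 * ∑ L ∈ multiIndices,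
      ∫ y in Metric.closedBall (0 : Space) (r + 3), sdList L g (τ, y) ^ 2 := by
  have hc (L : List (Fin 3)) : Continuous fun y : Space => sdList L g (τ, y) :=
    ((hg.sdList L).slice hτ).continuous
  let K : List (Fin 3) → Space → ℝ := fun L y => sdList L g (τ, y) ^ 2
  have hKc (L) : Continuous (K L) := (hc L).pow 2
  have step (L : List (Fin 3)) (i : Fin 3) (y : Space) : K L y ≤
      segmentMean i (fun y => 2 * K L y + K (i :: L) y) y :=
    sq_le_segmentMean (hg.sdList L) hτ i y
  have lin (i : Fin 3) (k l : Space → ℝ) (hk : Continuous k) (hl : Continuous l) (y : Space) :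
      segmentMean i (fun y => 2 * k y + l y) y = 2 * segmentMean i k y + segmentMean i l y := by
    simp only [segmentMean]
    rw [intervalIntegral.integral_add, intervalIntegral.integral_const_mul]
    · exact (continuous_const.mul (continuous_segment i hk y)).intervalIntegrable _ _
    · exact (continuous_segment i hl y).intervalIntegrable _ _
  have s0 := step [] 0 x
  -- `k1` and `k2` are the integrands after using the one-dimensional bound in two and three
  -- directions. Each use doubles the old terms, so the largest coefficient is `2³ = 8`.
  set k1 : Space → ℝ := fun y => 2 * (2 * K [] y + K [1] y) + (2 * K [0] y + K [1, 0] y) with hk1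
  set k2 : Space → ℝ := fun y => 2 * (2 * (2 * K [] y + K [2] y) + (2 * K [1] y + K [2, 1] y)) +
    (2 * (2 * K [0] y + K [2, 0] y) + (2 * K [1, 0] y + K [2, 1, 0] y)) with hk2
  have hk1c : Continuous k1 := by fun_prop
  have hk2c : Continuous k2 := by fun_prop
  have b1 (y : Space) : 2 * K [] y + K [0] y ≤ segmentMean 1 k1 y := by
    have t1 := step [] 1 y
    have t2 := step [0] 1 y
    rw [hk1, lin 1 _ _ (by fun_prop) (by fun_prop)]
    linarith
  have b2 (y : Space) : k1 y ≤ segmentMean 2 k2 y := by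
    have t1 := step [] 2 y
    have t2 := step [0] 2 y
    have t3 := step [1] 2 y
    have t4 := step [1, 0] 2 y
    have hP (L) : Continuous fun y => 2 * K L y + K (2 :: L) y := by fun_prop
    have a2 := lin 2 (fun y => 2 * K [] y + K [2] y) _ (hP []) (hP [1]) y
    have a3 := lin 2 (fun y => 2 * K [0] y + K [2, 0] y) _ (hP [0]) (hP [1, 0]) y
    rw [hk2, lin 2 _ _ (by fun_prop) (by fun_prop)]
    rw [a2, a3]
    simp only [hk1]
    linarith
  have c2 := continuous_segmentMean 2 hk2c
  have m1 := segmentMean_mono 0 (by fun_prop) (continuous_segmentMean 1 hk1c) b1 x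
  have m2 := segmentMean_mono 0 (continuous_segmentMean 1 hk1c) (continuous_segmentMean 1 c2)
    (segmentMean_mono 1 hk1c c2 b2) x
  have hnn (L) (y) : 0 ≤ K L y := sq_nonneg _
  have hnn2 (y : Space) : 0 ≤ k2 y := by
    simp only [hk2]
    linarith [hnn [] y, hnn [0] y, hnn [1] y, hnn [2] y, hnn [1, 0] y, hnn [2, 0] y, hnn [2, 1] y,
      hnn [2, 1, 0] y]
  have fin := segmentMean_iterate_le hk2c hnn2 hx
  have hint (L) : IntegrableOn (K L) (Metric.closedBall (0 : Space) (r + 3)) :=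
    (hKc L).continuousOn.integrableOn_compact (isCompact_closedBall _ _)
  have last : ∫ y in Metric.closedBall (0 : Space) (r + 3), k2 y ≤
      ∫ y in Metric.closedBall (0 : Space) (r + 3), 8 * ∑ L ∈ multiIndices, K L y := by
    refine integral_mono (hk2c.continuousOn.integrableOn_compact (isCompact_closedBall _ _))
      ((integrable_finsetSum _ fun L _ => hint L).const_mul 8) fun y => ?_
    simp [hk2, multiIndices]
    linarith [hnn [] y, hnn [0] y, hnn [1] y, hnn [2] y, hnn [1, 0] y, hnn [2, 0] y, hnn [2, 1] y,
      hnn [2, 1, 0] y]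
  rw [integral_const_mul, integral_finsetSum _ fun L _ => hint L] at last
  exact s0.trans (m1.trans (m2.trans (fin.trans last)))

/-- Solutions of the wave equation with damping and regular source have locally bounded time
derivative. -/
lemma IsWaveSolution.bddNear_pd {τ₀ : ℝ} {H : ℝ → ℝ} {f F : Spacetime → ℝ}
    (h : IsWaveSolution τ₀ H f F) (hHs : ContDiffOn ℝ ∞ H (Ioo τ₀ 0))
    (hH : ∀ τ ∈ Ioo τ₀ 0, 0 ≤ H τ) (hF : AllBddNear τ₀ F) : BddNear τ₀ (pd 0 f) := fun τ₁ h₁ r => by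
  -- Every spatial derivative of `f` solves a wave equation with bounded source. The radius `|r| +
  -- 3` is the one required by the Sobolev inequality.
  choose M hM using fun L => exists_energy_bound (h.sdList hHs L) hH (hF L) h₁
    (r := |r| + 3) (by positivity)
  refine ⟨8 * ∑ L ∈ multiIndices, M L + 1, fun τ hτ x hx => abs_le_of_sq_le_add ?_⟩
  have hτI := Ico_sub_Ioo h₁ hτ
  refine (sq_le_sum_integral (h.smooth.pd 0) hτI (hx.trans (le_abs_self r))).trans ?_
  gcongr with L _
  refine le_of_eq_of_le ?_ (hM L τ hτ)
  refine setIntegral_congr_fun measurableSet_closedBall fun y _ => ?_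
  simp only [pd_zero_sdList h.smooth L (mk_mem_slab hτI y)]

lemma IsWaveSolution.tendsToConstantInTime {τ₀ : ℝ} (hτ₀ : τ₀ < 0) {H : ℝ → ℝ}
    {f F : Spacetime → ℝ} (h : IsWaveSolution τ₀ H f F) (hHs : ContDiffOn ℝ ∞ H (Ioo τ₀ 0))
    (hH : ∀ τ ∈ Ioo τ₀ 0, 0 ≤ H τ) (hF : AllBddNear τ₀ F) : TendsToConstantInTime f :=
  tendsToConstantInTime_of_bddNear hτ₀ h.smooth (h.bddNear_pd hHs hH hF)

end

end DustPert

namespace DustPert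

noncomputable section

/-! ### Approach to de Sitter spacetime -/

/-- Locally uniform convergence to a continuous limit is joint convergence at every point. This
lemma serves to prove local uniformity from joint limits, and
`tendsto_joint_of_tendstoLocallyUniformly` is the converse passage. -/
lemma tendsto_uniformity_of_tendsto {α β : Type*} [UniformSpace β] {l : Filter α} {f g : α → β}
    {b : β} (hf : Tendsto f l (𝓝 b)) (hg : Tendsto g l (𝓝 b)) :
    Tendsto (fun x => (f x, g x)) l (uniformity β) := by
  have h := hf.prodMk_nhds hg
  exact h.mono_right (nhds_le_uniformity b)

lemma tendsto_joint_of_tendstoLocallyUniformly {ι α β : Type*} [TopologicalSpace α]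
    [UniformSpace β] {F : ι → α → β} {f : α → β} {l : Filter ι}
    (h : TendstoLocallyUniformly F f l) (hf : Continuous f) (x : α) :
    Tendsto (fun y : ι × α => F y.1 y.2) (l ×ˢ 𝓝 x) (𝓝 (f x)) :=
  ((hf.tendsto x).comp tendsto_snd).congr_uniformity
    (tendstoLocallyUniformly_iff_forall_tendsto.1 h x)

/-- The block matrix `diag(-1, h)`. -/
def lorentzBlock (h : Matrix (Fin 3) (Fin 3) ℝ) : Matrix (Fin 4) (Fin 4) ℝ :=
  Matrix.of fun μ ν => Fin.cases (Fin.cases (-1 : ℝ) (fun _ => (0 : ℝ)) ν)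
    (fun i : Fin 3 => Fin.cases (0 : ℝ) (fun j : Fin 3 => h i j) ν) μ

lemma synchronousMetric_apply (a : ℝ → ℝ) (h : Spacetime → Matrix (Fin 3) (Fin 3) ℝ)
    (p : Spacetime) (μ ν : Fin 4) :
    synchronousMetric a h p μ ν = a p.1 ^ 2 * lorentzBlock (h p) μ ν := rfl

lemma continuous_lorentzBlock_apply (μ ν : Fin 4) :
    Continuous fun h : Matrix (Fin 3) (Fin 3) ℝ => lorentzBlock h μ ν := by
  refine Fin.cases ?_ (fun i => ?_) μ <;> refine Fin.cases ?_ (fun j => ?_) ν <;>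
    simp only [lorentzBlock, Matrix.of_apply, Fin.cases_zero, Fin.cases_succ] <;>
    first | exact continuous_const | exact (continuous_apply_apply i j)

lemma fderiv_observerChart (M : Matrix (Fin 3) (Fin 3) ℝ) (x₀ : Space) (s : ℝ)
    (p v : Spacetime) :
    fderiv ℝ (observerChart M x₀ s) p v = (s * v.1, s • Matrix.toEuclideanLin M v.2) := by
  have h1 : HasFDerivAt (fun p : Spacetime => s * p.1)
      (s • ContinuousLinearMap.fst ℝ ℝ Space) p := hasFDerivAt_fst.const_mul s
  have h2 : HasFDerivAt (fun p : Spacetime => x₀ + s • Matrix.toEuclideanLin M p.2)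
      (s • (LinearMap.toContinuousLinearMap (Matrix.toEuclideanLin M)).comp
        (ContinuousLinearMap.snd ℝ ℝ Space)) p := by
    have h3 := (LinearMap.toContinuousLinearMap (Matrix.toEuclideanLin M)).hasFDerivAt.comp p
      (hasFDerivAt_snd (𝕜 := ℝ) (E := ℝ) (F := Space))
    exact (h3.const_smul s).const_add x₀
  have h := (h1.prodMk h2).fderiv
  change fderiv ℝ (fun p : Spacetime => (s * p.1, x₀ + s • Matrix.toEuclideanLin M p.2)) p v = _
  rw [h]; simp

/-- The chart is affine with differential `s · diag(1, M)`, so the factor `s²` joins `a²` and `M`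
acts by congruence on the spatial block only. -/
lemma pullback_observerChart (a : ℝ → ℝ) (h : Spacetime → Matrix (Fin 3) (Fin 3) ℝ)
    (M : Matrix (Fin 3) (Fin 3) ℝ) (x₀ : Space) (s : ℝ) (p : Spacetime) (μ ν : Fin 4) :
    pullback (observerChart M x₀ s) (synchronousMetric a h) p μ ν =
      (s * a (s * p.1)) ^ 2 * lorentzBlock (M.transpose * h (observerChart M x₀ s p) * M) μ ν := by
  have hc (i j : Fin 3) : coord i.succ (fderiv ℝ (observerChart M x₀ s) p (basisVec j.succ)) =
      s * M i j := by
    simp [fderiv_observerChart, coord, basisVec_succ, Matrix.toLpLin_apply]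
  have hc0 : coord 0 (fderiv ℝ (observerChart M x₀ s) p (basisVec 0)) = s := by
    simp [fderiv_observerChart, coord, basisVec_zero]
  have hc1 (j : Fin 3) : coord 0 (fderiv ℝ (observerChart M x₀ s) p (basisVec j.succ)) = 0 := by
    simp [fderiv_observerChart, coord, basisVec_succ]
  have hc2 (j : Fin 3) : coord j.succ (fderiv ℝ (observerChart M x₀ s) p (basisVec 0)) = 0 := by
    simp [fderiv_observerChart, coord, basisVec_zero]
  have hp1 : (observerChart M x₀ s p).1 = s * p.1 := rfl
  simp only [pullback, synchronousMetric_apply, Matrix.of_apply, hp1]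
  generalize h (observerChart M x₀ s p) = N
  refine Fin.cases ?_ (fun i => ?_) μ <;> refine Fin.cases ?_ (fun j => ?_) ν <;>
    simp only [lorentzBlock, Matrix.of_apply, Fin.cases_zero, Fin.cases_succ,
      Fin.sum_univ_succ (n := 3), hc, hc0, hc1, hc2]
  · simp; ring
  · simp
  · simp
  · simp [Matrix.mul_apply, Finset.mul_sum, Finset.sum_mul]
    rw [Finset.sum_comm]
    refine Finset.sum_congr rfl fun k _ => Finset.sum_congr rfl fun l _ => ?_
    ring

/-- This invariance expresses that dilations are isometries of de Sitter space. -/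
lemma deSitterScale_rescale (Λ : ℝ) {s : ℝ} (hs : s ≠ 0) (η : ℝ) :
    s * deSitterScale Λ (s * η) = deSitterScale Λ η := by
  unfold deSitterScale
  rcases eq_or_ne η 0 with rfl | hη
  · simp
  · field_simp

lemma deSitterScale_pos {Λ τ : ℝ} (hΛ : 0 < Λ) (hτ : τ < 0) : 0 < deSitterScale Λ τ :=
  div_pos_of_neg_of_neg (neg_neg_of_pos (Real.sqrt_pos.2 (by positivity))) hτ

lemma continuousAt_deSitterScale (Λ : ℝ) {τ : ℝ} (hτ : τ ≠ 0) :
    ContinuousAt (deSitterScale Λ) τ :=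
  continuousAt_const.div continuousAt_id hτ

open scoped MatrixOrder Matrix.Norms.L2Operator in
/-- A metric with de Sitter asymptotics of the scale factor and convergent conformal spatial metric
approaches de Sitter spacetime locally. -/
lemma approachesDeSitterAt_of_tendsto {Λ : ℝ} (hΛ : 0 < Λ) {a : ℝ → ℝ}
    (ha : Tendsto (fun τ => a τ / deSitterScale Λ τ) (𝓝[<] 0) (𝓝 1))
    {h : Spacetime → Matrix (Fin 3) (Fin 3) ℝ} {x₀ : Space} {P : Matrix (Fin 3) (Fin 3) ℝ}
    (hP : P.PosDef) (hh : Tendsto h (𝓝[<] 0 ×ˢ 𝓝 x₀) (𝓝 P)) :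
    ApproachesDeSitterAt Λ (synchronousMetric a h) x₀ := by
  -- The inverse of any such factor is the required frame, since `(B⁻¹)ᵀ P B⁻¹ = 1`.
  obtain ⟨B, hB⟩ : ∃ B : Matrix (Fin 3) (Fin 3) ℝ, P = B.transpose * B := by
    obtain ⟨B, hB⟩ := CStarAlgebra.nonneg_iff_eq_star_mul_self.1 hP.posSemidef.nonneg
    exact ⟨B, hB⟩
  have hBu : IsUnit B.det := by
    have := hP.isUnit
    rw [hB, Matrix.isUnit_iff_isUnit_det, Matrix.det_mul] at this
    exact isUnit_of_mul_isUnit_right this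
  have hM : (B⁻¹).transpose * P * B⁻¹ = 1 := by
    rw [hB, Matrix.mul_assoc, Matrix.mul_assoc, Matrix.mul_nonsing_inv _ hBu, Matrix.mul_one,
      ← Matrix.transpose_mul, Matrix.mul_nonsing_inv _ hBu, Matrix.transpose_one]
  refine ⟨B⁻¹, (Matrix.isUnit_nonsing_inv_det _ hBu), fun μ ν => ?_⟩
  have hopen : IsOpen {p : Spacetime | p.1 < 0} := isOpen_lt continuous_fst continuous_const
  rw [hopen.tendstoLocallyUniformlyOn_iff_forall_tendsto]
  intro p₀ (hp₀ : p₀.1 < 0)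
  set l : Filter (ℝ × Spacetime) := 𝓝[>] (0 : ℝ) ×ˢ 𝓝 p₀ with hl
  have hs : Tendsto (fun y : ℝ × Spacetime => y.1) l (𝓝[>] 0) := tendsto_fst
  have hs0 : Tendsto (fun y : ℝ × Spacetime => y.1) l (𝓝 0) :=
    hs.mono_right nhdsWithin_le_nhds
  have hp : Tendsto (fun y : ℝ × Spacetime => y.2) l (𝓝 p₀) := tendsto_snd
  have hη : Tendsto (fun y : ℝ × Spacetime => y.2.1) l (𝓝 p₀.1) :=
    (continuous_fst.tendsto p₀).comp hp
  have hspos : ∀ᶠ y in l, 0 < y.1 := hs self_mem_nhdsWithin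
  have hηneg : ∀ᶠ y in l, y.2.1 < 0 := hη (Iio_mem_nhds hp₀)
  have hsη : Tendsto (fun y : ℝ × Spacetime => y.1 * y.2.1) l (𝓝[<] 0) := by
    refine tendsto_nhdsWithin_iff.2 ⟨by simpa using hs0.mul hη, ?_⟩
    filter_upwards [hspos, hηneg] with y h1 h2 using mul_neg_of_pos_of_neg h1 h2
  have hdS : Tendsto (fun y : ℝ × Spacetime => deSitterScale Λ y.2.1) l
      (𝓝 (deSitterScale Λ p₀.1)) := (continuousAt_deSitterScale Λ hp₀.ne).tendsto.comp hη
  -- By the dilation invariance, `s a(s η)` is the ratio `a / a_dS` at `s η` times `a_dS(η)`.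
  have hsa : Tendsto (fun y : ℝ × Spacetime => y.1 * a (y.1 * y.2.1)) l
      (𝓝 (deSitterScale Λ p₀.1)) := by
    have := (ha.comp hsη).mul hdS
    rw [one_mul] at this
    refine this.congr' ?_
    filter_upwards [hspos, hηneg] with y h1 h2
    have h3 := (deSitterScale_pos hΛ (mul_neg_of_pos_of_neg h1 h2)).ne'
    rw [← deSitterScale_rescale Λ h1.ne' y.2.1]
    simp only [Function.comp]
    field_simp
  have hx : Tendsto (fun y : ℝ × Spacetime =>
      x₀ + y.1 • Matrix.toEuclideanLin B⁻¹ y.2.2) l (𝓝 x₀) := by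
    have h1 : Tendsto (fun y : ℝ × Spacetime => Matrix.toEuclideanLin B⁻¹ y.2.2) l
        (𝓝 (Matrix.toEuclideanLin B⁻¹ p₀.2)) :=
      (((LinearMap.continuous_of_finiteDimensional (Matrix.toEuclideanLin B⁻¹)).comp
        continuous_snd).tendsto p₀).comp hp
    simpa using (hs0.smul h1).const_add x₀
  have hN : Tendsto (fun y : ℝ × Spacetime => h (observerChart B⁻¹ x₀ y.1 y.2)) l (𝓝 P) :=
    hh.comp (hsη.prodMk hx)
  have hblock : Tendsto (fun y : ℝ × Spacetime => lorentzBlock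
      ((B⁻¹).transpose * h (observerChart B⁻¹ x₀ y.1 y.2) * B⁻¹) μ ν) l
      (𝓝 (lorentzBlock 1 μ ν)) := by
    rw [← hM]
    have hc : Continuous fun N : Matrix (Fin 3) (Fin 3) ℝ =>
        lorentzBlock ((B⁻¹).transpose * N * B⁻¹) μ ν :=
      (continuous_lorentzBlock_apply μ ν).comp (by fun_prop)
    exact (hc.tendsto P).comp hN
  refine tendsto_uniformity_of_tendsto (b := deSitterScale Λ p₀.1 ^ 2 * lorentzBlock 1 μ ν) ?_ ?_
  · exact (hdS.pow 2).mul_const _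
  · simp only [pullback_observerChart]
    exact (hsa.pow 2).mul hblock

/-- A small multiple of a bounded symmetric matrix does not spoil positivity of the identity. -/
lemma posDef_one_add_smul {N : Matrix (Fin 3) (Fin 3) ℝ} (hN : N.IsSymm) {C ε : ℝ}
    (hC : ∀ i j, |N i j| ≤ C) (hε : |ε| < 1 / (3 * C + 1)) : (1 + ε • N).PosDef := by
  have hC0 : 0 ≤ C := (abs_nonneg _).trans (hC 0 0)
  have hε' : |ε| * (3 * C) < 1 := by
    rw [lt_div_iff₀ (by positivity)] at hε
    nlinarith [abs_nonneg ε]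
  refine Matrix.PosDef.of_dotProduct_mulVec_pos ?_ fun x hx => ?_
  · rw [Matrix.IsHermitian, Matrix.conjTranspose_eq_transpose_of_trivial, Matrix.transpose_add,
      Matrix.transpose_one, Matrix.transpose_smul, hN.eq]
  · have hpos : 0 < ∑ i, x i ^ 2 := by
      obtain ⟨i, hi⟩ := Function.ne_iff.1 hx
      exact Finset.sum_pos' (fun i _ => sq_nonneg _) ⟨i, Finset.mem_univ _, by
        have : x i ≠ 0 := hi
        positivity⟩
    -- Summed over the nine pairs, these bounds cost at most `3 C |ε| |x|²`, which is the source of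
    -- the factor `3 C` in the smallness condition.
    have hterm (i j : Fin 3) : -(C * |ε| * (x i ^ 2 + x j ^ 2) / 2) ≤ x i * (ε * N i j * x j) := by
      have h1 : |x i * (ε * N i j * x j)| ≤ C * |ε| * (x i ^ 2 + x j ^ 2) / 2 := by
        rw [show x i * (ε * N i j * x j) = (N i j * ε) * (x i * x j) by ring, abs_mul, abs_mul]
        have h2 : |x i * x j| ≤ (x i ^ 2 + x j ^ 2) / 2 := by
          rw [abs_le]; constructor <;> nlinarith [sq_nonneg (x i + x j), sq_nonneg (x i - x j)]
        calc |N i j| * |ε| * |x i * x j| ≤ (C * |ε|) * ((x i ^ 2 + x j ^ 2) / 2) := by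
              gcongr; exact hC i j
          _ = _ := by ring
      exact (abs_le.1 h1).1
    have hexp : star x ⬝ᵥ ((1 + ε • N).mulVec x) =
        ∑ i, x i ^ 2 + ∑ i, ∑ j, x i * (ε * N i j * x j) := by
      rw [Matrix.add_mulVec, Matrix.one_mulVec, dotProduct_add]
      simp [dotProduct, Matrix.mulVec, Finset.mul_sum, pow_two, Matrix.smul_apply]
    have hsum := Finset.sum_le_sum fun i (_ : i ∈ Finset.univ) =>
      Finset.sum_le_sum fun j (_ : j ∈ Finset.univ) => hterm i j
    rw [hexp]
    simp only [Fin.sum_univ_three] at hsum hpos ⊢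
    nlinarith

/-- Metric perturbations converge at late times, and the perturbed metric approaches de Sitter. -/
theorem perturbation_asymptotics {Λ τ₀ : ℝ} (hΛ : 0 < Λ) (hτ₀ : τ₀ < 0) {a ρ : ℝ → ℝ}
    (h : IsDustBackground Λ τ₀ a ρ) {γ : Spacetime → Matrix (Fin 3) (Fin 3) ℝ}
    {ρ₁ : Spacetime → ℝ} (hγ : ∀ i j, SlabSmooth τ₀ (comp γ i j))
    (hsym : ∀ p ∈ slab τ₀, (γ p).IsSymm) (hE : SolvesLinearizedEinstein Λ τ₀ a ρ γ ρ₁) :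
    ∃ γlim : Space → Matrix (Fin 3) (Fin 3) ℝ, Continuous γlim ∧
      (∀ i j, TendstoLocallyUniformly (fun (τ : ℝ) (x : Space) => γ (τ, x) i j)
        (fun x => γlim x i j) (𝓝[<] 0)) ∧
      (∀ (ε : ℝ) (x₀ : Space), (1 + ε • γlim x₀).PosDef →
        ApproachesDeSitterAt Λ (perturbedMetric a γ ε) x₀) ∧
      (∀ S : Set Space, IsCompact S → ∃ ε₀ : ℝ, 0 < ε₀ ∧
        ∀ ε : ℝ, |ε| < ε₀ → ∀ x ∈ S, (1 + ε • γlim x).PosDef) := by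
  have hlim (i j) : TendsToConstantInTime (comp γ i j) := by
    have hsrc := allBddNear_waveSource h hΛ hγ hsym hE i j
    have hw : IsWaveSolution τ₀ (hubble a) (comp γ i j) (waveSource γ i j) :=
      ⟨hγ i j, hsrc.1, fun p hp => (linearized_system h hγ hsym hE hp).2.2 i j⟩
    exact hw.tendsToConstantInTime hτ₀ (contDiffOn_hubble h.smooth h.a_pos)
      (fun τ hτ => (h.hubble_pos hΛ hτ).le) hsrc.2
  choose c hc hcl using hlim
  have hcont : Continuous fun x => (Matrix.of fun i j => c i j x : Matrix (Fin 3) (Fin 3) ℝ) :=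
    continuous_matrix fun i j => hc i j
  have hjoint (x : Space) (i j) :
      Tendsto (fun p : Spacetime => γ p i j) (𝓝[<] 0 ×ˢ 𝓝 x) (𝓝 (c i j x)) :=
    tendsto_joint_of_tendstoLocallyUniformly (hcl i j) (hc i j) x
  refine ⟨fun x => Matrix.of fun i j => c i j x, hcont, hcl, fun ε x₀ hP => ?_, fun S hS => ?_⟩
  · refine approachesDeSitterAt_of_tendsto hΛ (h.tendsto_scale_div hΛ hτ₀) hP ?_
    refine tendsto_const_nhds.add (Tendsto.const_smul ?_ ε)
    exact tendsto_pi_nhds.2 fun i => tendsto_pi_nhds.2 fun j => hjoint x₀ i j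
  · have hsymm (x : Space) : (Matrix.of fun i j => c i j x : Matrix (Fin 3) (Fin 3) ℝ).IsSymm := by
      refine Matrix.IsSymm.ext fun i j => ?_
      -- Symmetry passes to the limit by uniqueness of limits.
      refine tendsto_nhds_unique_of_eventuallyEq (hjoint x j i) (hjoint x i j) ?_
      have : slab τ₀ ∈ 𝓝[<] (0 : ℝ) ×ˢ 𝓝 x :=
        prod_mem_prod (Ioo_mem_nhdsLT hτ₀) univ_mem
      filter_upwards [this] with p hp using (hsym p hp).apply i j
    obtain ⟨C, hC⟩ := hS.exists_bound_of_continuousOn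
      (f := fun x => fun ij : Fin 3 × Fin 3 => c ij.1 ij.2 x)
      (continuous_pi fun ij : Fin 3 × Fin 3 => hc ij.1 ij.2).continuousOn
    refine ⟨1 / (3 * max C 0 + 1), by positivity, fun ε hε x hx =>
      posDef_one_add_smul (hsymm x) (C := max C 0) (fun i j => ?_) hε⟩
    exact ((norm_le_pi_norm (fun ij : Fin 3 × Fin 3 => c ij.1 ij.2 x) (i, j)).trans
      (hC x hx)).trans (le_max_left _ _)

end

end DustPert

namespace DustPert

noncomputable section

/-! ### Decay at spatial infinity and Liouville's theorem -/

/-- `f` is smooth and vanishes with all its derivatives at spatial infinity. -/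
structure IsDecaying (τ₀ : ℝ) (f : Spacetime → ℝ) : Prop where
  smooth : SlabSmooth τ₀ f
  vanishes : VanishesAtInfinity τ₀ f

/-- `f` tends to `0` at spatial infinity at each time. -/
def TendsToZeroAtInfinity (τ₀ : ℝ) (f : Spacetime → ℝ) : Prop :=
  ∀ τ ∈ Ioo τ₀ 0, Tendsto (fun x : Space => f (τ, x)) (cocompact Space) (𝓝 0)

namespace IsDecaying
variable {τ₀ : ℝ} {f g : Spacetime → ℝ}

/-- The derivatives required to decay are spacetime derivatives, so time derivatives decay too. This
allows Liouville's theorem to be applied to the time derivative of a mode. -/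
lemma pd (hf : IsDecaying τ₀ f) (μ : Fin 4) : IsDecaying τ₀ (pd μ f) := by
  refine ⟨hf.smooth.pd μ, fun τ hτ k => ?_⟩
  set L : (Spacetime →L[ℝ] ℝ) →L[ℝ] ℝ := ContinuousLinearMap.apply ℝ ℝ (basisVec μ)
  have hbound (x : Space) : ‖iteratedFDeriv ℝ k (DustPert.pd μ f) (τ, x)‖ ≤
      ‖L‖ * ‖iteratedFDeriv ℝ (k + 1) f (τ, x)‖ := by
    have hc : ContDiffAt ℝ ∞ (fderiv ℝ f) (τ, x) :=
      (hf.smooth.contDiffAt (mk_mem_slab hτ x)).fderiv_right (by simp)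
    have := L.norm_iteratedFDeriv_comp_left (n := k) hc (WithTop.coe_le_coe.2 le_top)
    rwa [norm_iteratedFDeriv_fderiv] at this
  refine squeeze_zero_norm hbound ?_
  simpa using (hf.vanishes τ hτ (k + 1)).norm.const_mul ‖L‖

lemma sd (hf : IsDecaying τ₀ f) (i : Fin 3) : IsDecaying τ₀ (sd i f) := hf.pd i.succ

lemma add (hf : IsDecaying τ₀ f) (hg : IsDecaying τ₀ g) : IsDecaying τ₀ (fun p => f p + g p) := by
  refine ⟨hf.smooth.add hg.smooth, fun τ hτ k => ?_⟩
  have h (x : Space) : iteratedFDeriv ℝ k (fun p => f p + g p) (τ, x) =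
      iteratedFDeriv ℝ k f (τ, x) + iteratedFDeriv ℝ k g (τ, x) :=
    iteratedFDeriv_add_apply
      ((hf.smooth.contDiffAt (mk_mem_slab hτ x)).of_le (WithTop.coe_le_coe.2 le_top))
      ((hg.smooth.contDiffAt (mk_mem_slab hτ x)).of_le (WithTop.coe_le_coe.2 le_top))
  simp only [h]
  simpa using (hf.vanishes τ hτ k).add (hg.vanishes τ hτ k)

lemma const_mul (hf : IsDecaying τ₀ f) (c : ℝ) : IsDecaying τ₀ (fun p => c * f p) := by
  refine ⟨contDiffOn_const.mul hf.smooth, fun τ hτ k => ?_⟩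
  have h (x : Space) : iteratedFDeriv ℝ k (fun p => c * f p) (τ, x) =
      c • iteratedFDeriv ℝ k f (τ, x) :=
    iteratedFDeriv_const_smul_apply (a := c)
      ((hf.smooth.contDiffAt (mk_mem_slab hτ x)).of_le (WithTop.coe_le_coe.2 le_top))
  simp only [h]
  simpa using (hf.vanishes τ hτ k).const_smul c

lemma lap (hf : IsDecaying τ₀ f) : IsDecaying τ₀ (lap f) := by
  have h : DustPert.lap f = fun p => DustPert.sd 0 (DustPert.sd 0 f) p +
      (DustPert.sd 1 (DustPert.sd 1 f) p + DustPert.sd 2 (DustPert.sd 2 f) p) := by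
    funext p; simp [DustPert.lap, Fin.sum_univ_three, add_assoc]
  rw [h]
  exact ((hf.sd 0).sd 0).add (((hf.sd 1).sd 1).add ((hf.sd 2).sd 2))

lemma tendsToZero (hf : IsDecaying τ₀ f) : TendsToZeroAtInfinity τ₀ f := fun τ hτ => by
  have h := (hf.vanishes τ hτ 0).norm
  simp only [norm_iteratedFDeriv_zero, norm_zero] at h
  exact tendsto_zero_iff_norm_tendsto_zero.2 h

end IsDecaying

namespace TendsToZeroAtInfinity
variable {τ₀ : ℝ} {f g : Spacetime → ℝ}

lemma add (hf : TendsToZeroAtInfinity τ₀ f) (hg : TendsToZeroAtInfinity τ₀ g) :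
    TendsToZeroAtInfinity τ₀ (fun p => f p + g p) := fun τ hτ => by
  simpa using (hf τ hτ).add (hg τ hτ)

lemma time_mul (hf : TendsToZeroAtInfinity τ₀ f) (c : ℝ → ℝ) :
    TendsToZeroAtInfinity τ₀ (fun p => c p.1 * f p) := fun τ hτ => by
  simpa using (hf τ hτ).const_mul (c τ)

lemma const_mul (hf : TendsToZeroAtInfinity τ₀ f) (c : ℝ) :
    TendsToZeroAtInfinity τ₀ (fun p => c * f p) := hf.time_mul fun _ => c

lemma congr (hf : TendsToZeroAtInfinity τ₀ f) (h : EqOn f g (slab τ₀)) :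
    TendsToZeroAtInfinity τ₀ g := fun τ hτ =>
  (hf τ hτ).congr fun x => h (mk_mem_slab hτ x)

end TendsToZeroAtInfinity

/-- Maximum principle with a strictly subharmonic perturbation: a positive value of `u` would force
`u + ε |y|²` to have an interior maximum in a large ball, where its Laplacian `6 ε` would have to be
nonpositive. -/
lemma nonpos_of_harmonic {τ₀ τ : ℝ} {u : Spacetime → ℝ} (hu : SlabSmooth τ₀ u) (hτ : τ ∈ Ioo τ₀ 0)
    (hlap : ∀ x, lap u (τ, x) = 0)
    (hlim : Tendsto (fun x : Space => u (τ, x)) (cocompact Space) (𝓝 0)) (x : Space) :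
    u (τ, x) ≤ 0 := by
  by_contra! hx
  set m := u (τ, x)
  obtain ⟨R, hR⟩ : ∃ R : ℝ, ∀ y : Space, R ≤ ‖y‖ → u (τ, y) < m / 2 := by
    have h1 := hlim.eventually (Iio_mem_nhds (half_pos hx))
    rw [← Metric.cobounded_eq_cocompact, ← comap_norm_atTop, eventually_comap] at h1
    obtain ⟨R, hR⟩ := eventually_atTop.1 h1
    exact ⟨R, fun y hy => hR ‖y‖ hy y rfl⟩
  set S := max (max R ‖x‖) 1
  have hS : 0 < S := lt_of_lt_of_le one_pos (le_max_right _ _)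
  have hSR : R ≤ S := (le_max_left _ _).trans (le_max_left _ _)
  have hxS : ‖x‖ ≤ S := (le_max_right _ _).trans (le_max_left _ _)
  -- The perturbation is at most `m/4` on the ball, while `u < m/2` on its boundary. Hence the
  -- boundary values stay below `m`.
  set ε := m / (4 * S ^ 2)
  have hε : 0 < ε := by positivity
  have hεS : ε * S ^ 2 = m / 4 := by simp only [ε]; field_simp
  set v : Space → ℝ := fun y => u (τ, y) + ε * ‖y‖ ^ 2 with hv
  have hvc : Continuous v := (hu.slice hτ).continuous.add (by fun_prop)
  obtain ⟨y, hy, hmax⟩ := (isCompact_closedBall (0 : Space) S).exists_isMaxOn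
    ⟨x, by simpa using hxS⟩ hvc.continuousOn
  rw [mem_closedBall_zero_iff] at hy
  have hvy : m ≤ v y := by
    refine le_trans ?_ (hmax (a := x) (by simpa using hxS))
    have : 0 ≤ ε * ‖x‖ ^ 2 := by positivity
    simp only [hv]; linarith
  have hyS : ‖y‖ < S := by
    refine lt_of_le_of_ne hy fun h => ?_
    have h2 := hR y (hSR.trans h.ge)
    simp only [hv] at hvy
    rw [h, hεS] at hvy
    linarith
  have hloc : IsLocalMax v y := by
    filter_upwards [Metric.isOpen_ball.mem_nhds
      (show y ∈ Metric.ball (0 : Space) S by simpa using hyS)] with z hz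
    exact hmax (Metric.ball_subset_closedBall hz)
  -- Second derivative test along a coordinate line. A positive second derivative would make the
  -- maximum also a minimum, so the function would be locally constant, contradicting that
  -- positivity.
  have hline (i : Fin 3) : sd i (sd i u) (τ, y) + 2 * ε ≤ 0 := by
    by_contra! hpos
    set e : Space := EuclideanSpace.single i (1 : ℝ) with he
    set w : ℝ → ℝ := fun t => v (y + t • e) with hw
    have hnorm (t : ℝ) : ‖y + t • e‖ ^ 2 = ‖y‖ ^ 2 + 2 * t * y i + t ^ 2 := by
      rw [norm_add_sq_real, norm_smul, real_inner_smul_right, he, EuclideanSpace.inner_single_right]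
      simp
      ring
    have hd (t : ℝ) : HasDerivAt w (sd i u (τ, y + t • e) + ε * (2 * y i + 2 * t)) t := by
      have h1 := hasDerivAt_line (i := i) (s := t) (hu.differentiableAt (mk_mem_slab hτ _))
        (x := y)
      have h2 : HasDerivAt (fun t : ℝ => ε * (‖y‖ ^ 2 + 2 * t * y i + t ^ 2))
          (ε * (2 * y i + 2 * t)) t := by
        have h3 := ((((hasDerivAt_id t).const_mul 2).mul_const (y i)).const_add (‖y‖ ^ 2)).add
          ((hasDerivAt_id t).pow 2)
        refine (h3.const_mul ε).congr_deriv ?_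
        simp
      have h4 := h1.add h2
      refine h4.congr_of_eventuallyEq (Eventually.of_forall fun s => ?_)
      simp only [hw, hv, hnorm]; rfl
    have hdd : HasDerivAt (deriv w) (sd i (sd i u) (τ, y) + ε * 2) 0 := by
      have h0 : deriv w = fun t => sd i u (τ, y + t • e) + ε * (2 * y i + 2 * t) :=
        funext fun t => (hd t).deriv
      rw [h0]
      have h1 := hasDerivAt_line (i := i) (s := 0) (x := y)
        ((hu.sd i).differentiableAt (mk_mem_slab hτ _))
      have h2 : HasDerivAt (fun t : ℝ => ε * (2 * y i + 2 * t)) (ε * 2) 0 := by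
        simpa using (((hasDerivAt_id (0 : ℝ)).const_mul 2).const_add (2 * y i)).const_mul ε
      refine (h1.add h2).congr_deriv ?_
      simp
    have hwmax : IsLocalMax w 0 := by
      have hc : ContinuousAt (fun t : ℝ => y + t • e) 0 := by fun_prop
      have h1 : ∀ᶠ z in 𝓝 (y + (0 : ℝ) • e), v z ≤ v y := by
        rw [zero_smul, add_zero]; exact hloc
      have := hc.tendsto.eventually h1
      filter_upwards [this] with t ht
      simpa [hw] using ht
    have hwmin : IsLocalMin w 0 := isLocalMin_of_deriv_deriv_pos
      (by rw [hdd.deriv]; linarith) hwmax.deriv_eq_zero (hd 0).continuousAt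
    have hconst : w =ᶠ[𝓝 0] fun _ => w 0 := by
      filter_upwards [hwmax, hwmin] with t h1 h2 using le_antisymm h1 h2
    have h0 : deriv (deriv w) 0 = 0 := by
      rw [hconst.deriv.deriv_eq]; simp
    rw [hdd.deriv] at h0
    linarith
  have := hlap y
  simp only [lap, Fin.sum_univ_three] at this
  linarith [hline 0, hline 1, hline 2]

/-- Harmonic functions that vanish at infinity are zero. -/
lemma eq_zero_of_harmonic {τ₀ : ℝ} {u : Spacetime → ℝ} (hu : SlabSmooth τ₀ u)
    (hlap : ∀ p ∈ slab τ₀, lap u p = 0) (hlim : TendsToZeroAtInfinity τ₀ u) {p : Spacetime}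
    (hp : p ∈ slab τ₀) : u p = 0 := by
  have hτ := hp.1
  refine le_antisymm (nonpos_of_harmonic hu hτ (fun x => hlap _ (mk_mem_slab hτ x))
    (hlim p.1 hτ) p.2) ?_
  have hneg (q : Spacetime) : lap (fun q => - u q) q = - lap u q := by
    have h1 (i : Fin 3) : sd i (fun q => - u q) = fun q => - sd i u q :=
      funext fun q => pd_neg
    simp only [lap, h1, ← Finset.sum_neg_distrib]
    exact Finset.sum_congr rfl fun i _ => pd_neg
  have := nonpos_of_harmonic (u := fun q => - u q) hu.neg hτ
    (fun x => by rw [hneg, hlap _ (mk_mem_slab hτ x), neg_zero])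
    (by simpa using (hlim p.1 hτ).neg) p.2
  simpa using this

/-! ### The damped wave operator -/

section operators
variable {τ₀ : ℝ} {f g : Spacetime → ℝ}

lemma lap_pd (hf : SlabSmooth τ₀ f) (μ : Fin 4) : EqOn (lap (pd μ f)) (pd μ (lap f)) (slab τ₀) := by
  intro p hp
  unfold lap
  rw [pd_sum fun i _ => ((hf.sd i).sd i).differentiableAt hp]
  refine Finset.sum_congr rfl fun i _ => ?_
  have h1 : EqOn (sd i (pd μ f)) (pd μ (sd i f)) (slab τ₀) := fun q hq => pd_comm hf _ _ hq
  exact (sd_congr h1 i hp).trans (pd_comm (hf.sd i) _ _ hp)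

lemma pd_add_on (hf : SlabSmooth τ₀ f) (hg : SlabSmooth τ₀ g) (μ : Fin 4) :
    EqOn (pd μ fun p => f p + g p) (fun p => pd μ f p + pd μ g p) (slab τ₀) := fun _ hp =>
  pd_add (hf.differentiableAt hp) (hg.differentiableAt hp)

lemma pd_const_mul_on (hf : SlabSmooth τ₀ f) (c : ℝ) (μ : Fin 4) :
    EqOn (pd μ fun p => c * f p) (fun p => c * pd μ f p) (slab τ₀) := fun _ hp =>
  pd_const_mul (hf.differentiableAt hp)

lemma pd_pd_add_on (hf : SlabSmooth τ₀ f) (hg : SlabSmooth τ₀ g) (μ ν : Fin 4) :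
    EqOn (pd μ (pd ν fun p => f p + g p)) (fun p => pd μ (pd ν f) p + pd μ (pd ν g) p)
      (slab τ₀) := fun _ hp =>
  (pd_congr (pd_add_on hf hg ν) μ hp).trans (pd_add_on (hf.pd ν) (hg.pd ν) μ hp)

lemma pd_pd_const_mul_on (hf : SlabSmooth τ₀ f) (c : ℝ) (μ ν : Fin 4) :
    EqOn (pd μ (pd ν fun p => c * f p)) (fun p => c * pd μ (pd ν f) p) (slab τ₀) := fun _ hp =>
  (pd_congr (pd_const_mul_on hf c ν) μ hp).trans (pd_const_mul_on (hf.pd ν) c μ hp)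

lemma lap_add_on (hf : SlabSmooth τ₀ f) (hg : SlabSmooth τ₀ g) :
    EqOn (lap fun p => f p + g p) (fun p => lap f p + lap g p) (slab τ₀) := fun p hp => by
  simp only [lap, sd_eq_pd, ← Finset.sum_add_distrib]
  exact Finset.sum_congr rfl fun i _ => pd_pd_add_on hf hg _ _ hp

lemma lap_const_mul_on (hf : SlabSmooth τ₀ f) (c : ℝ) :
    EqOn (lap fun p => c * f p) (fun p => c * lap f p) (slab τ₀) := fun p hp => by
  simp only [lap, sd_eq_pd, Finset.mul_sum]
  exact Finset.sum_congr rfl fun i _ => pd_pd_const_mul_on hf c _ _ hp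

/-- The operator `f'' + 2 H f' - Δ f`. -/
def box (H : ℝ → ℝ) (f : Spacetime → ℝ) : Spacetime → ℝ := fun p =>
  pd 0 (pd 0 f) p + 2 * H p.1 * pd 0 f p - lap f p

variable {H : ℝ → ℝ}

lemma slabSmooth_box (hH : ContDiffOn ℝ ∞ H (Ioo τ₀ 0)) (hf : SlabSmooth τ₀ f) :
    SlabSmooth τ₀ (box H f) :=
  (((hf.pd 0).pd 0).add ((contDiffOn_const.mul (slabSmooth_of_time hH)).mul (hf.pd 0))).sub hf.lap

lemma box_congr (h : EqOn f g (slab τ₀)) : EqOn (box H f) (box H g) (slab τ₀) := fun p hp => by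
  simp only [box, pd_congr h 0 hp, pd_congr (pd_congr h 0) 0 hp, lap_congr h hp]

lemma box_add_on (hf : SlabSmooth τ₀ f) (hg : SlabSmooth τ₀ g) :
    EqOn (box H fun p => f p + g p) (fun p => box H f p + box H g p) (slab τ₀) := fun p hp => by
  simp only [box, pd_pd_add_on hf hg 0 0 hp, pd_add_on hf hg 0 hp, lap_add_on hf hg hp]
  ring

lemma box_const_mul_on (hf : SlabSmooth τ₀ f) (c : ℝ) :
    EqOn (box H fun p => c * f p) (fun p => c * box H f p) (slab τ₀) := fun p hp => by
  simp only [box, pd_pd_const_mul_on hf c 0 0 hp, pd_const_mul_on hf c 0 hp,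
    lap_const_mul_on hf c hp]
  ring

/-- Any smooth `f` solves the wave equation with source `box H f`, so the commutation is an instance
of `IsWaveSolution.sd`. -/
lemma box_sd (hH : ContDiffOn ℝ ∞ H (Ioo τ₀ 0)) (hf : SlabSmooth τ₀ f) (i : Fin 3) :
    EqOn (box H (sd i f)) (sd i (box H f)) (slab τ₀) :=
  ((⟨hf, slabSmooth_box hH hf, fun _ _ => rfl⟩ : IsWaveSolution τ₀ H f (box H f)).sd hH i).eq

lemma box_sd_sd (hH : ContDiffOn ℝ ∞ H (Ioo τ₀ 0)) (hf : SlabSmooth τ₀ f) (i j : Fin 3) :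
    EqOn (box H (sd i (sd j f))) (sd i (sd j (box H f))) (slab τ₀) := fun _ hp =>
  (box_sd hH (hf.sd j) i hp).trans (sd_congr (box_sd hH hf j) i hp)

lemma box_lap (hH : ContDiffOn ℝ ∞ H (Ioo τ₀ 0)) (hf : SlabSmooth τ₀ f) :
    EqOn (box H (lap f)) (lap (box H f)) (slab τ₀) := fun p hp => by
  have h (i : Fin 3) := (hf.sd i).sd i
  have e : lap f = fun p => sd 0 (sd 0 f) p + (sd 1 (sd 1 f) p + sd 2 (sd 2 f) p) := by
    funext p; simp [lap, Fin.sum_univ_three, add_assoc]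
  rw [e, box_add_on (h 0) ((h 1).add (h 2)) hp]
  simp only [box_add_on (h 1) (h 2) hp, box_sd_sd hH hf _ _ hp]
  simp [lap, Fin.sum_univ_three, add_assoc]

lemma IsDecaying.box (hf : IsDecaying τ₀ f) : TendsToZeroAtInfinity τ₀ (box H f) := by
  refine ((((hf.pd 0).pd 0).tendsToZero.add
    ((hf.pd 0).tendsToZero.time_mul fun t => 2 * H t)).add
    (hf.lap.tendsToZero.const_mul (-1))).congr fun p _ => ?_
  simp only [DustPert.box]; ring

end operators

end

end DustPert

namespace DustPert

noncomputable section

/-! ### Scalar, vector and tensor parts of a linearized solution -/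

/-- Linearized mass conservation: `ρ₁/ρ + T/2` does not depend on time, and `D` is one third of it.
-/
lemma exists_time_indep_density {Λ τ₀ : ℝ} {a ρ : ℝ → ℝ} (hτ₀ : τ₀ < 0)
    (h : IsDustBackground Λ τ₀ a ρ) {γ : Spacetime → Matrix (Fin 3) (Fin 3) ℝ}
    {ρ₁ : Spacetime → ℝ} (hγ : ∀ i j, SlabSmooth τ₀ (comp γ i j))
    (hsym : ∀ p ∈ slab τ₀, (γ p).IsSymm) (hE : SolvesLinearizedEinstein Λ τ₀ a ρ γ ρ₁) :
    ∃ D : Space → ℝ, ∀ τ ∈ Ioo τ₀ 0, ∀ x,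
      ρ₁ (τ, x) = ρ τ * (3 * D x - trace₁ γ (τ, x) / 2) := by
  obtain ⟨ρ₀, hρ₀, hρ⟩ := h.exists_density hτ₀
  obtain ⟨τ₁, h₁⟩ : (Ioo τ₀ 0).Nonempty := nonempty_Ioo.2 hτ₀
  -- This is `ρ₁/ρ + T/2` with `ρ₁` replaced by the constraint and `ρ` by `ρ₀ a⁻³`;
  -- differentiability in time is then available without assuming it of `ρ₁`.
  set Q : ℝ → Space → ℝ := fun t x =>
    a t * (hubble a t * pd 0 (trace₁ γ) (t, x) + 1 / 2 * curvature₁ γ (t, x)) / ρ₀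
      + trace₁ γ (t, x) / 2 with hQ
  have hT := slabSmooth_trace hγ
  have hQd (x : Space) (t : ℝ) (ht : t ∈ Ioo τ₀ 0) : HasDerivAt (fun t => Q t x) 0 t := by
    have hp := mk_mem_slab ht x
    have d1 := hasDerivAt_time (hT.differentiableAt hp)
    have d2 := hasDerivAt_time ((hT.pd 0).differentiableAt hp)
    have d3 := hasDerivAt_time ((slabSmooth_curvature hγ).differentiableAt hp)
    rw [pd_zero_curvature h hγ hsym hE hp] at d3
    have d := (((h.hasDerivAt_scale ht).mul (((h.hasDerivAt_hubble ht).mul d2).add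
      (d3.const_mul (1 / 2)))).div_const ρ₀).add (d1.div_const 2)
    refine d.congr_deriv ?_
    have e1 := (linearized_system h hγ hsym hE hp).2.1
    have e2 := (h.friedmann ht).1
    have ha := (h.a_pos t ht).ne'
    -- After inserting the equations for `H'` and `T''`, the derivative of the first summand of `Q`
    -- is `-a T' (3 H² - Λ a²) / (2 ρ₀)`. The Friedmann equation turns it into `-T'/2`, which
    -- cancels the second summand.
    have e3 : a t ^ 3 * (3 * hubble a t ^ 2 - a t ^ 2 * Λ) = a t ^ 2 * ρ₀ := by
      rw [e2, hρ t ht]; field_simp; ring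
    have e4 : a t * (3 * hubble a t ^ 2 - a t ^ 2 * Λ) = ρ₀ := by
      have : a t ^ 2 ≠ 0 := pow_ne_zero 2 ha
      apply mul_left_cancel₀ this
      linear_combination e3
    simp only [Pi.add_apply, Pi.mul_apply]
    dsimp only at e1
    have e5 : pd 0 (pd 0 (trace₁ γ)) (t, x) = -(1 / 2) * curvature₁ γ (t, x)
        - 2 * hubble a t * pd 0 (trace₁ γ) (t, x) := by linear_combination e1
    rw [e5]
    field_simp
    linear_combination (-pd 0 (trace₁ γ) (t, x)) * e4
  refine ⟨fun x => Q τ₁ x / 3, fun τ hτ x => ?_⟩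
  have hconst : Q τ x = Q τ₁ x :=
    IsOpen.is_const_of_deriv_eq_zero isOpen_Ioo isPreconnected_Ioo (f := fun t => Q t x)
      (fun t ht => (hQd x t ht).differentiableAt.differentiableWithinAt)
      (fun t ht => (hQd x t ht).deriv) hτ h₁
  have e := (linearized_system h hγ hsym hE (mk_mem_slab hτ x)).1
  have ha := (h.a_pos τ hτ).ne'
  beta_reduce
  rw [← hconst]
  simp only [hQ]
  dsimp only at e
  rw [← e, hρ τ hτ]
  field_simp
  ring

namespace IsModeDecomposition
variable {τ₀ : ℝ} {φ χ : Spacetime → ℝ} {Z : Spacetime → Fin 3 → ℝ}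
  {π : Spacetime → Matrix (Fin 3) (Fin 3) ℝ}

/-- The coefficient of `δ_{ij}` in the mode decomposition. -/
def diagPart (φ χ : Spacetime → ℝ) : Spacetime → ℝ := fun p => (-2) * φ p + (-1 / 3) * lap χ p

/-- The potential of the scalar part of the momentum density. -/
def momentumPotential (φ χ : Spacetime → ℝ) : Spacetime → ℝ :=
  fun p => 4 * φ p + (2 / 3) * lap χ p

lemma comp_modeSum (i j : Fin 3) : comp (modeSum φ χ Z π) i j = fun p =>
    ((if i = j then 1 else 0) * diagPart φ χ p + sd i (sd j χ) p) +
      ((sd i (fun q => Z q j) p + sd j (fun q => Z q i) p) + π p i j) := by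
  funext p
  simp only [comp, modeSum, diagPart, Matrix.of_apply, Matrix.one_apply]
  ring

variable (hm : IsModeDecomposition τ₀ φ χ Z π)
include hm

lemma isDecaying_phi : IsDecaying τ₀ φ := ⟨hm.smooth_phi, hm.decay_phi⟩

lemma isDecaying_chi : IsDecaying τ₀ χ := ⟨hm.smooth_chi, hm.decay_chi⟩

lemma isDecaying_Z (i : Fin 3) : IsDecaying τ₀ (fun p => Z p i) := ⟨hm.smooth_Z i, hm.decay_Z i⟩

lemma isDecaying_diagPart : IsDecaying τ₀ (diagPart φ χ) :=
  (hm.isDecaying_phi.const_mul _).add (hm.isDecaying_chi.lap.const_mul _)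

lemma isDecaying_momentumPotential : IsDecaying τ₀ (momentumPotential φ χ) :=
  (hm.isDecaying_phi.const_mul _).add (hm.isDecaying_chi.lap.const_mul _)

lemma slabSmooth_scalarPart (i j : Fin 3) : SlabSmooth τ₀ (fun p =>
    (if i = j then 1 else 0) * diagPart φ χ p + sd i (sd j χ) p) :=
  (contDiffOn_const.mul hm.isDecaying_diagPart.smooth).add ((SlabSmooth.sd hm.smooth_chi j).sd i)

lemma slabSmooth_vectorPart (i j : Fin 3) : SlabSmooth τ₀ (fun p =>
    sd i (fun q => Z q j) p + sd j (fun q => Z q i) p) :=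
  (SlabSmooth.sd (hm.smooth_Z j) i).add (SlabSmooth.sd (hm.smooth_Z i) j)

lemma slabSmooth_comp (i j : Fin 3) : SlabSmooth τ₀ (comp (modeSum φ χ Z π) i j) := by
  rw [comp_modeSum]
  exact (hm.slabSmooth_scalarPart i j).add ((hm.slabSmooth_vectorPart i j).add (hm.smooth_pi i j))

lemma isSymm {p : Spacetime} (hp : p ∈ slab τ₀) : (modeSum φ χ Z π p).IsSymm := by
  refine Matrix.IsSymm.ext fun i j => ?_
  have h (i j : Fin 3) : modeSum φ χ Z π p i j = _ := congrFun (comp_modeSum i j) p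
  rw [h, h]
  have e1 : sd i (sd j χ) p = sd j (sd i χ) p := pd_comm hm.smooth_chi _ _ hp
  have e2 : π p i j = π p j i := (hm.symm_pi p hp).apply j i
  rw [e1, e2]
  simp only [eq_comm (a := i) (b := j)]
  ring

/-- Only the conformal part has a trace: the `χ` part is trace-free by construction, the `Z` part
because `Z` is divergence-free, and `π` by assumption. -/
lemma trace_eq : EqOn (trace₁ (modeSum φ χ Z π)) (fun p => (-6) * φ p) (slab τ₀) := fun p hp => by
  have h (i : Fin 3) : modeSum φ χ Z π p i i = _ := congrFun (comp_modeSum i i) p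
  simp only [trace₁, h]
  have e1 := hm.div_Z p hp
  have e2 := hm.trace_pi p hp
  simp only [Matrix.trace, Matrix.diag_apply, Fin.sum_univ_three] at e1 e2
  simp only [Fin.sum_univ_three, diagPart, lap, if_true]
  linear_combination 2 * e1 + e2

/-- The divergence gives `-2 ∂_j φ + (2/3) ∂_j Δχ + ΔZ_j`, and removing `∂_j T = -6 ∂_j φ` raises
the first coefficient to `4`. -/
lemma momentum_eq (j : Fin 3) : EqOn (momentum (modeSum φ χ Z π) j)
    (fun p => sd j (momentumPotential φ χ) p + lap (fun q => Z q j) p) (slab τ₀) := fun p hp => by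
  have hc := hm.smooth_chi
  have hcl : SlabSmooth τ₀ (lap χ) := SlabSmooth.lap hc
  have hd (k : Fin 3) : sd k (comp (modeSum φ χ Z π) k j) p =
      ((if k = j then 1 else 0) * sd k (diagPart φ χ) p + sd k (sd k (sd j χ)) p) +
      ((sd k (sd k fun q => Z q j) p + sd k (sd j fun q => Z q k) p) +
        sd k (fun q => π q k j) p) := by
    rw [comp_modeSum, sd_eq_pd,
      pd_add_on (hm.slabSmooth_scalarPart k j)
        ((hm.slabSmooth_vectorPart k j).add (hm.smooth_pi k j)) _ hp]
    beta_reduce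
    rw [pd_add_on (hm.slabSmooth_vectorPart k j) (hm.smooth_pi k j) _ hp]
    beta_reduce
    rw [pd_add_on (contDiffOn_const.mul hm.isDecaying_diagPart.smooth)
        ((SlabSmooth.sd hc j).sd k) _ hp]
    beta_reduce
    rw [pd_const_mul_on hm.isDecaying_diagPart.smooth _ _ hp]
    beta_reduce
    rw [pd_add_on (SlabSmooth.sd (hm.smooth_Z j) k) (SlabSmooth.sd (hm.smooth_Z k) j) _ hp]
    rfl
  have hU (k : Fin 3) : sd k (diagPart φ χ) p = (-2) * sd k φ p + (-1 / 3) * sd k (lap χ) p := by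
    unfold diagPart
    rw [sd_eq_pd, pd_add_on (contDiffOn_const.mul hm.smooth_phi) (contDiffOn_const.mul hcl) _ hp]
    beta_reduce
    rw [pd_const_mul_on hm.smooth_phi _ _ hp, pd_const_mul_on hcl _ _ hp]
    rfl
  have hS : sd j (momentumPotential φ χ) p = 4 * sd j φ p + (2 / 3) * sd j (lap χ) p := by
    unfold momentumPotential
    rw [sd_eq_pd, pd_add_on (contDiffOn_const.mul hm.smooth_phi) (contDiffOn_const.mul hcl) _ hp]
    beta_reduce
    rw [pd_const_mul_on hm.smooth_phi _ _ hp, pd_const_mul_on hcl _ _ hp]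
    rfl
  have htr : sd j (trace₁ (modeSum φ χ Z π)) p = (-6) * sd j φ p :=
    (sd_congr hm.trace_eq j hp).trans (pd_const_mul_on hm.smooth_phi _ _ hp)
  have hχ : ∑ k, sd k (sd k (sd j χ)) p = sd j (lap χ) p := lap_pd hc j.succ hp
  have hdiv : ∑ k, sd k (sd j fun q => Z q k) p = 0 := by
    have h1 (k : Fin 3) : sd k (sd j fun q => Z q k) p = sd j (sd k fun q => Z q k) p :=
      pd_comm (hm.smooth_Z k) _ _ hp
    simp only [h1]
    have h2 : EqOn (fun q => ∑ k, sd k (fun q => Z q k) q) (fun _ => 0) (slab τ₀) := hm.div_Z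
    have h3 := sd_congr h2 j hp
    rw [sd_eq_pd, sd_eq_pd, pd_const, pd_sum fun k _ =>
      (SlabSmooth.sd (hm.smooth_Z k) k).differentiableAt hp] at h3
    exact h3
  have hπ := hm.div_pi p hp j
  have hδ : ∑ k, (if k = j then (1 : ℝ) else 0) * sd k (diagPart φ χ) p =
      sd j (diagPart φ χ) p := by simp
  simp only [momentum, hd, Finset.sum_add_distrib]
  rw [hδ, hχ, hdiv, hπ, hU, hS, htr]
  simp only [lap]
  ring

lemma curvature_eq : EqOn (curvature₁ (modeSum φ χ Z π)) (lap (momentumPotential φ χ))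
    (slab τ₀) := fun p hp => by
  have h (j : Fin 3) : sd j (momentum (modeSum φ χ Z π) j) p =
      sd j (sd j (momentumPotential φ χ)) p + lap (sd j fun q => Z q j) p := by
    rw [sd_congr (hm.momentum_eq j) j hp, sd_eq_pd,
      pd_add_on (hm.isDecaying_momentumPotential.sd j).smooth (SlabSmooth.lap (hm.smooth_Z j)) _ hp]
    beta_reduce
    rw [← lap_pd (hm.smooth_Z j) _ hp]
    rfl
  have hdiv : ∑ j, lap (sd j fun q => Z q j) p = 0 := by
    have h0 : EqOn (fun q => sd 0 (fun q => Z q 0) q + (sd 1 (fun q => Z q 1) q +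
        sd 2 (fun q => Z q 2) q)) (fun _ => 0) (slab τ₀) := fun q hq => by
      have := hm.div_Z q hq
      simp only [Fin.sum_univ_three] at this
      linarith
    have hs (i : Fin 3) := SlabSmooth.sd (hm.smooth_Z i) i
    have h1 := lap_congr h0 hp
    rw [lap_add_on (hs 0) ((hs 1).add (hs 2)) hp] at h1
    beta_reduce at h1
    rw [lap_add_on (hs 1) (hs 2) hp] at h1
    have h2 : lap (fun _ : Spacetime => (0 : ℝ)) p = 0 := by
      have h3 (i : Fin 3) : sd i (fun _ : Spacetime => (0 : ℝ)) = fun _ => 0 :=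
        funext fun q => pd_const _ _ _
      simp only [lap, h3]; simp
    rw [h2] at h1
    simp only [Fin.sum_univ_three]
    linarith
  simp only [curvature₁, h, Finset.sum_add_distrib, hdiv, add_zero]
  rfl

variable {Λ : ℝ} {a ρ : ℝ → ℝ} {ρ₁ : Spacetime → ℝ} (h : IsDustBackground Λ τ₀ a ρ)
  (hE : SolvesLinearizedEinstein Λ τ₀ a ρ (modeSum φ χ Z π) ρ₁)
include h hE

/-- The scalar curvature perturbation is `ΔS` and does not depend on time, so `S'` is harmonic and
decaying, hence zero. The same argument applied to the momentum density then gives `pd_zero_Z`. -/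
lemma pd_zero_momentumPotential {p : Spacetime} (hp : p ∈ slab τ₀) :
    pd 0 (momentumPotential φ χ) p = 0 := by
  have hS := hm.isDecaying_momentumPotential
  refine eq_zero_of_harmonic (hS.pd 0).smooth (fun q hq => ?_) (hS.pd 0).tendsToZero hp
  rw [lap_pd hS.smooth 0 hq, ← pd_congr hm.curvature_eq 0 hq]
  exact pd_zero_curvature h hm.slabSmooth_comp (fun _ => hm.isSymm) hE hq

lemma pd_zero_Z (i : Fin 3) {p : Spacetime} (hp : p ∈ slab τ₀) :
    pd 0 (fun q => Z q i) p = 0 := by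
  have hS := hm.isDecaying_momentumPotential
  have hZ := hm.isDecaying_Z i
  refine eq_zero_of_harmonic (hZ.pd 0).smooth (fun q hq => ?_) (hZ.pd 0).tendsToZero hp
  have h1 := pd_zero_momentum h hm.slabSmooth_comp (fun _ => hm.isSymm) hE i hq
  rw [pd_congr (hm.momentum_eq i) 0 hq, pd_add_on (hS.sd i).smooth hZ.lap.smooth 0 hq] at h1
  have h2 : pd 0 (sd i (momentumPotential φ χ)) q = 0 := by
    rw [sd_eq_pd, pd_comm hS.smooth _ _ hq,
      pd_congr (g := fun _ => 0) (fun r hr => hm.pd_zero_momentumPotential h hE hr) _ hq, pd_const]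
  rw [lap_pd hZ.smooth 0 hq]
  linarith

lemma box_Z (i : Fin 3) : EqOn (box (hubble a) fun q => Z q i)
    (fun p => (-1) * lap (fun q => Z q i) p) (slab τ₀) := fun p hp => by
  have h1 : EqOn (pd 0 fun q => Z q i) (fun _ => 0) (slab τ₀) := fun q hq => hm.pd_zero_Z h hE i hq
  simp only [box, pd_congr h1 0 hp, h1 hp, pd_const]
  ring

/-- The wave operator maps the tensor part to a tensor built from two scalars. -/
lemma box_pi_eq (i j : Fin 3) {p : Spacetime} (hp : p ∈ slab τ₀) :
    box (hubble a) (fun q => π q i j) p =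
      sd i (sd j fun q => (6 * φ q + (-2) * momentumPotential φ χ q)
        + (-1) * box (hubble a) χ q) p
      + (if i = j then 1 else 0) * ((1 / 2) * lap (momentumPotential φ χ) p
        + (-1) * box (hubble a) (diagPart φ χ) p) := by
  have hH := contDiffOn_hubble h.smooth h.a_pos
  have hS := hm.isDecaying_momentumPotential.smooth
  have hU := hm.isDecaying_diagPart.smooth
  have hχ := hm.smooth_chi
  have hφ := hm.smooth_phi
  have hbχ := slabSmooth_box hH hχ
  have hw := (linearized_system h hm.slabSmooth_comp (fun _ => hm.isSymm) hE hp).2.2 i j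
  change box (hubble a) (comp (modeSum φ χ Z π) i j) p = _ at hw
  rw [comp_modeSum, box_add_on (hm.slabSmooth_scalarPart i j)
    ((hm.slabSmooth_vectorPart i j).add (hm.smooth_pi i j)) hp] at hw
  beta_reduce at hw
  rw [box_add_on (hm.slabSmooth_vectorPart i j) (hm.smooth_pi i j) hp] at hw
  beta_reduce at hw
  rw [box_add_on (SlabSmooth.sd (hm.smooth_Z j) i) (SlabSmooth.sd (hm.smooth_Z i) j) hp] at hw
  beta_reduce at hw
  rw [box_add_on (contDiffOn_const.mul hU) ((SlabSmooth.sd hχ j).sd i) hp] at hw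
  beta_reduce at hw
  rw [box_const_mul_on hU _ hp] at hw
  -- `Z` does not depend on time, so the operator reduces to `-Δ` on it. This cancels exactly the
  -- vector part of the source.
  have hZ (i j : Fin 3) : box (hubble a) (sd i fun q => Z q j) p =
      (-1) * sd i (lap fun q => Z q j) p := by
    rw [box_sd hH (hm.smooth_Z j) i hp, sd_congr (hm.box_Z h hE j) i hp]
    exact pd_const_mul_on (SlabSmooth.lap (hm.smooth_Z j)) _ _ hp
  have hV (i j : Fin 3) : sd i (momentum (modeSum φ χ Z π) j) p =
      sd i (sd j (momentumPotential φ χ)) p + sd i (lap fun q => Z q j) p := by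
    rw [sd_congr (hm.momentum_eq j) i hp]
    exact pd_add_on (hS.sd j) (SlabSmooth.lap (hm.smooth_Z j)) _ hp
  have ht : sd i (sd j (trace₁ (modeSum φ χ Z π))) p = (-6) * sd i (sd j φ) p :=
    (sd_congr (sd_congr hm.trace_eq j) i hp).trans (pd_pd_const_mul_on hφ _ _ _ hp)
  have hSs : sd j (sd i (momentumPotential φ χ)) p = sd i (sd j (momentumPotential φ χ)) p :=
    pd_comm hS _ _ hp
  have hA : sd i (sd j fun q => (6 * φ q + (-2) * momentumPotential φ χ q)
        + (-1) * box (hubble a) χ q) p = (6 * sd i (sd j φ) p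
        + (-2) * sd i (sd j (momentumPotential φ χ)) p)
        + (-1) * sd i (sd j (box (hubble a) χ)) p := by
    have h6 : SlabSmooth τ₀ fun q => 6 * φ q := contDiffOn_const.mul hφ
    have h2 : SlabSmooth τ₀ fun q => (-2) * momentumPotential φ χ q := contDiffOn_const.mul hS
    have h1 : SlabSmooth τ₀ fun q => (-1) * box (hubble a) χ q := contDiffOn_const.mul hbχ
    simp only [sd_eq_pd]
    rw [pd_pd_add_on (h6.add h2) h1 _ _ hp]
    beta_reduce
    rw [pd_pd_add_on h6 h2 _ _ hp]
    beta_reduce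
    rw [pd_pd_const_mul_on hφ _ _ _ hp, pd_pd_const_mul_on hS _ _ _ hp,
      pd_pd_const_mul_on hbχ _ _ _ hp]
  rw [hA]
  simp only [waveSource] at hw
  rw [hV, hV, ht, hm.curvature_eq hp, hSs, hZ, hZ, box_sd_sd hH hχ i j hp] at hw
  split_ifs at hw ⊢ <;> linear_combination hw

/-- The tensor part satisfies the source-free wave equation. -/
lemma box_pi (i j : Fin 3) {p : Spacetime} (hp : p ∈ slab τ₀) :
    box (hubble a) (fun q => π q i j) p = 0 := by
  have hH := contDiffOn_hubble h.smooth h.a_pos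
  have hS := hm.isDecaying_momentumPotential
  have hU := hm.isDecaying_diagPart
  have hbχ := slabSmooth_box hH hm.smooth_chi
  set A : Spacetime → ℝ := fun q => (6 * φ q + (-2) * momentumPotential φ χ q)
        + (-1) * box (hubble a) χ q with hA
  set B : Spacetime → ℝ := fun q => (1 / 2) * lap (momentumPotential φ χ) q
        + (-1) * box (hubble a) (diagPart φ χ) q with hB
  have hAs : SlabSmooth τ₀ A := ((contDiffOn_const.mul hm.smooth_phi).add
    (contDiffOn_const.mul hS.smooth)).add (contDiffOn_const.mul hbχ)
  have hBs : SlabSmooth τ₀ B := (contDiffOn_const.mul hS.lap.smooth).add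
    (contDiffOn_const.mul (slabSmooth_box hH hU.smooth))
  have hE' (i j : Fin 3) : EqOn (box (hubble a) fun q => π q i j)
      (fun p => sd i (sd j A) p + (if i = j then 1 else 0) * B p) (slab τ₀) :=
    fun q hq => hm.box_pi_eq h hE i j hq
  have hA0 : TendsToZeroAtInfinity τ₀ A :=
    ((hm.isDecaying_phi.const_mul _).add (hS.const_mul _)).tendsToZero.add
      (hm.isDecaying_chi.box.const_mul _)
  have hLA0 : TendsToZeroAtInfinity τ₀ (lap A) := by
    refine (((((hm.isDecaying_phi.lap.const_mul 6).add (hS.lap.const_mul (-2))).tendsToZero.add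
      (hm.isDecaying_chi.lap.box (H := hubble a) |>.const_mul (-1))))).congr fun q hq => ?_
    have h6 : SlabSmooth τ₀ fun q => 6 * φ q := contDiffOn_const.mul hm.smooth_phi
    have h2 : SlabSmooth τ₀ fun q => (-2) * momentumPotential φ χ q :=
      contDiffOn_const.mul hS.smooth
    have h1 : SlabSmooth τ₀ fun q => (-1) * box (hubble a) χ q := contDiffOn_const.mul hbχ
    rw [hA, lap_add_on (h6.add h2) h1 hq]
    beta_reduce
    rw [lap_add_on h6 h2 hq]
    beta_reduce
    rw [lap_const_mul_on hm.smooth_phi _ hq, lap_const_mul_on hS.smooth _ hq,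
      lap_const_mul_on hbχ _ hq]
    beta_reduce
    rw [← box_lap hH hm.smooth_chi hq]
  -- The operator is applied to the vanishing trace of `π`. Zero is written as `0 * φ` so that
  -- linearity of `box` handles it.
  have htr : ∀ q ∈ slab τ₀, lap A q + 3 * B q = 0 := fun q hq => by
    have h0 : EqOn (fun p => π p 0 0 + (π p 1 1 + π p 2 2)) (fun p => 0 * φ p) (slab τ₀) :=
      fun r hr => by
        have := hm.trace_pi r hr
        simp only [Matrix.trace, Matrix.diag_apply, Fin.sum_univ_three] at this
        linarith
    have h1 := box_congr (H := hubble a) h0 hq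
    rw [box_const_mul_on hm.smooth_phi _ hq, box_add_on (hm.smooth_pi 0 0)
      ((hm.smooth_pi 1 1).add (hm.smooth_pi 2 2)) hq] at h1
    beta_reduce at h1
    rw [box_add_on (hm.smooth_pi 1 1) (hm.smooth_pi 2 2) hq] at h1
    simp only [hE' _ _ hq] at h1
    simp only [lap, Fin.sum_univ_three]
    simp only [if_true] at h1
    linarith
  -- The same for the vanishing divergence of `π`.
  have hdiv (j : Fin 3) : ∀ q ∈ slab τ₀, sd j (lap A) q + sd j B q = 0 := fun q hq => by
    have h0 : EqOn (fun p => sd 0 (fun q => π q 0 j) p + (sd 1 (fun q => π q 1 j) p +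
        sd 2 (fun q => π q 2 j) p)) (fun p => 0 * φ p) (slab τ₀) := fun r hr => by
      have := hm.div_pi r hr j
      simp only [Fin.sum_univ_three] at this
      linarith
    have hs (k : Fin 3) := SlabSmooth.sd (hm.smooth_pi k j) k
    have h1 := box_congr (H := hubble a) h0 hq
    rw [box_const_mul_on hm.smooth_phi _ hq, box_add_on (hs 0) ((hs 1).add (hs 2)) hq] at h1
    beta_reduce at h1
    rw [box_add_on (hs 1) (hs 2) hq] at h1
    have h2 (k : Fin 3) : box (hubble a) (sd k fun q => π q k j) q =
        sd k (sd k (sd j A)) q + (if k = j then 1 else 0) * sd k B q := by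
      rw [box_sd hH (hm.smooth_pi k j) k hq, sd_congr (hE' k j) k hq, sd_eq_pd,
        pd_add_on ((hAs.sd j).sd k) (contDiffOn_const.mul hBs) _ hq]
      beta_reduce
      rw [pd_const_mul_on hBs _ _ hq]
      rfl
    beta_reduce at h1
    rw [h2, h2, h2] at h1
    have h3 : sd j (lap A) q = ∑ k, sd k (sd k (sd j A)) q := (lap_pd hAs j.succ hq).symm
    rw [h3]
    simp only [Fin.sum_univ_three]
    fin_cases j <;> simp at h1 ⊢ <;> linarith
  -- Differentiating the trace identity and comparing with the divergence identity eliminates `B`.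
  -- Thus `ΔA` is harmonic and decaying, and Liouville's theorem applies to `ΔA` and then to `A`.
  have hdLA (j : Fin 3) : EqOn (sd j (lap A)) (fun _ => 0) (slab τ₀) := fun q hq => by
    have h0 : EqOn (fun p => lap A p + 3 * B p) (fun _ => 0) (slab τ₀) := htr
    have h1 := sd_congr h0 j hq
    rw [sd_eq_pd, sd_eq_pd, pd_add_on hAs.lap (contDiffOn_const.mul hBs) _ hq] at h1
    beta_reduce at h1
    rw [pd_const_mul_on hBs _ _ hq, pd_const] at h1
    have h2 := hdiv j q hq
    simp only [sd_eq_pd] at h2 ⊢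
    linarith
  have hLA : ∀ q ∈ slab τ₀, lap A q = 0 := fun q hq => by
    refine eq_zero_of_harmonic hAs.lap (fun r hr => ?_) hLA0 hq
    rw [lap]
    refine Finset.sum_eq_zero fun k _ => ?_
    rw [sd_congr (hdLA k) k hr]
    exact pd_const _ _ _
  have hAz : EqOn A (fun _ => 0) (slab τ₀) := fun q hq => eq_zero_of_harmonic hAs hLA hA0 hq
  have hBz : B p = 0 := by
    have := htr p hp
    rw [hLA p hp] at this
    linarith
  rw [hE' i j hp]
  beta_reduce
  rw [hBz, sd_congr (sd_congr hAz j) i hp]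
  have h3 : sd j (fun _ : Spacetime => (0 : ℝ)) = fun _ => 0 := funext fun q => pd_const _ _ _
  rw [h3, sd_eq_pd, pd_const]
  ring

end IsModeDecomposition

/-- The modes of a solution of the linearized Einstein equations. -/
theorem modes_asymptotics {Λ τ₀ : ℝ} (hΛ : 0 < Λ) (hτ₀ : τ₀ < 0) {a ρ : ℝ → ℝ}
    (h : IsDustBackground Λ τ₀ a ρ) {φ χ : Spacetime → ℝ} {Z : Spacetime → Fin 3 → ℝ}
    {π : Spacetime → Matrix (Fin 3) (Fin 3) ℝ} {ρ₁ : Spacetime → ℝ}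
    (hm : IsModeDecomposition τ₀ φ χ Z π)
    (hE : SolvesLinearizedEinstein Λ τ₀ a ρ (modeSum φ χ Z π) ρ₁) :
    (∃ D : Space → ℝ,
      (∀ τ ∈ Ioo τ₀ 0, ∀ x, ρ₁ (τ, x) = 3 * ρ τ * (φ (τ, x) + D x)) ∧
      ∀ x, ScalarModeEq τ₀ a ρ (fun τ => φ (τ, x) + D x)) ∧
    (∀ i, ∀ p ∈ slab τ₀, pd 0 (fun q => Z q i) p = 0) ∧
    (∀ i j, TensorModeEq τ₀ a (fun p => π p i j)) ∧
    TendsToConstantInTime φ ∧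
    (∀ i, TendsToConstantInTime (fun p => Z p i)) ∧
    (∀ i j, TendsToConstantInTime (fun p => π p i j)) := by
  have hγ := hm.slabSmooth_comp
  have hsym : ∀ p ∈ slab τ₀, (modeSum φ χ Z π p).IsSymm := fun _ => hm.isSymm
  have hH := contDiffOn_hubble h.smooth h.a_pos
  have hH0 : ∀ τ ∈ Ioo τ₀ 0, 0 ≤ hubble a τ := fun τ hτ => (h.hubble_pos hΛ hτ).le
  have hsys {p : Spacetime} (hp : p ∈ slab τ₀) := linearized_system h hγ hsym hE hp
  have ht {p : Spacetime} (hp : p ∈ slab τ₀) :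
      pd 0 (trace₁ (modeSum φ χ Z π)) p = (-6) * pd 0 φ p :=
    (pd_congr hm.trace_eq 0 hp).trans (pd_const_mul_on hm.smooth_phi _ _ hp)
  have htt {p : Spacetime} (hp : p ∈ slab τ₀) :
      pd 0 (pd 0 (trace₁ (modeSum φ χ Z π))) p = (-6) * pd 0 (pd 0 φ) p :=
    (pd_congr (pd_congr hm.trace_eq 0) 0 hp).trans (pd_pd_const_mul_on hm.smooth_phi _ _ _ hp)
  have hπ0 (i j) (p) (hp : p ∈ slab τ₀) : box (hubble a) (fun q => π q i j) p = 0 :=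
    hm.box_pi h hE i j hp
  refine ⟨?_, fun i p hp => hm.pd_zero_Z h hE i hp, fun i j => ⟨?_, fun p hp => ?_⟩, ?_,
    fun i => ?_, fun i j => ?_⟩
  · obtain ⟨D, hD⟩ := exists_time_indep_density hτ₀ h hγ hsym hE
    have hD' : ∀ τ ∈ Ioo τ₀ 0, ∀ x, ρ₁ (τ, x) = 3 * ρ τ * (φ (τ, x) + D x) := fun τ hτ x => by
      rw [hD τ hτ x, hm.trace_eq (mk_mem_slab hτ x)]; ring
    refine ⟨D, hD', fun x => ⟨?_, fun τ hτ => ?_⟩⟩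
    · exact ((SlabSmooth.timeSlice hm.smooth_phi x).add contDiffOn_const).of_le
        (WithTop.coe_le_coe.2 le_top)
    · have hp := mk_mem_slab hτ x
      have e1 : deriv (fun τ => φ (τ, x) + D x) = deriv fun τ => φ (τ, x) :=
        funext fun t => deriv_add_const _
      rw [e1, deriv_deriv_time hm.smooth_phi hτ, deriv_time hm.smooth_phi hτ]
      -- With `T = -6 φ`, eliminating the curvature between the constraint and the trace equation
      -- leaves the scalar equation.
      have e2 := (hsys hp).1
      have e3 := (hsys hp).2.1
      rw [hD' τ hτ x] at e2
      rw [ht hp] at e2 e3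
      rw [htt hp] at e3
      simp only [hubble, smul_eq_mul] at e2 e3 ⊢
      linear_combination (-1 / 6) * e3 - (1 / 6) * e2
  · exact (hm.smooth_pi i j).of_le (WithTop.coe_le_coe.2 le_top)
  · have := hπ0 i j p hp
    simp only [box, hubble, smul_eq_mul] at this ⊢
    linear_combination this
  -- The trace equation reads `φ'' + 2 H φ' = W/12` with `W` constant in time.
  · refine tendsToConstantInTime_of_bddNear hτ₀ hm.smooth_phi
      (bddNear_pd_of_damped hH0 hm.smooth_phi
        ((bddNear_of_time_indep (slabSmooth_curvature hγ)
          fun p hp => pd_zero_curvature h hγ hsym hE hp).const_mul (1 / 12)) fun p hp => ?_)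
    have e3 := (hsys hp).2.1
    rw [ht hp, htt hp] at e3
    linear_combination (-1 / 6) * e3
  · refine tendsToConstantInTime_of_bddNear hτ₀ (hm.smooth_Z i) fun τ₁ h₁ r =>
      ⟨0, fun τ hτ x _ => ?_⟩
    rw [hm.pd_zero_Z h hE i (mk_mem_slab (Ico_sub_Ioo h₁ hτ) x), abs_zero]
  · have hw : IsWaveSolution τ₀ (hubble a) (fun q => π q i j) (fun _ => 0) :=
      ⟨hm.smooth_pi i j, contDiffOn_const, hπ0 i j⟩
    exact hw.tendsToConstantInTime hτ₀ hH hH0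
      (allBddNear_of_time_indep contDiffOn_const fun p _ => pd_const _ _ _)

end

end DustPert

namespace DustPert

noncomputable section

/-! ### Arbitrary solutions of the mode equations -/

section modes
variable {Λ τ₀ : ℝ} {a ρ : ℝ → ℝ}

/-- Solutions of the scalar equation become constant in time. -/
theorem scalarMode_tendsToConstantInTime (hΛ : 0 < Λ) (hτ₀ : τ₀ < 0)
    (h : IsDustBackground Λ τ₀ a ρ) {φ : Spacetime → ℝ} (hφ : SlabSmooth τ₀ φ)
    (heq : ∀ x, ScalarModeEq τ₀ a ρ (fun τ => φ (τ, x))) : TendsToConstantInTime φ := by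
  obtain ⟨ρ₀, hρ₀, hρ⟩ := h.exists_density hτ₀
  refine tendsToConstantInTime_of_bddNear hτ₀ hφ (bddNear_pd_of_scalar (H := hubble a)
    (c := fun τ => (1 / 2) * a τ ^ 2 * ρ τ) (fun τ hτ => (h.hubble_pos hΛ hτ).le)
    (fun τ₁ h₁ => ⟨1 / 2 * ρ₀ / a τ₁, fun τ hτ => ?_⟩) hφ fun p hp => ?_)
  · have hτI := Ico_sub_Ioo h₁ hτ
    have h1 := h.a_pos τ₁ h₁
    have h2 := h.a_pos τ hτI
    have h3 : a τ₁ ≤ a τ := h.monotoneOn_scale hΛ h₁ hτI hτ.1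
    -- Dust dilutes like `a⁻³` and `a` is nondecreasing, so the potential never exceeds its value at
    -- `τ₁`.
    have h4 : (1 / 2) * a τ ^ 2 * ρ τ = 1 / 2 * ρ₀ / a τ := by
      rw [hρ τ hτI]; field_simp
    rw [h4, abs_of_pos (by positivity)]
    gcongr
  · have := (heq p.2).2 p.1 hp.1
    rw [deriv_deriv_time hφ hp.1, deriv_time hφ hp.1] at this
    simp only [smul_eq_mul] at this
    simp only [hubble]
    linear_combination this

/-- Solutions of the tensor equation become constant in time. -/
theorem tensorMode_tendsToConstantInTime (hΛ : 0 < Λ) (hτ₀ : τ₀ < 0)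
    (h : IsDustBackground Λ τ₀ a ρ) {π : Spacetime → ℝ} (hπ : SlabSmooth τ₀ π)
    (heq : TensorModeEq τ₀ a π) : TendsToConstantInTime π := by
  have hw : IsWaveSolution τ₀ (hubble a) π (fun _ => 0) :=
    ⟨hπ, contDiffOn_const, fun p hp => by simpa [hubble] using heq.2 p hp⟩
  exact hw.tendsToConstantInTime hτ₀ (contDiffOn_hubble h.smooth h.a_pos)
    (fun τ hτ => (h.hubble_pos hΛ hτ).le)
    (allBddNear_of_time_indep contDiffOn_const fun p _ => pd_const _ _ _)

/-- Solutions of the vector equation decay like `1 / a`. -/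
theorem vectorMode_asymptotics (hτ₀ : τ₀ < 0) (h : IsDustBackground Λ τ₀ a ρ)
    {Z : Spacetime → Fin 3 → ℝ} (hZ : ContDiffOn ℝ ∞ Z (slab τ₀))
    (heq : ∀ x, VectorModeEq τ₀ a (fun τ => Z (τ, x))) :
    (∃ C : Space → Fin 3 → ℝ, ContDiff ℝ ∞ C ∧
      ∀ τ ∈ Ioo τ₀ 0, ∀ x, Z (τ, x) = (a τ)⁻¹ • C x) ∧
    TendstoLocallyUniformly (fun (τ : ℝ) (x : Space) => Z (τ, x)) 0 (𝓝[<] 0) := by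
  obtain ⟨τ₁, h₁⟩ : (Ioo τ₀ 0).Nonempty := nonempty_Ioo.2 hτ₀
  have hd (x : Space) (t : ℝ) (ht : t ∈ Ioo τ₀ 0) :
      HasDerivAt (fun t => a t • Z (t, x)) 0 t := by
    have d1 : HasDerivAt (fun t => Z (t, x)) (deriv (fun t => Z (t, x)) t) t :=
      (((heq x).1.contDiffAt (isOpen_Ioo.mem_nhds ht)).differentiableAt (by simp)).hasDerivAt
    refine ((h.hasDerivAt_scale ht).smul d1).congr_deriv ?_
    have e := (heq x).2 t ht
    rw [show a t • deriv (fun t => Z (t, x)) t + (hubble a t * a t) • Z (t, x) =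
      a t • (deriv (fun t => Z (t, x)) t + (deriv a t / a t) • Z (t, x)) by
        rw [smul_add, smul_smul, hubble, mul_comm (a t) (deriv a t / a t)], e, smul_zero]
  set C : Space → Fin 3 → ℝ := fun x => a τ₁ • Z (τ₁, x)
  have hCs : ContDiff ℝ ∞ C := by
    have h1 : ContDiff ℝ ∞ fun x : Space => Z (τ₁, x) := by
      rw [← contDiffOn_univ]
      exact ContDiffOn.comp hZ (t := slab τ₀) (contDiff_prodMk_right τ₁).contDiffOn
        fun x _ => mk_mem_slab h₁ x
    exact h1.const_smul (a τ₁)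
  have hform : ∀ τ ∈ Ioo τ₀ 0, ∀ x, Z (τ, x) = (a τ)⁻¹ • C x := fun τ hτ x => by
    have hconst : a τ • Z (τ, x) = a τ₁ • Z (τ₁, x) :=
      IsOpen.is_const_of_deriv_eq_zero isOpen_Ioo isPreconnected_Ioo
        (f := fun t => a t • Z (t, x))
        (fun t ht => (hd x t ht).differentiableAt.differentiableWithinAt)
        (fun t ht => (hd x t ht).deriv) hτ h₁
    change _ = (a τ)⁻¹ • (a τ₁ • Z (τ₁, x))
    rw [← hconst, smul_smul, inv_mul_cancel₀ (h.a_pos τ hτ).ne', one_smul]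
  refine ⟨⟨C, hCs, hform⟩, ?_⟩
  rw [tendstoLocallyUniformly_iff_forall_tendsto]
  intro x
  refine tendsto_uniformity_of_tendsto (b := 0) tendsto_const_nhds ?_
  have h1 : Tendsto (fun y : ℝ × Space => (a y.1)⁻¹) (𝓝[<] 0 ×ˢ 𝓝 x) (𝓝 0) :=
    (tendsto_inv_atTop_zero.comp h.tendsto_atTop).comp tendsto_fst
  have h2 : Tendsto (fun y : ℝ × Space => C y.2) (𝓝[<] 0 ×ˢ 𝓝 x) (𝓝 (C x)) :=
    (hCs.continuous.tendsto x).comp tendsto_snd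
  have h3 := h1.smul h2
  rw [zero_smul] at h3
  refine h3.congr' ?_
  have hev : ∀ᶠ y : ℝ × Space in 𝓝[<] 0 ×ˢ 𝓝 x, y.1 ∈ Ioo τ₀ 0 :=
    tendsto_fst (Ioo_mem_nhdsLT hτ₀)
  filter_upwards [hev] with y hy using (hform y.1 hy y.2).symm

end modes

end

end DustPert

namespace DustPert

noncomputable section

/-! ### The entire function in the Bessel series -/

/-- The coefficients `(-1)^k / (k! Γ(k + ν + 1))`. -/
def besselCoeff (ν : ℂ) (k : ℕ) : ℂ :=
  (-1 : ℂ) ^ k / ((k.factorial : ℂ) * Complex.Gamma (k + ν + 1))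

/-- The entire function `s ↦ ∑ (-1)^k s^k / (k! Γ(k + ν + 1))`, so that
`J_ν(z) = (z/2)^ν besselEntire ν ((z/2)²)`. -/
def besselEntire (ν s : ℂ) : ℂ := ∑' k : ℕ, besselCoeff ν k * s ^ k

section series
variable {ν : ℂ}

/-- For `k ≥ 1` the functional equation divides `1/Γ` by `k + ν + 1`, of norm at least one, so
`|1/Γ|` does not increase. The index `0` is separate because `ν + 1` may have norm less than one. -/
lemma besselCoeff_bound (hν : -1 < ν.re) :
    ∃ C : ℝ, 0 ≤ C ∧ ∀ k, ‖besselCoeff ν k‖ ≤ C / k.factorial := by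
  set G : ℕ → ℝ := fun k => ‖(Complex.Gamma (k + ν + 1))⁻¹‖ with hG
  have hstep (k : ℕ) (hk : 1 ≤ k) : G (k + 1) ≤ G k := by
    have hre : 1 ≤ (k + ν + 1 : ℂ).re := by
      have : (1 : ℝ) ≤ k := by exact_mod_cast hk
      simp only [Complex.add_re, Complex.natCast_re, Complex.one_re]
      linarith
    have hne : (k + ν + 1 : ℂ) ≠ 0 := fun h => by
      rw [h, Complex.zero_re] at hre; linarith
    have hnorm : 1 ≤ ‖(k + ν + 1 : ℂ)‖ := hre.trans (Complex.re_le_norm _)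
    have he : Complex.Gamma (((k + 1 : ℕ) : ℂ) + ν + 1) =
        (k + ν + 1) * Complex.Gamma (k + ν + 1) := by
      rw [← Complex.Gamma_add_one _ hne]; congr 1; push_cast; ring
    simp only [hG, he, mul_inv, norm_mul, norm_inv]
    have h0 : 0 ≤ ‖Complex.Gamma (k + ν + 1)‖⁻¹ := by positivity
    calc ‖(k + ν + 1 : ℂ)‖⁻¹ * ‖Complex.Gamma (k + ν + 1)‖⁻¹
        ≤ 1 * ‖Complex.Gamma (k + ν + 1)‖⁻¹ := by
          gcongr; exact inv_le_one_of_one_le₀ hnorm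
      _ = _ := one_mul _
  have hbd (k : ℕ) : G (k + 1) ≤ G 1 := by
    induction k with
    | zero => exact le_rfl
    | succ k ih => exact (hstep (k + 1) (by omega)).trans ih
  have hGnn (k) : 0 ≤ G k := norm_nonneg _
  refine ⟨G 0 + G 1, add_nonneg (hGnn 0) (hGnn 1), fun k => ?_⟩
  have hk : G k ≤ G 0 + G 1 := by
    rcases k with _ | k
    · linarith [hGnn 1]
    · linarith [hbd k, hGnn 0]
  have he : ‖besselCoeff ν k‖ = G k / k.factorial := by
    simp only [besselCoeff, hG, norm_div, norm_mul, norm_pow, norm_neg, norm_one, one_pow,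
      norm_inv, Complex.norm_natCast]
    field_simp
  rw [he]
  gcongr

lemma summable_besselEntire (hν : -1 < ν.re) (s : ℂ) :
    Summable fun k => besselCoeff ν k * s ^ k := by
  obtain ⟨C, -, hC⟩ := besselCoeff_bound hν
  refine Summable.of_norm_bounded ((Real.summable_pow_div_factorial ‖s‖).mul_left C) fun k => ?_
  rw [norm_mul, norm_pow, show C * (‖s‖ ^ k / k.factorial) = C / k.factorial * ‖s‖ ^ k by ring]
  gcongr
  exact hC k

lemma besselCoeff_succ_mul (k : ℕ) :
    besselCoeff ν (k + 1) * (k + 1) = -besselCoeff (ν + 1) k := by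
  have h1 : (((k + 1 : ℕ) : ℂ) + ν + 1) = k + (ν + 1) + 1 := by push_cast; ring
  have h2 : (k + 1 : ℂ) ≠ 0 := by exact_mod_cast k.succ_ne_zero
  have h3 : (k.factorial : ℂ) ≠ 0 := by exact_mod_cast k.factorial_ne_zero
  simp only [besselCoeff, h1, Nat.factorial_succ, Nat.cast_mul, pow_succ]
  push_cast
  -- At a pole `Complex.Gamma` has the value `0`, and division by zero makes both sides vanish.
  rcases eq_or_ne (Complex.Gamma (k + (ν + 1) + 1)) 0 with h | h
  · simp [h]
  · field_simp

lemma hasDerivAt_besselEntire (hν : -1 < ν.re) (s : ℂ) :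
    HasDerivAt (besselEntire ν) (-besselEntire (ν + 1) s) s := by
  obtain ⟨C, hC0, hC⟩ := besselCoeff_bound hν
  set R := ‖s‖ + 1
  have hu : Summable fun k : ℕ => C / k.factorial * (k * R ^ (k - 1)) := by
    rw [← summable_nat_add_iff 1]
    refine ((Real.summable_pow_div_factorial R).mul_left C).congr fun k => ?_
    rw [Nat.factorial_succ]
    push_cast
    have h3 : (k.factorial : ℝ) ≠ 0 := by exact_mod_cast k.factorial_ne_zero
    have h2 : (k + 1 : ℝ) ≠ 0 := by positivity
    field_simp
  have hs : s ∈ Metric.ball (0 : ℂ) R := by simp [R]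
  have h := hasDerivAt_tsum_of_isPreconnected (g := fun k t => besselCoeff ν k * t ^ k)
    (g' := fun k t => besselCoeff ν k * (k * t ^ (k - 1))) hu Metric.isOpen_ball
    (convex_ball (0 : ℂ) R).isPreconnected
    (fun k t _ => (hasDerivAt_pow k t).const_mul _)
    (fun k t ht => ?_) hs (summable_besselEntire hν s) hs
  · refine h.congr_deriv ?_
    have hsum : Summable fun k : ℕ => besselCoeff ν k * (k * s ^ (k - 1)) := by
      refine Summable.of_norm_bounded hu fun k => ?_
      rw [norm_mul, norm_mul, norm_pow, Complex.norm_natCast]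
      gcongr
      · exact hC k
      · simp [R]
    rw [hsum.tsum_eq_zero_add]
    simp only [Nat.cast_zero, zero_mul, mul_zero, zero_add, Nat.add_sub_cancel, besselEntire]
    rw [← tsum_neg]
    refine tsum_congr fun k => ?_
    have := besselCoeff_succ_mul (ν := ν) k
    push_cast
    linear_combination s ^ k * this
  · rw [norm_mul, norm_mul, norm_pow, Complex.norm_natCast]
    have : ‖t‖ ≤ R := (mem_ball_zero_iff.1 ht).le
    gcongr
    exact hC k

/-- Bessel's equation. -/
lemma besselEntire_recursion (hν : -1 < ν.re) (s : ℂ) :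
    s * besselEntire (ν + 2) s - (ν + 1) * besselEntire (ν + 1) s + besselEntire ν s = 0 := by
  have h0 := summable_besselEntire hν s
  have h1 := summable_besselEntire (ν := ν + 1) (by simp; linarith) s
  have h2 := summable_besselEntire (ν := ν + 2) (by simp; linarith) s
  have hΓ (k : ℕ) : Complex.Gamma (k + ν + 1) ≠ 0 := Complex.Gamma_ne_zero_of_re_pos (by
    simp only [Complex.add_re, Complex.natCast_re, Complex.one_re]
    linarith [Nat.cast_nonneg (α := ℝ) k])
  have hne (k : ℕ) : (k + ν + 1 : ℂ) ≠ 0 := fun h => by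
    have := congrArg Complex.re h
    simp only [Complex.add_re, Complex.natCast_re, Complex.one_re, Complex.zero_re] at this
    linarith [Nat.cast_nonneg (α := ℝ) k]
  have hr (k : ℕ) : (k + ν + 1) * besselCoeff (ν + 1) k = besselCoeff ν k := by
    have h3 : (k.factorial : ℂ) ≠ 0 := by exact_mod_cast k.factorial_ne_zero
    simp only [besselCoeff]
    rw [show (k + (ν + 1) + 1 : ℂ) = (k + ν + 1) + 1 by ring, Complex.Gamma_add_one _ (hne k)]
    have := hΓ k
    have := hne k
    field_simp
  have hs (k : ℕ) : besselCoeff (ν + 1) (k + 1) * (k + 1) = -besselCoeff (ν + 2) k := by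
    rw [besselCoeff_succ_mul, show ν + 1 + 1 = ν + 2 by ring]
  -- By `Γ(z + 1) = z Γ(z)` only the factor `k` survives. It kills the first term, and the index
  -- shift produces `s` times the series of order `ν + 2`.
  have e : besselEntire ν s - (ν + 1) * besselEntire (ν + 1) s =
      ∑' k : ℕ, (k * besselCoeff (ν + 1) k) * s ^ k := by
    simp only [besselEntire]
    rw [← tsum_mul_left, ← h0.tsum_sub (h1.mul_left _)]
    refine tsum_congr fun k => ?_
    rw [← hr k]; ring
  have hsum : Summable fun k : ℕ => (k * besselCoeff (ν + 1) k) * s ^ k := by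
    refine (h0.sub (h1.mul_left (ν + 1))).congr fun k => ?_
    rw [← hr k]; ring
  have e2 : ∑' k : ℕ, (k * besselCoeff (ν + 1) k) * s ^ k = -(s * besselEntire (ν + 2) s) := by
    rw [hsum.tsum_eq_zero_add]
    simp only [Nat.cast_zero, zero_mul, zero_add, besselEntire]
    rw [← tsum_mul_left, ← tsum_neg]
    refine tsum_congr fun k => ?_
    push_cast
    linear_combination s ^ (k + 1) * hs k
  linear_combination e + e2

lemma besselEntire_zero (ν : ℂ) : besselEntire ν 0 = (Complex.Gamma (ν + 1))⁻¹ := by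
  rw [besselEntire, tsum_eq_single 0 fun k hk => by simp [hk]]
  simp [besselCoeff]

lemma contDiff_besselEntire (hν : -1 < ν.re) {n : ℕ∞ω} : ContDiff ℂ n (besselEntire ν) :=
  Differentiable.contDiff fun s => (hasDerivAt_besselEntire hν s).differentiableAt

lemma besselJ_eq {z : ℂ} (hz : z ≠ 0) :
    besselJ ν z = (z / 2) ^ ν * besselEntire ν ((z / 2) ^ 2) := by
  have hz2 : z / 2 ≠ 0 := div_ne_zero hz two_ne_zero
  rw [besselJ, besselEntire, ← tsum_mul_left]
  refine tsum_congr fun k => ?_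
  rw [Complex.cpow_add _ _ hz2, show (2 * (k : ℂ)) = ((2 * k : ℕ) : ℂ) by push_cast; ring,
    Complex.cpow_natCast, pow_mul, besselCoeff]
  ring

end series

/-! ### The two power series solutions of the scalar equation -/

/-- `τ ↦ besselEntire ν (w τ³)`. -/
def besselCubic (w ν : ℂ) (τ : ℝ) : ℂ := besselEntire ν (w * (τ : ℂ) ^ 3)

section cubic
variable {w ν : ℂ}

lemma hasDerivAt_ofReal_pow (n : ℕ) (τ : ℝ) :
    HasDerivAt (fun t : ℝ => (t : ℂ) ^ n) (n * (τ : ℂ) ^ (n - 1)) τ :=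
  (hasDerivAt_pow n (τ : ℂ)).comp_ofReal

lemma hasDerivAt_besselCubic (hν : -1 < ν.re) (τ : ℝ) :
    HasDerivAt (besselCubic w ν) (-(3 * w * (τ : ℂ) ^ 2) * besselCubic w (ν + 1) τ) τ := by
  have h1 := (hasDerivAt_ofReal_pow 3 τ).const_mul w
  have h2 := (hasDerivAt_besselEntire hν (w * (τ : ℂ) ^ 3)).comp τ h1
  refine h2.congr_deriv ?_
  simp only [besselCubic]
  push_cast
  ring

lemma contDiff_besselCubic (hν : -1 < ν.re) : ContDiff ℝ 2 (besselCubic w ν) := by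
  have h1 : ContDiff ℝ 2 fun t : ℝ => w * (t : ℂ) ^ 3 :=
    contDiff_const.mul (Complex.ofRealCLM.contDiff.pow 3)
  exact ((contDiff_besselEntire hν).restrict_scalars ℝ).comp h1

/-- The power series solution with value `1 / Γ(1/3)` at `0`. -/
def evenSeries (w : ℂ) (τ : ℝ) : ℂ := besselCubic w (-(2 / 3)) τ

/-- The power series solution that vanishes quadratically at `0`. -/
def quadSeries (w : ℂ) (τ : ℝ) : ℂ := (τ : ℂ) ^ 2 * besselCubic w (2 / 3) τ

/-- The derivative of `evenSeries`. -/
def evenSeries' (w : ℂ) (τ : ℝ) : ℂ := -(3 * w * (τ : ℂ) ^ 2) * besselCubic w (1 / 3) τ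

/-- The derivative of `quadSeries`. -/
def quadSeries' (w : ℂ) (τ : ℝ) : ℂ :=
  2 * (τ : ℂ) * besselCubic w (2 / 3) τ - 3 * w * (τ : ℂ) ^ 4 * besselCubic w (5 / 3) τ

lemma re_two_thirds : ((2 / 3 : ℂ)).re = 2 / 3 := by
  rw [show (2 / 3 : ℂ) = ((2 / 3 : ℝ) : ℂ) by push_cast; ring, Complex.ofReal_re]

lemma re_one_third : ((1 / 3 : ℂ)).re = 1 / 3 := by
  rw [show (1 / 3 : ℂ) = ((1 / 3 : ℝ) : ℂ) by push_cast; ring, Complex.ofReal_re]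

lemma re_five_thirds : ((5 / 3 : ℂ)).re = 5 / 3 := by
  rw [show (5 / 3 : ℂ) = ((5 / 3 : ℝ) : ℂ) by push_cast; ring, Complex.ofReal_re]

lemma hasDerivAt_evenSeries (τ : ℝ) : HasDerivAt (evenSeries w) (evenSeries' w τ) τ := by
  have := hasDerivAt_besselCubic (w := w) (ν := -(2 / 3))
    (by rw [Complex.neg_re, re_two_thirds]; norm_num) τ
  rwa [show (-(2 / 3) + 1 : ℂ) = 1 / 3 by norm_num] at this

lemma hasDerivAt_quadSeries (τ : ℝ) : HasDerivAt (quadSeries w) (quadSeries' w τ) τ := by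
  have h := hasDerivAt_besselCubic (w := w) (ν := 2 / 3) (by rw [re_two_thirds]; norm_num) τ
  rw [show (2 / 3 + 1 : ℂ) = 5 / 3 by norm_num] at h
  refine ((hasDerivAt_ofReal_pow 2 τ).mul h).congr_deriv ?_
  simp only [quadSeries']
  push_cast
  ring

/-- The recursion between orders `-2/3`, `1/3` and `4/3` becomes `f'' = f'/τ - 9 w τ f` under `s = w
τ³`; `quadSeries` uses orders `2/3`, `5/3` and `8/3`. -/
lemma hasDerivAt_evenSeries' {τ : ℝ} (hτ : τ ≠ 0) : HasDerivAt (evenSeries' w)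
    ((1 / (τ : ℂ)) * evenSeries' w τ - 9 * w * τ * evenSeries w τ) τ := by
  have h := hasDerivAt_besselCubic (w := w) (ν := 1 / 3) (by rw [re_one_third]; norm_num) τ
  rw [show (1 / 3 + 1 : ℂ) = 4 / 3 by norm_num] at h
  have hr := besselEntire_recursion (ν := -(2 / 3))
    (by rw [Complex.neg_re, re_two_thirds]; norm_num) (w * (τ : ℂ) ^ 3)
  rw [show (-(2 / 3) + 1 : ℂ) = 1 / 3 by norm_num, show (-(2 / 3) + 2 : ℂ) = 4 / 3 by norm_num] at hr
  refine ((((hasDerivAt_ofReal_pow 2 τ).const_mul (3 * w)).neg).mul h).congr_deriv ?_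
  have hτ' : (τ : ℂ) ≠ 0 := Complex.ofReal_ne_zero.2 hτ
  simp only [evenSeries', evenSeries, besselCubic, Pi.neg_apply]
  push_cast
  field_simp
  linear_combination (9 * w) * hr

lemma hasDerivAt_quadSeries' {τ : ℝ} (hτ : τ ≠ 0) : HasDerivAt (quadSeries' w)
    ((1 / (τ : ℂ)) * quadSeries' w τ - 9 * w * τ * quadSeries w τ) τ := by
  have h1 := hasDerivAt_besselCubic (w := w) (ν := 2 / 3) (by rw [re_two_thirds]; norm_num) τ
  have h2 := hasDerivAt_besselCubic (w := w) (ν := 5 / 3) (by rw [re_five_thirds]; norm_num) τ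
  rw [show (2 / 3 + 1 : ℂ) = 5 / 3 by norm_num] at h1
  rw [show (5 / 3 + 1 : ℂ) = 8 / 3 by norm_num] at h2
  have hr := besselEntire_recursion (ν := 2 / 3) (by rw [re_two_thirds]; norm_num)
    (w * (τ : ℂ) ^ 3)
  rw [show (2 / 3 + 1 : ℂ) = 5 / 3 by norm_num, show (2 / 3 + 2 : ℂ) = 8 / 3 by norm_num] at hr
  have h := ((((hasDerivAt_ofReal_pow 1 τ).const_mul 2)).mul h1).sub
    (((hasDerivAt_ofReal_pow 4 τ).const_mul (3 * w)).mul h2)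
  have he : quadSeries' w = ((fun t : ℝ => 2 * (t : ℂ) ^ 1) * besselCubic w (2 / 3)) -
      (fun t : ℝ => 3 * w * (t : ℂ) ^ 4) * besselCubic w (5 / 3) := by
    funext t; simp [quadSeries']
  rw [he]
  refine h.congr_deriv ?_
  have hτ' : (τ : ℂ) ≠ 0 := Complex.ofReal_ne_zero.2 hτ
  simp only [quadSeries, besselCubic, Pi.sub_apply, Pi.mul_apply]
  push_cast
  field_simp
  linear_combination (9 * w * τ ^ 3) * hr

lemma contDiff_evenSeries : ContDiff ℝ 2 (evenSeries w) :=
  contDiff_besselCubic (by rw [Complex.neg_re, re_two_thirds]; norm_num)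

lemma contDiff_quadSeries : ContDiff ℝ 2 (quadSeries w) :=
  (Complex.ofRealCLM.contDiff.pow 2).mul
    (contDiff_besselCubic (by rw [re_two_thirds]; norm_num))

end cubic

/-- The Wronskian of two solutions of `f'' - (n/τ) f' + r f = 0` is a multiple of `τ^n`. -/
lemma wronskian_div_pow_const {τ₀ : ℝ} (n : ℕ) {r : ℝ → ℂ} {f f' f'' g g' g'' : ℝ → ℂ}
    (hf : ∀ t ∈ Ioo τ₀ 0, HasDerivAt f (f' t) t) (hf' : ∀ t ∈ Ioo τ₀ 0, HasDerivAt f' (f'' t) t)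
    (hg : ∀ t ∈ Ioo τ₀ 0, HasDerivAt g (g' t) t) (hg' : ∀ t ∈ Ioo τ₀ 0, HasDerivAt g' (g'' t) t)
    (ef : ∀ t ∈ Ioo τ₀ 0, f'' t = (n / (t : ℂ)) * f' t - r t * f t)
    (eg : ∀ t ∈ Ioo τ₀ 0, g'' t = (n / (t : ℂ)) * g' t - r t * g t)
    {t s : ℝ} (ht : t ∈ Ioo τ₀ 0) (hs : s ∈ Ioo τ₀ 0) :
    (f t * g' t - f' t * g t) / (t : ℂ) ^ n = (f s * g' s - f' s * g s) / (s : ℂ) ^ n := by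
  have hd : ∀ t ∈ Ioo τ₀ 0,
      HasDerivAt (fun t : ℝ => (f t * g' t - f' t * g t) / (t : ℂ) ^ n) 0 t := fun t ht => by
    have ht0 : (t : ℂ) ≠ 0 := Complex.ofReal_ne_zero.2 ht.2.ne
    refine ((((hf t ht).mul (hg' t ht)).sub ((hf' t ht).mul (hg t ht))).div
      (hasDerivAt_ofReal_pow n t) (pow_ne_zero n ht0)).congr_deriv ?_
    rw [ef t ht, eg t ht]
    simp only [Pi.sub_apply, Pi.mul_apply]
    rw [div_eq_zero_iff]
    left
    -- The exponent `n - 1` is truncated, so `n = 0` is treated apart.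
    rcases n with _ | n
    · simp; ring
    · simp only [Nat.add_sub_cancel, pow_succ]
      field_simp
      ring
  exact IsOpen.is_const_of_deriv_eq_zero isOpen_Ioo isPreconnected_Ioo
    (f := fun t : ℝ => (f t * g' t - f' t * g t) / (t : ℂ) ^ n)
    (fun t ht => (hd t ht).differentiableAt.differentiableWithinAt)
    (fun t ht => (hd t ht).deriv) ht hs

end

end DustPert

namespace DustPert

noncomputable section

/-! ### Bessel representation of the scalar modes -/

lemma deriv_deSitterScale_div {Λ τ : ℝ} (hΛ : 0 < Λ) (hτ : τ < 0) :
    deriv (deSitterScale Λ) τ / deSitterScale Λ τ = -1 / τ := by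
  have h1 : HasDerivAt (deSitterScale Λ) ((0 * τ - -Real.sqrt (3 / Λ) * 1) / τ ^ 2) τ :=
    (hasDerivAt_const τ (-Real.sqrt (3 / Λ))).div (hasDerivAt_id τ) hτ.ne
  have h2 : Real.sqrt (3 / Λ) ≠ 0 := (Real.sqrt_pos.2 (by positivity)).ne'
  have h3 := hτ.ne
  rw [h1.deriv, deSitterScale]
  field_simp
  ring

/-- The constant `A = (½ ρ₀ √(Λ/3))^{1/2}`. -/
def besselFreq (Λ ρ₀ : ℝ) : ℝ := Real.sqrt ((1 / 2) * ρ₀ * Real.sqrt (Λ / 3))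

section bessel
variable {Λ ρ₀ τ : ℝ}

lemma besselFreq_pos (hΛ : 0 < Λ) (hρ : 0 < ρ₀) : 0 < besselFreq Λ ρ₀ := by
  have : 0 < Real.sqrt (Λ / 3) := Real.sqrt_pos.2 (by positivity)
  exact Real.sqrt_pos.2 (by positivity)

lemma scalar_potential_deSitter (hΛ : 0 < Λ) (hρ : 0 < ρ₀) (hτ : τ < 0) :
    (1 / 2) * deSitterScale Λ τ ^ 2 * (ρ₀ / deSitterScale Λ τ ^ 3) = -besselFreq Λ ρ₀ ^ 2 * τ := by
  have h0 : 0 < Real.sqrt (Λ / 3) := Real.sqrt_pos.2 (by positivity)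
  have h1 : Real.sqrt (3 / Λ) = (Real.sqrt (Λ / 3))⁻¹ := by
    rw [← Real.sqrt_inv, inv_div]
  rw [besselFreq, Real.sq_sqrt (by positivity), deSitterScale, h1]
  have := hτ.ne
  field_simp

/-- The logarithm of half the argument of the Bessel functions. -/
def halfArgLog (Λ ρ₀ τ : ℝ) : ℂ :=
  (Real.log (besselFreq Λ ρ₀ / 3) + 3 / 2 * Real.log (-τ) : ℝ) + (-(Real.pi / 2) : ℝ) * Complex.I

lemma besselArg_half (hΛ : 0 < Λ) (hρ : 0 < ρ₀) (hτ : τ < 0) :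
    besselArg Λ ρ₀ τ / 2 = Complex.exp (halfArgLog Λ ρ₀ τ) := by
  have hA := besselFreq_pos hΛ hρ
  have hne : ((-τ : ℝ) : ℂ) ≠ 0 := Complex.ofReal_ne_zero.2 (by linarith)
  have h1 : (τ : ℂ) ^ (3 / 2 : ℂ) =
      Complex.exp ((3 / 2 * Real.log (-τ) : ℝ) + (-(Real.pi / 2) : ℝ) * Complex.I) := by
    rw [Complex.ofReal_cpow_of_nonpos hτ.le, ← Complex.ofReal_neg,
      Complex.cpow_def_of_ne_zero hne, ← Complex.exp_add, ← Complex.ofReal_log (by linarith),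
      Complex.exp_eq_exp_iff_exists_int]
    -- For negative `τ` the principal power has phase `3π/2`, which differs from `-π/2` by one full
    -- turn.
    exact ⟨1, by push_cast; ring⟩
  have h2 : ((besselFreq Λ ρ₀ / 3 : ℝ) : ℂ) = Complex.exp (Real.log (besselFreq Λ ρ₀ / 3) : ℝ) := by
    rw [← Complex.ofReal_exp, Real.exp_log (by positivity)]
  rw [besselArg, h1, halfArgLog, Complex.ofReal_add, add_assoc, Complex.exp_add _ (_ + _), ← h2]
  simp only [besselFreq]
  push_cast
  ring

/-- The imaginary part `-π/2` lies in the principal strip, so `halfArgLog` is the principal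
logarithm and powers multiply it. -/
lemma besselArg_half_cpow (hΛ : 0 < Λ) (hρ : 0 < ρ₀) (hτ : τ < 0) (ν : ℂ) :
    (besselArg Λ ρ₀ τ / 2) ^ ν = Complex.exp (halfArgLog Λ ρ₀ τ * ν) := by
  have him : (halfArgLog Λ ρ₀ τ).im = -(Real.pi / 2) := by
    simp only [halfArgLog, Complex.add_im, Complex.ofReal_im, Complex.mul_im, Complex.I_re,
      Complex.I_im, Complex.ofReal_re]
    ring
  rw [besselArg_half hΛ hρ hτ, Complex.cpow_def_of_ne_zero (Complex.exp_ne_zero _), Complex.log_exp]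
  · rw [him]; linarith [Real.pi_pos]
  · rw [him]; linarith [Real.pi_pos]

/-- The coefficient of the cubic argument of the power series. -/
def cubicCoeff (Λ ρ₀ : ℝ) : ℂ := ((besselFreq Λ ρ₀ / 3 : ℝ) : ℂ) ^ 2

lemma besselArg_half_sq (hΛ : 0 < Λ) (hρ : 0 < ρ₀) (hτ : τ < 0) :
    (besselArg Λ ρ₀ τ / 2) ^ 2 = cubicCoeff Λ ρ₀ * (τ : ℂ) ^ 3 := by
  have hA := besselFreq_pos hΛ hρ
  rw [besselArg_half hΛ hρ hτ, ← Complex.exp_nat_mul]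
  -- The logarithms are written as repeated summands so that the exponential becomes `(A/3)² (-τ)³
  -- e^{-πi}`.
  have e : ((2 : ℕ) : ℂ) * halfArgLog Λ ρ₀ τ = ((Real.log (besselFreq Λ ρ₀ / 3) : ℝ) : ℂ) +
      ((Real.log (besselFreq Λ ρ₀ / 3) : ℝ) + (((Real.log (-τ) : ℝ) : ℂ) + (((Real.log (-τ) : ℝ) : ℂ)
        + ((Real.log (-τ) : ℝ) + -(Real.pi * Complex.I))))) := by
    simp only [halfArgLog]; push_cast; ring
  rw [e]
  simp only [Complex.exp_add, ← Complex.ofReal_exp]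
  rw [Real.exp_log (by positivity), Real.exp_log (by linarith), Complex.exp_neg,
    Complex.exp_pi_mul_I, cubicCoeff]
  push_cast
  ring

/-- The constant in `(z/2)^{2/3} = - κ τ`. -/
def besselPhase (Λ ρ₀ : ℝ) : ℂ :=
  Complex.exp ((2 / 3 : ℂ) * ((Real.log (besselFreq Λ ρ₀ / 3) : ℝ)
    + (-(Real.pi / 2) : ℝ) * Complex.I))

lemma besselArg_half_cpow_two_thirds (hΛ : 0 < Λ) (hρ : 0 < ρ₀) (hτ : τ < 0) :
    (besselArg Λ ρ₀ τ / 2) ^ (2 / 3 : ℂ) = -(besselPhase Λ ρ₀ * τ) := by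
  have e : halfArgLog Λ ρ₀ τ * (2 / 3) = (2 / 3 : ℂ) * ((Real.log (besselFreq Λ ρ₀ / 3) : ℝ)
    + (-(Real.pi / 2) : ℝ) * Complex.I) + (Real.log (-τ) : ℝ) := by
    simp only [halfArgLog]; push_cast; ring
  rw [besselArg_half_cpow hΛ hρ hτ, e, Complex.exp_add, ← Complex.ofReal_exp,
    Real.exp_log (by linarith), besselPhase]
  push_cast
  ring

lemma besselArg_ne_zero (hΛ : 0 < Λ) (hρ : 0 < ρ₀) (hτ : τ < 0) : besselArg Λ ρ₀ τ ≠ 0 := by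
  intro h
  have := besselArg_half hΛ hρ hτ
  rw [h, zero_div] at this
  exact Complex.exp_ne_zero _ this.symm

/-- Since `(z/2)^{2/3}` is a multiple of `τ`, the prefactors combine to `τ²`; for order `-2/3` they
cancel to a constant. Both functions are therefore regular at `τ = 0`. -/
lemma mul_besselJ_pos (hΛ : 0 < Λ) (hρ : 0 < ρ₀) (hτ : τ < 0) :
    (τ : ℂ) * besselJ (2 / 3) (besselArg Λ ρ₀ τ) =
      -besselPhase Λ ρ₀ * quadSeries (cubicCoeff Λ ρ₀) τ := by
  rw [besselJ_eq (besselArg_ne_zero hΛ hρ hτ), besselArg_half_sq hΛ hρ hτ,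
    besselArg_half_cpow_two_thirds hΛ hρ hτ, quadSeries, besselCubic]
  ring

lemma mul_besselJ_neg (hΛ : 0 < Λ) (hρ : 0 < ρ₀) (hτ : τ < 0) :
    (τ : ℂ) * besselJ (-(2 / 3)) (besselArg Λ ρ₀ τ) =
      -(besselPhase Λ ρ₀)⁻¹ * evenSeries (cubicCoeff Λ ρ₀) τ := by
  have hτ' : (τ : ℂ) ≠ 0 := Complex.ofReal_ne_zero.2 hτ.ne
  have hκ : besselPhase Λ ρ₀ ≠ 0 := Complex.exp_ne_zero _
  rw [besselJ_eq (besselArg_ne_zero hΛ hρ hτ), besselArg_half_sq hΛ hρ hτ, Complex.cpow_neg,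
    besselArg_half_cpow_two_thirds hΛ hρ hτ, evenSeries, besselCubic]
  field_simp

lemma sin_two_thirds_pi_ne_zero : Complex.sin ((2 / 3 : ℂ) * Real.pi) ≠ 0 := by
  have : Complex.sin ((2 / 3 : ℂ) * Real.pi) = (Real.sin (2 / 3 * Real.pi) : ℝ) := by
    rw [Complex.ofReal_sin]; push_cast; rfl
  rw [this]
  refine Complex.ofReal_ne_zero.2 (Real.sin_pos_of_pos_of_lt_pi ?_ ?_).ne'
  · positivity
  · linarith [Real.pi_pos]

/-- The Bessel solution in terms of the power series solutions. -/
lemma besselSolution_eq (hΛ : 0 < Λ) (hρ : 0 < ρ₀) (hτ : τ < 0) (C₁ C₂ : ℂ) :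
    besselSolution Λ ρ₀ C₁ C₂ τ =
      (C₁ * (besselPhase Λ ρ₀)⁻¹ / Complex.sin ((2 / 3 : ℂ) * Real.pi)) *
          evenSeries (cubicCoeff Λ ρ₀) τ +
        (-besselPhase Λ ρ₀ * (C₁ * Complex.cos ((2 / 3 : ℂ) * Real.pi) /
          Complex.sin ((2 / 3 : ℂ) * Real.pi) + C₂)) * quadSeries (cubicCoeff Λ ρ₀) τ := by
  have h1 := mul_besselJ_pos hΛ hρ hτ
  have h2 := mul_besselJ_neg hΛ hρ hτ
  have hs := sin_two_thirds_pi_ne_zero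
  rw [besselSolution, besselY]
  linear_combination (C₁ * Complex.cos ((2 / 3 : ℂ) * Real.pi) /
    Complex.sin ((2 / 3 : ℂ) * Real.pi) + C₂) * h1 -
    (C₁ / Complex.sin ((2 / 3 : ℂ) * Real.pi)) * h2

lemma ScalarModeEq.congr {τ₀ : ℝ} {a ρ : ℝ → ℝ} {f g : ℝ → ℂ} (hf : ScalarModeEq τ₀ a ρ f)
    (h : EqOn f g (Ioo τ₀ 0)) : ScalarModeEq τ₀ a ρ g := by
  refine ⟨hf.1.congr h.symm, fun τ hτ => ?_⟩
  have h1 : f =ᶠ[𝓝 τ] g := h.eventuallyEq_of_mem (isOpen_Ioo.mem_nhds hτ)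
  rw [← h1.deriv.deriv_eq, ← h1.deriv_eq, ← h hτ]
  exact hf.2 τ hτ

lemma nine_mul_cubicCoeff : 9 * cubicCoeff Λ ρ₀ = ((besselFreq Λ ρ₀ ^ 2 : ℝ) : ℂ) := by
  rw [cubicCoeff]; push_cast; ring

lemma scalarModeEq_series (hΛ : 0 < Λ) (hρ : 0 < ρ₀) (τ₀ : ℝ) (α β : ℂ) :
    ScalarModeEq τ₀ (deSitterScale Λ) (fun τ => ρ₀ / deSitterScale Λ τ ^ 3) (fun τ =>
      α * evenSeries (cubicCoeff Λ ρ₀) τ + β * quadSeries (cubicCoeff Λ ρ₀) τ) := by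
  refine ⟨((contDiff_const.mul contDiff_evenSeries).add
    (contDiff_const.mul contDiff_quadSeries)).contDiffOn, fun τ hτ => ?_⟩
  have h1 : deriv (fun τ => α * evenSeries (cubicCoeff Λ ρ₀) τ +
      β * quadSeries (cubicCoeff Λ ρ₀) τ) = fun τ => α * evenSeries' (cubicCoeff Λ ρ₀) τ +
      β * quadSeries' (cubicCoeff Λ ρ₀) τ := funext fun t =>
    (((hasDerivAt_evenSeries t).const_mul α).add ((hasDerivAt_quadSeries t).const_mul β)).deriv
  have h2 := (((hasDerivAt_evenSeries' (w := cubicCoeff Λ ρ₀) hτ.2.ne).const_mul α).add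
    ((hasDerivAt_quadSeries' (w := cubicCoeff Λ ρ₀) hτ.2.ne).const_mul β))
  rw [h1]
  erw [h2.deriv]
  rw [deriv_deSitterScale_div hΛ hτ.2, scalar_potential_deSitter hΛ hρ hτ.2]
  have h3 := nine_mul_cubicCoeff (Λ := Λ) (ρ₀ := ρ₀)
  push_cast at h3
  simp only [Complex.real_smul]
  push_cast
  linear_combination (-(τ : ℂ) * (α * evenSeries (cubicCoeff Λ ρ₀) τ +
      β * quadSeries (cubicCoeff Λ ρ₀) τ)) * h3

/-- The Bessel solutions solve the scalar equation and converge at late times. -/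
theorem besselSolution_scalarMode (hΛ : 0 < Λ) (hρ : 0 < ρ₀) {τ₀ : ℝ} (C₁ C₂ : ℂ) :
    ScalarModeEq τ₀ (deSitterScale Λ) (fun τ => ρ₀ / deSitterScale Λ τ ^ 3)
      (besselSolution Λ ρ₀ C₁ C₂) ∧
    ∃ c : ℂ, Tendsto (besselSolution Λ ρ₀ C₁ C₂) (𝓝[<] 0) (𝓝 c) := by
  refine ⟨(scalarModeEq_series hΛ hρ τ₀ _ _).congr fun τ hτ =>
    (besselSolution_eq hΛ hρ hτ.2 C₁ C₂).symm, ?_⟩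
  set α := C₁ * (besselPhase Λ ρ₀)⁻¹ / Complex.sin ((2 / 3 : ℂ) * Real.pi)
  set β := -besselPhase Λ ρ₀ * (C₁ * Complex.cos ((2 / 3 : ℂ) * Real.pi) /
          Complex.sin ((2 / 3 : ℂ) * Real.pi) + C₂)
  have hc : Continuous fun τ => α * evenSeries (cubicCoeff Λ ρ₀) τ +
      β * quadSeries (cubicCoeff Λ ρ₀) τ :=
    (continuous_const.mul (contDiff_evenSeries.continuous)).add
      (continuous_const.mul contDiff_quadSeries.continuous)
  refine ⟨_, ((hc.tendsto 0).mono_left nhdsWithin_le_nhds).congr' ?_⟩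
  filter_upwards [self_mem_nhdsWithin] with τ hτ using (besselSolution_eq hΛ hρ hτ C₁ C₂).symm

/-- The quotient is constant. After cancelling `τ` it extends continuously to `0`, where it can be
evaluated; the value is nonzero, so the two series are independent. -/
lemma wronskian_series {τ₀ τ : ℝ} (w : ℂ) (hτ : τ ∈ Ioo τ₀ 0) :
    (evenSeries w τ * quadSeries' w τ - evenSeries' w τ * quadSeries w τ) / (τ : ℂ) =
      2 * ((Complex.Gamma (1 / 3))⁻¹ * (Complex.Gamma (5 / 3))⁻¹) := by
  set F : ℝ → ℂ := fun t => evenSeries w t * (2 * besselCubic w (2 / 3) t -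
      3 * w * (t : ℂ) ^ 3 * besselCubic w (5 / 3) t) +
      (3 * w * (t : ℂ) ^ 3) * besselCubic w (1 / 3) t * besselCubic w (2 / 3) t with hF
  have hFe : ∀ t ∈ Ioo τ₀ 0, F t =
      (evenSeries w t * quadSeries' w t - evenSeries' w t * quadSeries w t) / (t : ℂ) ^ 1 :=
    fun t ht => by
      have : (t : ℂ) ≠ 0 := Complex.ofReal_ne_zero.2 ht.2.ne
      simp only [hF, quadSeries', evenSeries', quadSeries]
      field_simp
      ring
  have hconst : ∀ t ∈ Ioo τ₀ 0, F t = F τ := fun t ht => by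
    rw [hFe t ht, hFe τ hτ]
    exact wronskian_div_pow_const 1 (r := fun t => 9 * w * t)
      (fun t _ => hasDerivAt_evenSeries t) (fun t ht => hasDerivAt_evenSeries' ht.2.ne)
      (fun t _ => hasDerivAt_quadSeries t) (fun t ht => hasDerivAt_quadSeries' ht.2.ne)
      (fun t _ => by simp) (fun t _ => by simp) ht hτ
  have h23 := (contDiff_besselCubic (w := w) (ν := 2 / 3)
    (by rw [re_two_thirds]; norm_num)).continuous
  have h13 := (contDiff_besselCubic (w := w) (ν := 1 / 3)
    (by rw [re_one_third]; norm_num)).continuous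
  have h53 := (contDiff_besselCubic (w := w) (ν := 5 / 3)
    (by rw [re_five_thirds]; norm_num)).continuous
  have h0 := (contDiff_evenSeries (w := w)).continuous
  have hcF : Continuous F := by
    simp only [hF]
    fun_prop
  have hlim : Tendsto F (𝓝[<] 0) (𝓝 (F 0)) := (hcF.tendsto 0).mono_left nhdsWithin_le_nhds
  have hτ₀ : τ₀ < 0 := hτ.1.trans hτ.2
  have hlim' : Tendsto F (𝓝[<] 0) (𝓝 (F τ)) := by
    refine tendsto_const_nhds.congr' ?_
    filter_upwards [Ioo_mem_nhdsLT hτ₀] with t ht using (hconst t ht).symm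
  have h4 := tendsto_nhds_unique hlim' hlim
  rw [hFe τ hτ, pow_one] at h4
  rw [h4]
  simp only [hF, evenSeries, besselCubic]
  simp only [Complex.ofReal_zero, ne_eq, OfNat.ofNat_ne_zero, not_false_eq_true, zero_pow,
    mul_zero, zero_mul, sub_zero, add_zero, besselEntire_zero]
  rw [show (-(2 / 3) + 1 : ℂ) = 1 / 3 by norm_num, show (2 / 3 + 1 : ℂ) = 5 / 3 by norm_num]
  ring

/-- Every smooth solution of the scalar equation is a Bessel solution. -/
theorem scalarMode_eq_besselSolution (hΛ : 0 < Λ) (hρ : 0 < ρ₀) {τ₀ : ℝ} (hτ₀ : τ₀ < 0)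
    {φ : Spacetime → ℝ} (hφ : SlabSmooth τ₀ φ)
    (heq : ∀ x, ScalarModeEq τ₀ (deSitterScale Λ) (fun τ => ρ₀ / deSitterScale Λ τ ^ 3)
      (fun τ => φ (τ, x))) :
    ∃ C₁ C₂ : Space → ℂ, ContDiff ℝ 2 C₁ ∧ ContDiff ℝ 2 C₂ ∧
      ∀ τ ∈ Ioo τ₀ 0, ∀ x, (φ (τ, x) : ℂ) = besselSolution Λ ρ₀ (C₁ x) (C₂ x) τ := by
  obtain ⟨τ₁, h₁⟩ : (Ioo τ₀ 0).Nonempty := nonempty_Ioo.2 hτ₀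
  set w := cubicCoeff Λ ρ₀
  set U₀ := evenSeries w
  set U₂ := quadSeries w
  set V₀ := evenSeries' w
  set V₂ := quadSeries' w
  have hd1 (x : Space) (t : ℝ) (ht : t ∈ Ioo τ₀ 0) :
      HasDerivAt (fun t => (φ (t, x) : ℂ)) (pd 0 φ (t, x) : ℝ) t :=
    (hasDerivAt_time (hφ.differentiableAt (mk_mem_slab ht x))).ofReal_comp
  have hd2 (x : Space) (t : ℝ) (ht : t ∈ Ioo τ₀ 0) :
      HasDerivAt (fun t => ((pd 0 φ (t, x) : ℝ) : ℂ)) (pd 0 (pd 0 φ) (t, x) : ℝ) t :=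
    (hasDerivAt_time ((hφ.pd 0).differentiableAt (mk_mem_slab ht x))).ofReal_comp
  have hode (x : Space) (t : ℝ) (ht : t ∈ Ioo τ₀ 0) : ((pd 0 (pd 0 φ) (t, x) : ℝ) : ℂ) =
      ((1 : ℕ) / (t : ℂ)) * (pd 0 φ (t, x) : ℝ) - (9 * w * t) * (φ (t, x) : ℂ) := by
    have h := (heq x).2 t ht
    rw [deriv_deriv_time hφ ht, deriv_time hφ ht, deriv_deSitterScale_div hΛ ht.2,
      scalar_potential_deSitter hΛ hρ ht.2] at h
    have h' := congrArg (fun r : ℝ => (r : ℂ)) h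
    simp only [smul_eq_mul] at h'
    have h3 := nine_mul_cubicCoeff (Λ := Λ) (ρ₀ := ρ₀)
    push_cast at h' h3 ⊢
    linear_combination h' + (t : ℂ) * (φ (t, x) : ℂ) * h3
  -- `N₀` and `N₂` are the Wronskians of the given solution with the two series, divided by `τ`.
  -- They are constant in time and inherit regularity in `x` from the slice `τ₁`; Cramer's rule then
  -- recovers `φ`.
  set N₀ : Space → ℂ := fun x =>
    ((φ (τ₁, x) : ℂ) * V₂ τ₁ - ((pd 0 φ (τ₁, x) : ℝ) : ℂ) * U₂ τ₁) / (τ₁ : ℂ) ^ 1 with hN₀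
  set N₂ : Space → ℂ := fun x =>
    ((φ (τ₁, x) : ℂ) * V₀ τ₁ - ((pd 0 φ (τ₁, x) : ℝ) : ℂ) * U₀ τ₁) / (τ₁ : ℂ) ^ 1 with hN₂
  have hNc₀ : ContDiff ℝ 2 N₀ ∧ ContDiff ℝ 2 N₂ := by
    have s1 : ContDiff ℝ 2 fun x : Space => (φ (τ₁, x) : ℂ) :=
      Complex.ofRealCLM.contDiff.comp ((hφ.slice h₁).of_le (WithTop.coe_le_coe.2 le_top))
    have s2 : ContDiff ℝ 2 fun x : Space => ((pd 0 φ (τ₁, x) : ℝ) : ℂ) :=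
      Complex.ofRealCLM.contDiff.comp (((hφ.pd 0).slice h₁).of_le (WithTop.coe_le_coe.2 le_top))
    exact ⟨((s1.mul contDiff_const).sub (s2.mul contDiff_const)).div_const _,
      ((s1.mul contDiff_const).sub (s2.mul contDiff_const)).div_const _⟩
  have hW0 : 2 * ((Complex.Gamma (1 / 3))⁻¹ * (Complex.Gamma (5 / 3))⁻¹) ≠ 0 := by
    refine mul_ne_zero two_ne_zero (mul_ne_zero (inv_ne_zero ?_) (inv_ne_zero ?_))
    · exact Complex.Gamma_ne_zero_of_re_pos (by rw [re_one_third]; norm_num)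
    · exact Complex.Gamma_ne_zero_of_re_pos (by rw [re_five_thirds]; norm_num)
  set W : ℂ := 2 * ((Complex.Gamma (1 / 3))⁻¹ * (Complex.Gamma (5 / 3))⁻¹)
  have hrep (τ : ℝ) (hτ : τ ∈ Ioo τ₀ 0) (x : Space) :
      (φ (τ, x) : ℂ) = (N₀ x / W) * U₀ τ + (-N₂ x / W) * U₂ τ := by
    have e0 : N₀ x = _ := (wronskian_div_pow_const 1 (r := fun t => 9 * w * t) (hd1 x) (hd2 x)
      (fun t _ => hasDerivAt_quadSeries t) (fun t ht => hasDerivAt_quadSeries' ht.2.ne)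
      (hode x) (fun t _ => by simp) hτ h₁).symm
    have e2 : N₂ x = _ := (wronskian_div_pow_const 1 (r := fun t => 9 * w * t) (hd1 x) (hd2 x)
      (fun t _ => hasDerivAt_evenSeries t) (fun t ht => hasDerivAt_evenSeries' ht.2.ne)
      (hode x) (fun t _ => by simp) hτ h₁).symm
    have e3 : (U₀ τ * V₂ τ - V₀ τ * U₂ τ) / (τ : ℂ) = W := wronskian_series w hτ
    have ht : (τ : ℂ) ≠ 0 := Complex.ofReal_ne_zero.2 hτ.2.ne
    rw [pow_one] at e0 e2
    clear_value N₀ N₂ W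
    rw [div_mul_eq_mul_div, div_mul_eq_mul_div, ← add_div, eq_div_iff hW0, e0, e2, ← e3]
    field_simp
    ring
  have hκ : besselPhase Λ ρ₀ ≠ 0 := Complex.exp_ne_zero _
  have hs := sin_two_thirds_pi_ne_zero
  -- These coefficients invert the linear change of basis in `besselSolution_eq`.
  refine ⟨fun x => (besselPhase Λ ρ₀ * Complex.sin ((2 / 3 : ℂ) * Real.pi) / W) * N₀ x, fun x =>
    ((besselPhase Λ ρ₀)⁻¹ / W) * N₂ x -
      (besselPhase Λ ρ₀ * Complex.cos ((2 / 3 : ℂ) * Real.pi) / W) * N₀ x,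
    contDiff_const.mul hNc₀.1,
    (contDiff_const.mul hNc₀.2).sub (contDiff_const.mul hNc₀.1), fun τ hτ x => ?_⟩
  rw [besselSolution_eq hΛ hρ hτ.2, hrep τ hτ x]
  generalize Complex.sin ((2 / 3 : ℂ) * Real.pi) = S at hs ⊢
  generalize Complex.cos ((2 / 3 : ℂ) * Real.pi) = K
  clear_value W
  congr 2
  · field_simp
  · field_simp
    ring

end bessel

end

end DustPert

namespace DustPert

noncomputable section

/-! ### Superpositions of plane waves -/

/-- The `n`-th moment of `k` is finite. -/
def HasMoment (n : ℕ) (k : Space → ℂ) : Prop := Integrable fun q => ((1 + ‖q‖) ^ n : ℝ) • k q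

namespace HasMoment
variable {n j : ℕ} {k l c : Space → ℂ}

/-- A multiplier of polynomial growth `j` costs `j` moments, which is how derivatives of plane waves
are paid for. -/
lemma mul (hk : HasMoment (n + j) k) (hc : Continuous c) {C : ℝ}
    (hb : ∀ q, ‖c q‖ ≤ C * (1 + ‖q‖) ^ j) : HasMoment n (fun q => c q * k q) := by
  have hpos (q : Space) : 0 < 1 + ‖q‖ := by positivity
  have h := Integrable.bdd_mul (f := fun q => c q * (((1 + ‖q‖) ^ j : ℝ) : ℂ)⁻¹) (c := C) hk ?_ ?_
  · refine h.congr (Eventually.of_forall fun q => ?_)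
    have h1 : (((1 + ‖q‖) ^ j : ℝ) : ℂ) ≠ 0 :=
      Complex.ofReal_ne_zero.2 (pow_ne_zero j (hpos q).ne')
    simp only [Complex.real_smul, pow_add, Complex.ofReal_mul]
    field_simp
  · refine (hc.mul (Continuous.inv₀ (by fun_prop) fun q => ?_)).aestronglyMeasurable
    exact Complex.ofReal_ne_zero.2 (pow_ne_zero j (hpos q).ne')
  · refine Eventually.of_forall fun q => ?_
    rw [norm_mul, norm_inv, Complex.norm_real, Real.norm_of_nonneg (pow_pos (hpos q) j).le,
      ← div_eq_mul_inv, div_le_iff₀ (pow_pos (hpos q) j)]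
    exact hb q

lemma mono (hk : HasMoment (n + j) k) : HasMoment n k := by
  have := hk.mul (c := fun _ => 1) continuous_const (C := 1) fun q => by
    rw [norm_one, one_mul]
    exact one_le_pow₀ (by linarith [norm_nonneg q])
  simpa using this

lemma add (hk : HasMoment n k) (hl : HasMoment n l) : HasMoment n (fun q => k q + l q) := by
  refine (Integrable.add hk hl).congr (Eventually.of_forall fun q => ?_)
  simp [smul_add]

lemma const_mul (hk : HasMoment n k) (c : ℂ) : HasMoment n (fun q => c * k q) :=
  (mul (j := 0) hk continuous_const (C := ‖c‖) fun q => by simp)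

lemma integrable (hk : HasMoment 0 k) : Integrable k := by
  simpa [HasMoment] using hk

lemma norm_mul (hk : HasMoment (n + 1) k) : HasMoment n (fun q => (‖q‖ : ℂ) * k q) :=
  hk.mul (j := 1) (by fun_prop) (C := 1) fun q => by simp

lemma coord_mul (hk : HasMoment (n + 1) k) (i : Fin 3) :
    HasMoment n (fun q => ((q i : ℝ) : ℂ) * k q) :=
  hk.mul (j := 1) (by fun_prop) (C := 1) fun q => by
    have h1 : ‖q i‖ ≤ ‖q‖ := PiLp.norm_apply_le q i
    rw [Complex.norm_real]; linarith

end HasMoment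

/-- The phase `exp(i (σ |q| τ - q · x))`. -/
def wavePhase (σ : ℝ) (q : Space) (p : Spacetime) : ℂ :=
  Complex.exp (((σ * ‖q‖ * p.1 - inner ℝ q p.2 : ℝ) : ℂ) * Complex.I)

/-- The superposition of plane waves `∫ k(q) exp(i (σ |q| τ - q · x)) dq`. -/
def planeWave (σ : ℝ) (k : Space → ℂ) (p : Spacetime) : ℂ := ∫ q : Space, wavePhase σ q p * k q

lemma norm_wavePhase (σ : ℝ) (q : Space) (p : Spacetime) : ‖wavePhase σ q p‖ = 1 :=
  Complex.norm_exp_ofReal_mul_I _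

lemma continuous_wavePhase (σ : ℝ) (p : Spacetime) : Continuous fun q => wavePhase σ q p := by
  unfold wavePhase
  fun_prop

lemma integrable_planeWave {σ : ℝ} {k : Space → ℂ} (hk : Integrable k) (p : Spacetime) :
    Integrable fun q => wavePhase σ q p * k q :=
  hk.bdd_mul (c := 1) (continuous_wavePhase σ p).aestronglyMeasurable
    (Eventually.of_forall fun q => (norm_wavePhase σ q p).le)

/-- The light cone embedding `q ↦ (σ |q|, q)`. -/
def lightCone (σ : ℝ) (q : Space) : Spacetime := (σ * ‖q‖, q)

lemma measurableEmbedding_lightCone (σ : ℝ) : MeasurableEmbedding (lightCone σ) := by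
  have hc : Continuous (lightCone σ) := by unfold lightCone; fun_prop
  exact hc.measurableEmbedding fun q r h => congrArg Prod.snd h

lemma norm_lightCone {σ : ℝ} (hσ : |σ| = 1) (q : Space) : ‖lightCone σ q‖ = ‖q‖ := by
  simp [lightCone, Prod.norm_def, hσ]

/-- The inner product of `Space` as a bilinear map. -/
def spaceInner : Space →L[ℝ] Space →L[ℝ] ℝ := innerSL ℝ

/-- The Minkowski pairing, divided by `2π`. -/
def minkowskiPairing : Spacetime →L[ℝ] Spacetime →L[ℝ] ℝ :=
  (2 * Real.pi)⁻¹ •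
    (spaceInner.bilinearComp (ContinuousLinearMap.snd ℝ ℝ Space)
        (ContinuousLinearMap.snd ℝ ℝ Space) -
      (ContinuousLinearMap.mul ℝ ℝ).bilinearComp (ContinuousLinearMap.fst ℝ ℝ Space)
        (ContinuousLinearMap.fst ℝ ℝ Space))

lemma minkowskiPairing_apply (v w : Spacetime) :
    minkowskiPairing v w = (2 * Real.pi)⁻¹ * (inner ℝ v.2 w.2 - v.1 * w.1) := by
  simp [minkowskiPairing, spaceInner]
  rfl

lemma fourierChar_minkowskiPairing (σ : ℝ) (q : Space) (p : Spacetime) :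
    (Real.fourierChar (-(minkowskiPairing (lightCone σ q) p)) : ℂ) = wavePhase σ q p := by
  rw [Real.fourierChar_apply, minkowskiPairing_apply, wavePhase]
  congr 3
  have := Real.pi_ne_zero
  simp only [lightCone]
  field_simp
  ring

section planeWave
variable {σ : ℝ} {k : Space → ℂ} {n : ℕ}

/-- The superposition is a Fourier integral over the light cone, viewed on all of spacetime. Joint
smoothness in `(τ, x)` and the derivative formula then follow from the general theory. The factor
`1/(2π)` in the pairing offsets the normalization of `Real.fourierChar`. -/
lemma planeWave_eq_fourierIntegral (σ : ℝ) (k : Space → ℂ) :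
    planeWave σ k = VectorFourier.fourierIntegral Real.fourierChar
      (Measure.map (lightCone σ) volume) (ContinuousLinearMap.toLinearMap₁₂ minkowskiPairing)
      (fun v => k v.2) := by
  funext p
  rw [VectorFourier.fourierIntegral, (measurableEmbedding_lightCone σ).integral_map, planeWave]
  refine integral_congr_ae (Eventually.of_forall fun q => ?_)
  change _ = (Real.fourierChar (-(minkowskiPairing (lightCone σ q) p)) : ℂ) * k q
  rw [fourierChar_minkowskiPairing]

lemma integrable_lightCone (hσ : |σ| = 1) {m : ℕ} (hm : m ≤ n) (hk : HasMoment n k) :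
    Integrable (fun v : Spacetime => ‖v‖ ^ m * ‖k v.2‖) (Measure.map (lightCone σ) volume) := by
  rw [(measurableEmbedding_lightCone σ).integrable_map_iff]
  obtain ⟨j, rfl⟩ := Nat.exists_eq_add_of_le hm
  have h1 : HasMoment 0 (fun q => ((‖q‖ ^ m : ℝ) : ℂ) * k q) := by
    refine HasMoment.mul (j := m) (by simpa using hk.mono) (by fun_prop) (C := 1) fun q => ?_
    rw [Complex.norm_real, norm_pow, norm_norm, one_mul]
    gcongr
    linarith
  refine h1.integrable.norm.congr (Eventually.of_forall fun q => ?_)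
  simp only [Function.comp, norm_lightCone hσ, norm_mul, Complex.norm_real, norm_pow, norm_norm]
  rfl

lemma contDiff_planeWave (hσ : |σ| = 1) (hk : HasMoment n k) : ContDiff ℝ n (planeWave σ k) := by
  rw [planeWave_eq_fourierIntegral]
  refine VectorFourier.contDiff_fourierIntegral (N := (n : ℕ∞)) minkowskiPairing fun m hm =>
    integrable_lightCone hσ (by exact_mod_cast hm) hk

lemma pd_planeWave (hσ : |σ| = 1) (hk : HasMoment 1 k) (μ : Fin 4) :
    pd μ (planeWave σ k) = planeWave σ fun q =>
      (-(((inner ℝ q (basisVec μ).2 - σ * ‖q‖ * (basisVec μ).1 : ℝ) : ℂ) * Complex.I)) * k q := by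
  have h0 : Integrable (fun v : Spacetime => k v.2) (Measure.map (lightCone σ) volume) := by
    rw [(measurableEmbedding_lightCone σ).integrable_map_iff]
    exact (HasMoment.mono (n := 0) (j := 1) hk).integrable
  have h1 : Integrable (fun v : Spacetime => ‖v‖ * ‖k v.2‖) (Measure.map (lightCone σ) volume) := by
    simpa using integrable_lightCone hσ (m := 1) le_rfl hk
  have hmeas : AEStronglyMeasurable (fun v : Spacetime => k v.2)
      (Measure.map (lightCone σ) volume) := h0.1
  have hint : Integrable (VectorFourier.fourierSMulRight minkowskiPairing
      (fun v : Spacetime => k v.2)) (Measure.map (lightCone σ) volume) := by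
    refine (h1.const_mul (2 * Real.pi * ‖minkowskiPairing‖)).mono' hmeas.fourierSMulRight
      (Eventually.of_forall fun v => ?_)
    rw [← mul_assoc]
    exact VectorFourier.norm_fourierSMulRight_le _ _ _
  have hd : fderiv ℝ (planeWave σ k) = _ :=
    (congrArg (fderiv ℝ) (planeWave_eq_fourierIntegral σ k)).trans
      (VectorFourier.fderiv_fourierIntegral minkowskiPairing h0 h1)
  funext p
  rw [pd, hd, Real.fourierIntegral_continuousLinearMap_apply' hint, VectorFourier.fourierIntegral,
    (measurableEmbedding_lightCone σ).integral_map, planeWave]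
  refine integral_congr_ae (Eventually.of_forall fun q => ?_)
  have hπ := Complex.ofReal_ne_zero.2 Real.pi_ne_zero
  change (Real.fourierChar (-(minkowskiPairing (lightCone σ q) p)) : ℂ) *
    VectorFourier.fourierSMulRight minkowskiPairing (fun v : Spacetime => k v.2)
      (lightCone σ q) (basisVec μ) = _
  rw [fourierChar_minkowskiPairing, VectorFourier.fourierSMulRight_apply, minkowskiPairing_apply]
  congr 1
  simp only [lightCone, Complex.real_smul, smul_eq_mul]
  push_cast
  field_simp

end planeWave

end

end DustPert

namespace DustPert

noncomputable section

/-! ### Explicit tensor modes -/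

/-- A solution of the wave equation with given positive and negative frequency amplitudes. -/
def pairWave (k₁ k₂ : Space → ℂ) (p : Spacetime) : ℂ := planeWave 1 k₁ p + planeWave (-1) k₂ p

section pairWave
variable {k₁ k₂ : Space → ℂ} {n : ℕ}

lemma contDiff_pairWave (h₁ : HasMoment n k₁) (h₂ : HasMoment n k₂) :
    ContDiff ℝ n (pairWave k₁ k₂) :=
  (contDiff_planeWave (by simp) h₁).add (contDiff_planeWave (by simp) h₂)

lemma pd_pairWave (h₁ : HasMoment 1 k₁) (h₂ : HasMoment 1 k₂) (μ : Fin 4) :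
    pd μ (pairWave k₁ k₂) = pairWave
      (fun q => (-(((inner ℝ q (basisVec μ).2 - 1 * ‖q‖ * (basisVec μ).1 : ℝ) : ℂ) *
        Complex.I)) * k₁ q)
      (fun q => (-(((inner ℝ q (basisVec μ).2 - (-1) * ‖q‖ * (basisVec μ).1 : ℝ) : ℂ) *
        Complex.I)) * k₂ q) := by
  funext p
  have d1 : DifferentiableAt ℝ (planeWave 1 k₁) p :=
    ((contDiff_planeWave (by simp) h₁).differentiable (by simp)) p
  have d2 : DifferentiableAt ℝ (planeWave (-1) k₂) p :=
    ((contDiff_planeWave (by simp) h₂).differentiable (by simp)) p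
  have e : pd μ (pairWave k₁ k₂) p = pd μ (planeWave 1 k₁) p + pd μ (planeWave (-1) k₂) p := by
    have := fderiv_fun_add d1 d2
    simp only [pd]
    change fderiv ℝ (fun q => planeWave 1 k₁ q + planeWave (-1) k₂ q) p _ = _
    rw [this]; rfl
  rw [e, pd_planeWave (by simp) h₁, pd_planeWave (by simp) h₂, pairWave]

lemma pd_zero_pairWave (h₁ : HasMoment 1 k₁) (h₂ : HasMoment 1 k₂) :
    pd 0 (pairWave k₁ k₂) = pairWave (fun q => Complex.I * ((‖q‖ : ℂ) * k₁ q))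
      (fun q => -Complex.I * ((‖q‖ : ℂ) * k₂ q)) := by
  rw [pd_pairWave h₁ h₂]
  congr 1 <;> funext q <;> simp [basisVec_zero] <;> ring

lemma sd_pairWave (h₁ : HasMoment 1 k₁) (h₂ : HasMoment 1 k₂) (i : Fin 3) :
    sd i (pairWave k₁ k₂) = pairWave (fun q => -Complex.I * (((q i : ℝ) : ℂ) * k₁ q))
      (fun q => -Complex.I * (((q i : ℝ) : ℂ) * k₂ q)) := by
  rw [sd_eq_pd, pd_pairWave h₁ h₂]
  congr 1 <;> funext q <;>
    simp [basisVec_succ, EuclideanSpace.inner_single_right] <;> ring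

lemma pd_zero_pd_zero_pairWave (h₁ : HasMoment 2 k₁) (h₂ : HasMoment 2 k₂) :
    pd 0 (pd 0 (pairWave k₁ k₂)) = pairWave (fun q => -((‖q‖ : ℂ) * ((‖q‖ : ℂ) * k₁ q)))
      (fun q => -((‖q‖ : ℂ) * ((‖q‖ : ℂ) * k₂ q))) := by
  rw [pd_zero_pairWave (HasMoment.mono (n := 1) (j := 1) h₁) (HasMoment.mono (n := 1) (j := 1) h₂),
    pd_zero_pairWave (HasMoment.norm_mul (n := 1) h₁ |>.const_mul _)
      (HasMoment.norm_mul (n := 1) h₂ |>.const_mul _)]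
  congr 1 <;> funext q
  · linear_combination ((‖q‖ : ℂ) * ((‖q‖ : ℂ) * k₁ q)) * Complex.I_mul_I
  · linear_combination ((‖q‖ : ℂ) * ((‖q‖ : ℂ) * k₂ q)) * Complex.I_mul_I

/-- On the light cone `∑ q_i² = |q|²`, so both sides multiply the amplitudes by `-|q|²`. -/
lemma lap_pairWave (h₁ : HasMoment 2 k₁) (h₂ : HasMoment 2 k₂) :
    lap (pairWave k₁ k₂) = pd 0 (pd 0 (pairWave k₁ k₂)) := by
  have hs (i : Fin 3) : sd i (sd i (pairWave k₁ k₂)) =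
      pairWave (fun q => -(((q i : ℝ) : ℂ) * (((q i : ℝ) : ℂ) * k₁ q)))
        (fun q => -(((q i : ℝ) : ℂ) * (((q i : ℝ) : ℂ) * k₂ q))) := by
    rw [sd_pairWave (HasMoment.mono (n := 1) (j := 1) h₁) (HasMoment.mono (n := 1) (j := 1) h₂),
      sd_pairWave (HasMoment.coord_mul (n := 1) h₁ i |>.const_mul _)
        (HasMoment.coord_mul (n := 1) h₂ i |>.const_mul _)]
    congr 1 <;> funext q
    · linear_combination (((q i : ℝ) : ℂ) * (((q i : ℝ) : ℂ) * k₁ q)) * Complex.I_mul_I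
    · linear_combination (((q i : ℝ) : ℂ) * (((q i : ℝ) : ℂ) * k₂ q)) * Complex.I_mul_I
  have key (σ : ℝ) {k : Space → ℂ} (h : HasMoment 2 k) (p : Spacetime) :
      ∑ i : Fin 3, planeWave σ (fun q => -(((q i : ℝ) : ℂ) * (((q i : ℝ) : ℂ) * k q))) p =
        planeWave σ (fun q => -((‖q‖ : ℂ) * ((‖q‖ : ℂ) * k q))) p := by
    have hint (i : Fin 3) : Integrable fun q : Space =>
        -(((q i : ℝ) : ℂ) * (((q i : ℝ) : ℂ) * k q)) :=
      (HasMoment.integrable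
        (HasMoment.coord_mul (n := 0) (HasMoment.coord_mul (n := 1) h i) i)).neg
    simp only [planeWave]
    rw [← integral_finsetSum _ fun i _ => integrable_planeWave (hint i) p]
    refine integral_congr_ae (Eventually.of_forall fun q => ?_)
    have hn : (‖q‖ : ℂ) * ‖q‖ = ∑ i, ((q i : ℝ) : ℂ) * (q i : ℝ) := by
      have := EuclideanSpace.real_norm_sq_eq q
      rw [← Complex.ofReal_mul, ← pow_two, this]
      push_cast
      simp [pow_two]
    simp only [Fin.sum_univ_three] at hn ⊢
    linear_combination (wavePhase σ q p * k q) * hn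
  funext p
  rw [pd_zero_pd_zero_pairWave h₁ h₂]
  simp only [lap, hs, pairWave, Finset.sum_add_distrib, key _ h₁, key _ h₂]

end pairWave

lemma pd_sub_time_mul {A B : Spacetime → ℂ} (hA : Differentiable ℝ A) (hB : Differentiable ℝ B)
    (μ : Fin 4) : pd μ (fun p => A p - (p.1 : ℂ) * B p) = fun p =>
      pd μ A p - (((basisVec μ).1 : ℂ) * B p + (p.1 : ℂ) * pd μ B p) := by
  funext p
  have h1 : HasFDerivAt (fun p : Spacetime => (p.1 : ℂ))
      (Complex.ofRealCLM.comp (ContinuousLinearMap.fst ℝ ℝ Space)) p :=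
    Complex.ofRealCLM.hasFDerivAt.comp p hasFDerivAt_fst
  have h := (hA p).hasFDerivAt.sub (h1.mul (hB p).hasFDerivAt)
  have e : fderiv ℝ (fun p => A p - (p.1 : ℂ) * B p) p = _ := h.fderiv
  simp only [pd, e]
  simp
  ring

/-- `G - τ G'` solves the tensor equation in de Sitter spacetime if `G` solves the wave equation. -/
lemma tensorModeEq_pairWave {Λ : ℝ} (hΛ : 0 < Λ) (τ₀ : ℝ) {k₁ k₂ : Space → ℂ}
    (h₁ : HasMoment 3 k₁) (h₂ : HasMoment 3 k₂) :
    TensorModeEq τ₀ (deSitterScale Λ)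
      (fun p => pairWave k₁ k₂ p - (p.1 : ℂ) * pd 0 (pairWave k₁ k₂) p) := by
  have m₁ := HasMoment.mono (n := 1) (j := 2) h₁
  have m₂ := HasMoment.mono (n := 1) (j := 2) h₂
  have w₁ := HasMoment.mono (n := 2) (j := 1) h₁
  have w₂ := HasMoment.mono (n := 2) (j := 1) h₂
  have d₁ := (HasMoment.norm_mul (n := 2) h₁).const_mul Complex.I
  have d₂ := (HasMoment.norm_mul (n := 2) h₂).const_mul (-Complex.I)
  set G := pairWave k₁ k₂ with hG
  have hG' : pd 0 G = pairWave (fun q => Complex.I * ((‖q‖ : ℂ) * k₁ q))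
      (fun q => -Complex.I * ((‖q‖ : ℂ) * k₂ q)) := pd_zero_pairWave m₁ m₂
  have cG : ContDiff ℝ 2 G := contDiff_pairWave w₁ w₂
  have cG' : ContDiff ℝ 2 (pd 0 G) := by rw [hG']; exact contDiff_pairWave d₁ d₂
  have dG := cG.differentiable (by simp)
  have dG' := cG'.differentiable (by simp)
  have hpd {f : Spacetime → ℂ} (hf : ContDiff ℝ 2 f) (μ : Fin 4) : Differentiable ℝ (pd μ f) := by
    have h1 : ContDiff ℝ 1 (fderiv ℝ f) := hf.fderiv_right (by norm_num)
    exact (h1.differentiable (by simp)).clm_apply (differentiable_const _)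
  -- The first derivative is `-τ G''`, so the friction term `-(2/τ) f'` equals `2 G''`. This
  -- balances the `-G''` from `f''` and from `-Δf`, while the `τ G'''` terms cancel; the third
  -- derivative accounts for the three moments.
  have e1 : pd 0 (fun p => G p - (p.1 : ℂ) * pd 0 G p) =
      fun p => 0 - (p.1 : ℂ) * pd 0 (pd 0 G) p := by
    rw [pd_sub_time_mul dG dG' 0]
    funext p
    simp [basisVec_zero]
  have e2 : pd 0 (pd 0 (fun p => G p - (p.1 : ℂ) * pd 0 G p)) =
      fun p => -pd 0 (pd 0 G) p - (p.1 : ℂ) * pd 0 (pd 0 (pd 0 G)) p := by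
    rw [e1, pd_sub_time_mul (A := fun _ => 0) (differentiable_const _) (hpd cG' 0) 0]
    funext p
    simp [basisVec_zero, pd]
    ring
  have e3 (i : Fin 3) : sd i (fun p => G p - (p.1 : ℂ) * pd 0 G p) =
      fun p => sd i G p - (p.1 : ℂ) * sd i (pd 0 G) p := by
    rw [sd_eq_pd, pd_sub_time_mul dG dG' i.succ]
    funext p
    simp [basisVec_succ, sd]
  have e4 (i : Fin 3) : sd i (sd i (fun p => G p - (p.1 : ℂ) * pd 0 G p)) =
      fun p => sd i (sd i G) p - (p.1 : ℂ) * sd i (sd i (pd 0 G)) p := by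
    have h := pd_sub_time_mul (A := sd i G) (B := sd i (pd 0 G)) (hpd cG i.succ)
      (hpd cG' i.succ) i.succ
    rw [e3, sd_eq_pd, h]
    funext p
    simp [basisVec_succ, sd]
  have e5 (p : Spacetime) : lap (fun p => G p - (p.1 : ℂ) * pd 0 G p) p =
      pd 0 (pd 0 G) p - (p.1 : ℂ) * pd 0 (pd 0 (pd 0 G)) p := by
    have l1 : lap G p = pd 0 (pd 0 G) p := congrFun (lap_pairWave w₁ w₂) p
    have l2 : lap (pd 0 G) p = pd 0 (pd 0 (pd 0 G)) p := by
      rw [hG']; exact congrFun (lap_pairWave d₁ d₂) p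
    rw [← l1, ← l2]
    simp only [lap, e4, Finset.sum_sub_distrib, Finset.mul_sum]
  refine ⟨(cG.sub ((Complex.ofRealCLM.contDiff.comp contDiff_fst).mul cG')).contDiffOn,
    fun p hp => ?_⟩
  have hp0 : (p.1 : ℂ) ≠ 0 := Complex.ofReal_ne_zero.2 hp.1.2.ne
  rw [e5, e2, e1, deriv_deSitterScale_div hΛ hp.1.2]
  simp only [Complex.real_smul]
  push_cast
  field_simp
  ring

/-- The amplitudes `(F ∓ iK)/2` make `G` a superposition of `F cos qτ + K sin qτ`; applying `G - τ
G'` produces the stated combinations. -/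
lemma tensorFourierIntegral_eq {K F : Space → ℂ} (hK : HasMoment 1 K) (hF : HasMoment 1 F) :
    tensorFourierIntegral K F = fun p =>
      pairWave (fun q => -Complex.I / 2 * K q + 1 / 2 * F q)
        (fun q => Complex.I / 2 * K q + 1 / 2 * F q) p -
      (p.1 : ℂ) * pd 0 (pairWave (fun q => -Complex.I / 2 * K q + 1 / 2 * F q)
        (fun q => Complex.I / 2 * K q + 1 / 2 * F q)) p := by
  have h₁ : HasMoment 1 fun q => -Complex.I / 2 * K q + 1 / 2 * F q :=
    (hK.const_mul _).add (hF.const_mul _)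
  have h₂ : HasMoment 1 fun q => Complex.I / 2 * K q + 1 / 2 * F q :=
    (hK.const_mul _).add (hF.const_mul _)
  funext p
  rw [pd_zero_pairWave h₁ h₂]
  have i1 := integrable_planeWave (σ := 1) (HasMoment.mono (n := 0) (j := 1) h₁).integrable p
  have i2 := integrable_planeWave (σ := -1) (HasMoment.mono (n := 0) (j := 1) h₂).integrable p
  have i3 := integrable_planeWave (σ := 1)
    ((HasMoment.norm_mul (n := 0) h₁).const_mul Complex.I).integrable p
  have i4 := integrable_planeWave (σ := -1)
    ((HasMoment.norm_mul (n := 0) h₂).const_mul (-Complex.I)).integrable p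
  simp only [pairWave, planeWave, tensorFourierIntegral]
  rw [← integral_add i1 i2, ← integral_add i3 i4, ← integral_const_mul]
  refine Eq.trans (integral_congr_ae (Eventually.of_forall fun q => ?_))
    (integral_sub (i1.add i2) ((i3.add i4).const_mul _))
  have hph (σ : ℝ) : wavePhase σ q p = Complex.exp ((σ * ‖q‖ * p.1 : ℝ) * Complex.I) *
      Complex.exp (-Complex.I * (inner ℝ q p.2 : ℝ)) := by
    rw [wavePhase, ← Complex.exp_add]; congr 1; push_cast; ring
  have e1 : Complex.exp ((1 * ‖q‖ * p.1 : ℝ) * Complex.I) =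
      Complex.cos ((‖q‖ * p.1 : ℝ) : ℂ) + Complex.sin ((‖q‖ * p.1 : ℝ) : ℂ) * Complex.I := by
    rw [one_mul, Complex.exp_mul_I]
  have e2 : Complex.exp ((-1 * ‖q‖ * p.1 : ℝ) * Complex.I) =
      Complex.cos ((‖q‖ * p.1 : ℝ) : ℂ) - Complex.sin ((‖q‖ * p.1 : ℝ) : ℂ) * Complex.I := by
    rw [show (-1 * ‖q‖ * p.1 : ℝ) = -(‖q‖ * p.1) by ring, Complex.ofReal_neg, Complex.exp_mul_I,
      Complex.cos_neg, Complex.sin_neg]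
    ring
  simp only [hph, e1, e2, tensorFourierMode]
  push_cast
  generalize Complex.exp (-Complex.I * (inner ℝ q p.2 : ℝ)) = E
  generalize Complex.cos ((‖q‖ : ℂ) * (p.1 : ℂ)) = c
  generalize Complex.sin ((‖q‖ : ℂ) * (p.1 : ℂ)) = s
  linear_combination (E * (K q * (s - ‖q‖ * p.1 * c) + F q * (‖q‖ * p.1 * s))) * Complex.I_mul_I

/-- Superpositions of explicit tensor modes solve the tensor equation. -/
theorem tensorFourierIntegral_tensorMode {Λ : ℝ} (hΛ : 0 < Λ) (τ₀ : ℝ) {K F : Space → ℂ}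
    (hK : HasMoment 3 K) (hF : HasMoment 3 F) :
    TensorModeEq τ₀ (deSitterScale Λ) (tensorFourierIntegral K F) := by
  rw [tensorFourierIntegral_eq (HasMoment.mono (n := 1) (j := 2) hK)
    (HasMoment.mono (n := 1) (j := 2) hF)]
  exact tensorModeEq_pairWave hΛ τ₀ ((hK.const_mul _).add (hF.const_mul _))
    ((hK.const_mul _).add (hF.const_mul _))

lemma norm_tensorFourierMode_le {K F : ℂ} {q τ : ℝ} (hq : 0 ≤ q) (hτ : |τ| ≤ 1) :
    ‖tensorFourierMode K F q τ‖ ≤ (1 + q) * ‖K‖ + (1 + q) * ‖F‖ := by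
  have hqτ : |q * τ| ≤ q := by
    rw [abs_mul, abs_of_nonneg hq]; exact mul_le_of_le_one_right hq hτ
  have h1 : |Real.sin (q * τ) - q * τ * Real.cos (q * τ)| ≤ 1 + q := by
    refine (abs_sub _ _).trans (add_le_add (Real.abs_sin_le_one _) ?_)
    rw [abs_mul]
    exact (mul_le_of_le_one_right (abs_nonneg _) (Real.abs_cos_le_one _)).trans hqτ
  have h2 : |Real.cos (q * τ) + q * τ * Real.sin (q * τ)| ≤ 1 + q := by
    refine (abs_add_le _ _).trans (add_le_add (Real.abs_cos_le_one _) ?_)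
    rw [abs_mul]
    exact (mul_le_of_le_one_right (abs_nonneg _) (Real.abs_sin_le_one _)).trans hqτ
  rw [tensorFourierMode]
  refine (norm_add_le _ _).trans ?_
  rw [norm_mul, norm_mul, Complex.norm_real, Complex.norm_real, mul_comm ‖K‖, mul_comm ‖F‖]
  gcongr
  · exact h1
  · exact h2

/-- Late-time limit of superpositions of explicit tensor modes. -/
theorem tensorFourierIntegral_tendsto {K F : Space → ℂ} (hK : HasMoment 1 K)
    (hF : HasMoment 1 F) :
    TendstoLocallyUniformly (fun (τ : ℝ) (x : Space) => tensorFourierIntegral K F (τ, x))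
      (fun x => ∫ q : Space, F q * Complex.exp (-Complex.I * (inner ℝ q x : ℝ))) (𝓝[<] 0) := by
  have hKi := (HasMoment.mono (n := 0) (j := 1) hK).integrable
  have hFi := (HasMoment.mono (n := 0) (j := 1) hF).integrable
  have hexp (q x : Space) : ‖Complex.exp (-Complex.I * (inner ℝ q x : ℝ))‖ = 1 := by
    rw [show -Complex.I * (inner ℝ q x : ℝ) = ((-inner ℝ q x : ℝ) : ℂ) * Complex.I by
      push_cast; ring]
    exact Complex.norm_exp_ofReal_mul_I _
  have hbound : Integrable fun q : Space => (1 + ‖q‖) * ‖K q‖ + (1 + ‖q‖) * ‖F q‖ := by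
    have h (k : Space → ℂ) (hk : HasMoment 1 k) : Integrable fun q => (1 + ‖q‖) * ‖k q‖ := by
      refine hk.norm.congr (Eventually.of_forall fun q => ?_)
      simp only [pow_one, norm_smul]
      rw [Real.norm_of_nonneg (by positivity)]
    exact (h K hK).add (h F hF)
  rw [tendstoLocallyUniformly_iff_forall_tendsto]
  intro x₀
  have hmeas (p : Spacetime) : AEStronglyMeasurable (fun q : Space =>
      tensorFourierMode (K q) (F q) ‖q‖ p.1 * Complex.exp (-Complex.I * (inner ℝ q p.2 : ℝ)))
      volume := by
    unfold tensorFourierMode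
    refine ((hKi.1.mul ?_).add (hFi.1.mul ?_)).mul ?_ <;>
      exact Continuous.aestronglyMeasurable (by fun_prop)
  refine tendsto_uniformity_of_tendsto
    (b := ∫ q : Space, F q * Complex.exp (-Complex.I * (inner ℝ q x₀ : ℝ))) ?_ ?_
  · have : Continuous fun x : Space =>
        ∫ q : Space, F q * Complex.exp (-Complex.I * (inner ℝ q x : ℝ)) := by
      refine continuous_of_dominated (bound := fun q => ‖F q‖) (fun x => ?_) (fun x => ?_)
        hFi.norm (Eventually.of_forall fun q => by fun_prop)
      · exact hFi.1.mul (Continuous.aestronglyMeasurable (by fun_prop))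
      · exact Eventually.of_forall fun q => by rw [norm_mul, hexp, mul_one]
    exact (this.tendsto x₀).comp tendsto_snd
  · have hle : (𝓝[<] (0 : ℝ) ×ˢ 𝓝 x₀) ≤ 𝓝 ((0 : ℝ), x₀) := by
      rw [nhds_prod_eq]; exact prod_mono nhdsWithin_le_nhds le_rfl
    -- The limit is taken jointly in `(τ, x)`, which yields local uniformity. For `|τ| ≤ 1` the
    -- amplitudes grow at most linearly in `q`, so one moment dominates.
    refine tendsto_integral_filter_of_dominated_convergence
      (fun q => (1 + ‖q‖) * ‖K q‖ + (1 + ‖q‖) * ‖F q‖)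
      (Eventually.of_forall fun p => hmeas p) ?_ hbound (Eventually.of_forall fun q => ?_)
    · have hev : ∀ᶠ p in 𝓝 ((0 : ℝ), x₀), |p.1| < 1 := by
        have hc : ContinuousAt (fun p : ℝ × Space => |p.1|) ((0 : ℝ), x₀) := by fun_prop
        exact hc.eventually (Iio_mem_nhds (by simp))
      filter_upwards [hle hev] with p hp
      refine Eventually.of_forall fun q => ?_
      rw [norm_mul, hexp, mul_one]
      exact norm_tensorFourierMode_le (norm_nonneg q) hp.le
    · have hc : Continuous fun p : Spacetime => tensorFourierMode (K q) (F q) ‖q‖ p.1 *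
          Complex.exp (-Complex.I * (inner ℝ q p.2 : ℝ)) := by
        unfold tensorFourierMode
        fun_prop
      have h0 := (hc.tendsto ((0 : ℝ), x₀)).mono_left hle
      simpa [tensorFourierMode] using h0

/-! #### One Fourier mode -/

section mode
variable {q : ℝ}

lemma hasDerivAt_sinMode (t : ℝ) : HasDerivAt
    (fun t : ℝ => ((Real.sin (q * t) - q * t * Real.cos (q * t) : ℝ) : ℂ))
    ((q ^ 2 * t * Real.sin (q * t) : ℝ) : ℂ) t := by
  have h0 : HasDerivAt (fun t : ℝ => q * t) q t := by
    simpa using (hasDerivAt_id t).const_mul q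
  refine ((h0.sin.sub (h0.mul h0.cos)).congr_deriv ?_).ofReal_comp
  ring

lemma hasDerivAt_sinMode' (t : ℝ) : HasDerivAt
    (fun t : ℝ => ((q ^ 2 * t * Real.sin (q * t) : ℝ) : ℂ))
    ((q ^ 2 * Real.sin (q * t) + q ^ 3 * t * Real.cos (q * t) : ℝ) : ℂ) t := by
  have h0 : HasDerivAt (fun t : ℝ => q * t) q t := by
    simpa using (hasDerivAt_id t).const_mul q
  have h1 : HasDerivAt (fun t : ℝ => q ^ 2 * t) (q ^ 2) t := by
    simpa using (hasDerivAt_id t).const_mul (q ^ 2)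
  refine ((h1.mul h0.sin).congr_deriv ?_).ofReal_comp
  ring

lemma hasDerivAt_cosMode (t : ℝ) : HasDerivAt
    (fun t : ℝ => ((Real.cos (q * t) + q * t * Real.sin (q * t) : ℝ) : ℂ))
    ((q ^ 2 * t * Real.cos (q * t) : ℝ) : ℂ) t := by
  have h0 : HasDerivAt (fun t : ℝ => q * t) q t := by
    simpa using (hasDerivAt_id t).const_mul q
  refine ((h0.cos.add (h0.mul h0.sin)).congr_deriv ?_).ofReal_comp
  ring

lemma hasDerivAt_cosMode' (t : ℝ) : HasDerivAt
    (fun t : ℝ => ((q ^ 2 * t * Real.cos (q * t) : ℝ) : ℂ))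
    ((q ^ 2 * Real.cos (q * t) - q ^ 3 * t * Real.sin (q * t) : ℝ) : ℂ) t := by
  have h0 : HasDerivAt (fun t : ℝ => q * t) q t := by
    simpa using (hasDerivAt_id t).const_mul q
  have h1 : HasDerivAt (fun t : ℝ => q ^ 2 * t) (q ^ 2) t := by
    simpa using (hasDerivAt_id t).const_mul (q ^ 2)
  refine ((h1.mul h0.cos).congr_deriv ?_).ofReal_comp
  ring

/-- The solutions of the tensor equation for one Fourier mode in de Sitter spacetime. -/
theorem fourierModeEq_iff {Λ τ₀ : ℝ} (hΛ : 0 < Λ) (hτ₀ : τ₀ < 0) (hq : 0 < q) (f : ℝ → ℂ) :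
    FourierModeEq τ₀ (deSitterScale Λ) q f ↔
      ∃ K F : ℂ, ∀ τ ∈ Ioo τ₀ 0, f τ = tensorFourierMode K F q τ := by
  constructor
  · rintro ⟨hf, heq⟩
    obtain ⟨τ₁, h₁⟩ : (Ioo τ₀ 0).Nonempty := nonempty_Ioo.2 hτ₀
    have hd1 : ∀ t ∈ Ioo τ₀ 0, HasDerivAt f (deriv f t) t := fun t ht =>
      ((hf.contDiffAt (isOpen_Ioo.mem_nhds ht)).differentiableAt (by simp)).hasDerivAt
    have hf' : ContDiffOn ℝ 1 (deriv f) (Ioo τ₀ 0) :=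
      hf.deriv_of_isOpen isOpen_Ioo (by norm_num)
    have hd2 : ∀ t ∈ Ioo τ₀ 0, HasDerivAt (deriv f) (deriv (deriv f) t) t := fun t ht =>
      ((hf'.contDiffAt (isOpen_Ioo.mem_nhds ht)).differentiableAt (by simp)).hasDerivAt
    have ef : ∀ t ∈ Ioo τ₀ 0, deriv (deriv f) t =
        ((2 : ℕ) / (t : ℂ)) * deriv f t - ((q ^ 2 : ℝ) : ℂ) * f t := fun t ht => by
      have h := heq t ht
      rw [deriv_deSitterScale_div hΛ ht.2] at h
      simp only [Complex.real_smul] at h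
      push_cast at h ⊢
      linear_combination h
    -- The friction coefficient is `-2/τ`, so Wronskians are multiples of `τ²`.
    have hs (t : ℝ) (ht : t ∈ Ioo τ₀ 0) := wronskian_div_pow_const 2
      (r := fun _ => ((q ^ 2 : ℝ) : ℂ)) hd1 hd2
      (fun t _ => hasDerivAt_sinMode (q := q) t) (fun t _ => hasDerivAt_sinMode' (q := q) t) ef
      (fun t ht => by
        have : (t : ℂ) ≠ 0 := Complex.ofReal_ne_zero.2 ht.2.ne
        push_cast; field_simp; ring) ht h₁
    have hc (t : ℝ) (ht : t ∈ Ioo τ₀ 0) := wronskian_div_pow_const 2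
      (r := fun _ => ((q ^ 2 : ℝ) : ℂ)) hd1 hd2
      (fun t _ => hasDerivAt_cosMode (q := q) t) (fun t _ => hasDerivAt_cosMode' (q := q) t) ef
      (fun t ht => by
        have : (t : ℂ) ≠ 0 := Complex.ofReal_ne_zero.2 ht.2.ne
        push_cast; field_simp; ring) ht h₁
    -- Cramer's rule: the sine and cosine modes have Wronskian `-q³ τ²`, which explains the sign,
    -- the division by `q³` and the need for `q ≠ 0`.
    refine ⟨-((f τ₁ * ((q ^ 2 * τ₁ * Real.cos (q * τ₁) : ℝ) : ℂ) - deriv f τ₁ *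
        ((Real.cos (q * τ₁) + q * τ₁ * Real.sin (q * τ₁) : ℝ) : ℂ)) / (τ₁ : ℂ) ^ 2) / (q : ℂ) ^ 3,
      ((f τ₁ * ((q ^ 2 * τ₁ * Real.sin (q * τ₁) : ℝ) : ℂ) - deriv f τ₁ *
        ((Real.sin (q * τ₁) - q * τ₁ * Real.cos (q * τ₁) : ℝ) : ℂ)) / (τ₁ : ℂ) ^ 2) / (q : ℂ) ^ 3,
      fun τ hτ => ?_⟩
    rw [← hs τ hτ, ← hc τ hτ, tensorFourierMode]
    have ht : (τ : ℂ) ≠ 0 := Complex.ofReal_ne_zero.2 hτ.2.ne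
    have hq' : (q : ℂ) ≠ 0 := Complex.ofReal_ne_zero.2 hq.ne'
    have hsc := Complex.sin_sq_add_cos_sq ((q : ℂ) * τ)
    push_cast
    field_simp
    linear_combination (-f τ * (q : ℂ) ^ 3 * (τ : ℂ) ^ 2) * hsc
  · rintro ⟨K, F, hKF⟩
    have hg : ContDiff ℝ 2 (tensorFourierMode K F q) := by
      have h1 : ContDiff ℝ 2 fun t : ℝ => Real.sin (q * t) - q * t * Real.cos (q * t) := by
        fun_prop
      have h2 : ContDiff ℝ 2 fun t : ℝ => Real.cos (q * t) + q * t * Real.sin (q * t) := by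
        fun_prop
      exact (contDiff_const.mul (Complex.ofRealCLM.contDiff.comp h1)).add
        (contDiff_const.mul (Complex.ofRealCLM.contDiff.comp h2))
    have e1 : deriv (tensorFourierMode K F q) = fun t =>
        K * ((q ^ 2 * t * Real.sin (q * t) : ℝ) : ℂ) +
        F * ((q ^ 2 * t * Real.cos (q * t) : ℝ) : ℂ) := funext fun t =>
      (((hasDerivAt_sinMode t).const_mul K).add ((hasDerivAt_cosMode t).const_mul F)).deriv
    refine ⟨hg.contDiffOn.congr hKF, fun τ hτ => ?_⟩
    have h1 : f =ᶠ[𝓝 τ] tensorFourierMode K F q := by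
      filter_upwards [isOpen_Ioo.mem_nhds hτ] with t ht using hKF t ht
    have h2 := (((hasDerivAt_sinMode' (q := q) τ).const_mul K).add
      ((hasDerivAt_cosMode' (q := q) τ).const_mul F)).deriv
    rw [h1.deriv.deriv_eq, h1.deriv_eq, hKF τ hτ, e1]
    erw [h2]
    rw [deriv_deSitterScale_div hΛ hτ.2, tensorFourierMode]
    have ht : (τ : ℂ) ≠ 0 := Complex.ofReal_ne_zero.2 hτ.2.ne
    simp only [Complex.real_smul]
    push_cast
    field_simp
    ring

end mode

end

end DustPert

/-! ### Assembly of the background, perturbation, mode and explicit-solution results -/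

theorem proposition1 (Λ τ₀ : ℝ) (hΛ : 0 < Λ) (hτ₀ : τ₀ < 0) :
    -- exact dust backgrounds
    (∀ a ρ : ℝ → ℝ, DustPert.IsDustBackground Λ τ₀ a ρ →
      -- the asymptotic form of the background
      ((∃ ρ₀ : ℝ, 0 < ρ₀ ∧ ∀ τ ∈ Ioo τ₀ 0, ρ τ = ρ₀ / a τ ^ 3) ∧
        Tendsto (fun τ => a τ / DustPert.deSitterScale Λ τ) (𝓝[<] 0) (𝓝 1)) ∧
      -- the linearly perturbed metric approaches de Sitter
      (∀ (γ : DustPert.Spacetime → Matrix (Fin 3) (Fin 3) ℝ) (ρ₁ : DustPert.Spacetime → ℝ),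
        (∀ i j, ContDiffOn ℝ ∞ (fun p => γ p i j) (DustPert.slab τ₀)) →
        (∀ p ∈ DustPert.slab τ₀, (γ p).IsSymm) →
        DustPert.SolvesLinearizedEinstein Λ τ₀ a ρ γ ρ₁ →
        ∃ γlim : DustPert.Space → Matrix (Fin 3) (Fin 3) ℝ,
          Continuous γlim ∧
          (∀ i j, TendstoLocallyUniformly
            (fun (τ : ℝ) (x : DustPert.Space) => γ (τ, x) i j) (fun x => γlim x i j) (𝓝[<] 0)) ∧
          (∀ (ε : ℝ) (x₀ : DustPert.Space), (1 + ε • γlim x₀).PosDef →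
            DustPert.ApproachesDeSitterAt Λ (DustPert.perturbedMetric a γ ε) x₀) ∧
          (∀ S : Set DustPert.Space, IsCompact S → ∃ ε₀ : ℝ, 0 < ε₀ ∧
            ∀ ε : ℝ, |ε| < ε₀ → ∀ x ∈ S, (1 + ε • γlim x).PosDef)) ∧
      -- the modes of a perturbation that satisfies the Einstein equations
      (∀ (φ χ : DustPert.Spacetime → ℝ) (Z : DustPert.Spacetime → Fin 3 → ℝ)
        (π : DustPert.Spacetime → Matrix (Fin 3) (Fin 3) ℝ) (ρ₁ : DustPert.Spacetime → ℝ),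
        DustPert.IsModeDecomposition τ₀ φ χ Z π →
        DustPert.SolvesLinearizedEinstein Λ τ₀ a ρ (DustPert.modeSum φ χ Z π) ρ₁ →
        (∃ D : DustPert.Space → ℝ,
          (∀ τ ∈ Ioo τ₀ 0, ∀ x, ρ₁ (τ, x) = 3 * ρ τ * (φ (τ, x) + D x)) ∧
          ∀ x, DustPert.ScalarModeEq τ₀ a ρ (fun τ => φ (τ, x) + D x)) ∧
        (∀ i, ∀ p ∈ DustPert.slab τ₀, DustPert.pd 0 (fun q => Z q i) p = 0) ∧
        (∀ i j, DustPert.TensorModeEq τ₀ a (fun p => π p i j)) ∧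
        DustPert.TendsToConstantInTime φ ∧
        (∀ i, DustPert.TendsToConstantInTime (fun p => Z p i)) ∧
        (∀ i j, DustPert.TendsToConstantInTime (fun p => π p i j))) ∧
      -- all solutions of the three mode equations
      (∀ φ : DustPert.Spacetime → ℝ, ContDiffOn ℝ ∞ φ (DustPert.slab τ₀) →
        (∀ x, DustPert.ScalarModeEq τ₀ a ρ (fun τ => φ (τ, x))) →
        DustPert.TendsToConstantInTime φ) ∧
      (∀ Z : DustPert.Spacetime → Fin 3 → ℝ, ContDiffOn ℝ ∞ Z (DustPert.slab τ₀) →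
        (∀ x, DustPert.VectorModeEq τ₀ a (fun τ => Z (τ, x))) →
        (∃ C : DustPert.Space → Fin 3 → ℝ, ContDiff ℝ ∞ C ∧
          ∀ τ ∈ Ioo τ₀ 0, ∀ x, Z (τ, x) = (a τ)⁻¹ • C x) ∧
        TendstoLocallyUniformly (fun (τ : ℝ) (x : DustPert.Space) => Z (τ, x)) 0 (𝓝[<] 0)) ∧
      (∀ π : DustPert.Spacetime → ℝ, ContDiffOn ℝ ∞ π (DustPert.slab τ₀) →
        DustPert.TensorModeEq τ₀ a π → DustPert.TendsToConstantInTime π)) ∧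
    -- explicit scalar solutions for the asymptotic scale factor
    (∀ ρ₀ : ℝ, 0 < ρ₀ →
      (∀ φ : DustPert.Spacetime → ℝ, ContDiffOn ℝ ∞ φ (DustPert.slab τ₀) →
        (∀ x, DustPert.ScalarModeEq τ₀ (DustPert.deSitterScale Λ)
          (fun τ => ρ₀ / DustPert.deSitterScale Λ τ ^ 3) (fun τ => φ (τ, x))) →
        ∃ C₁ C₂ : DustPert.Space → ℂ, ContDiff ℝ 2 C₁ ∧ ContDiff ℝ 2 C₂ ∧
          ∀ τ ∈ Ioo τ₀ 0, ∀ x,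
            (φ (τ, x) : ℂ) = DustPert.besselSolution Λ ρ₀ (C₁ x) (C₂ x) τ) ∧
      (∀ C₁ C₂ : ℂ,
        DustPert.ScalarModeEq τ₀ (DustPert.deSitterScale Λ)
          (fun τ => ρ₀ / DustPert.deSitterScale Λ τ ^ 3)
          (DustPert.besselSolution Λ ρ₀ C₁ C₂) ∧
        ∃ c : ℂ, Tendsto (DustPert.besselSolution Λ ρ₀ C₁ C₂) (𝓝[<] 0) (𝓝 c))) ∧
    -- explicit tensor solutions for the asymptotic scale factor
    (∀ q : ℝ, 0 < q → ∀ f : ℝ → ℂ,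
      DustPert.FourierModeEq τ₀ (DustPert.deSitterScale Λ) q f ↔
        ∃ K F : ℂ, ∀ τ ∈ Ioo τ₀ 0, f τ = DustPert.tensorFourierMode K F q τ) ∧
    (∀ K F : DustPert.Space → ℂ,
      Integrable (fun q => ((1 + ‖q‖) ^ 3 : ℝ) • K q) →
      Integrable (fun q => ((1 + ‖q‖) ^ 3 : ℝ) • F q) →
      DustPert.TensorModeEq τ₀ (DustPert.deSitterScale Λ) (DustPert.tensorFourierIntegral K F)) ∧
    (∀ K F : DustPert.Space → ℂ,
      Integrable (fun q => ((1 + ‖q‖) : ℝ) • K q) →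
      Integrable (fun q => ((1 + ‖q‖) : ℝ) • F q) →
      TendstoLocallyUniformly
        (fun (τ : ℝ) (x : DustPert.Space) => DustPert.tensorFourierIntegral K F (τ, x))
        (fun x => ∫ q : DustPert.Space, F q * Complex.exp (-Complex.I * (inner ℝ q x : ℝ)))
        (𝓝[<] 0)) := by
  refine ⟨fun a ρ h => ⟨⟨h.exists_density hτ₀, h.tendsto_scale_div hΛ hτ₀⟩,
      fun γ ρ₁ hγ hsym hE => DustPert.perturbation_asymptotics hΛ hτ₀ h hγ hsym hE,
      fun φ χ Z π ρ₁ hm hE => DustPert.modes_asymptotics hΛ hτ₀ h hm hE,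
      fun φ hφ heq => DustPert.scalarMode_tendsToConstantInTime hΛ hτ₀ h hφ heq,
      fun Z hZ heq => DustPert.vectorMode_asymptotics hτ₀ h hZ heq,
      fun π hπ heq => DustPert.tensorMode_tendsToConstantInTime hΛ hτ₀ h hπ heq⟩,
    fun ρ₀ hρ => ⟨fun φ hφ heq => DustPert.scalarMode_eq_besselSolution hΛ hρ hτ₀ hφ heq,
      fun C₁ C₂ => DustPert.besselSolution_scalarMode hΛ hρ C₁ C₂⟩,
    fun q hq f => DustPert.fourierModeEq_iff hΛ hτ₀ hq f,
    fun K F hK hF => DustPert.tensorFourierIntegral_tensorMode hΛ τ₀ hK hF,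
    fun K F hK hF => DustPert.tensorFourierIntegral_tendsto
      (by simpa [DustPert.HasMoment] using hK) (by simpa [DustPert.HasMoment] using hF)⟩
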